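/- **Conventions.** "Double category" means pseudo double category: arrows and cells compose strictly along proarrows (vertically), while proarrows compose (externally, written $\odot$) associatively and unitally up to coherent globular isomorphism. A set is "small" if it lies in a fixed universe, and "complete"/"cocomplete" means having all small limits/colimits. For a category $\mathsf{S}$ with pullbacks, $\mathbb{S}\mathrm{pan}(\mathsf{S})$ is the double category whose objects and arrows are those of $\mathsf{S}$, whose proarrows $x \nrightarrow y$ are spans $x \leftarrow s \to y$, whose cells are maps of spans, and whose external composition is by pullback. Dually, for $\mathsf{S}$ with pushouts, $\mathbb{C}\mathrm{ospan}(\mathsf{S})$ has cospans $x \to s \leftarrow y$ as proarrows, maps of cospans as cells, and composition by pushout. **Families.** For a double category $\mathbb{D}$, both $\mathbb{F}\mathrm{am}(\mathbb{D})$ and $\mathbb{F}\mathrm{am}^*(\mathbb{D})$ have * as objects $(I,\vec x)$, a small set $I$ with objects $x_i$ of $\mathbb{D}$ for $i\in I$; * as proarrows $(A,\vec m)\colon (I,\vec x)\nrightarrow (J,\vec y)$, a span of small sets $I \xleftarrow{\ell} A \xrightarrow{r} J$ with proarrows $m_a\colon x_{\ell(a)} \nrightarrow y_{r(a)}$ of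 $\mathbb{D}$ for $a \in A$. Proarrows compose by pullback of the indexing spans, $(m\odot n)_{(a,b)} = m_a\odot n_b$, and the identity on $(I,\vec x)$ is the identity span on $I$ with the identity proarrows of the $x_i$. An arrow $(I,\vec x)\to(K,\vec w)$ of $\mathbb{F}\mathrm{am}(\mathbb{D})$ is a function $f_0\colon I\to K$ with arrows $x_i\to w_{f_0(i)}$, $i\in I$; an arrow of $\mathbb{F}\mathrm{am}^*(\mathbb{D})$ is a function $f_0\colon K\to I$ with arrows $x_{f_0(k)}\to w_k$, $k\in K$. Likewise a cell from $(A,\vec m)$ to $(B,\vec n)$ is, in $\mathbb{F}\mathrm{am}(\mathbb{D})$, a map of indexing spans with apex component $\alpha_0\colon A\to B$ and cells $m_a\Rightarrow n_{\alpha_0(a)}$, $a\in A$; in $\mathbb{F}\mathrm{am}^*(\mathbb{D})$, a map of indexing spans in the reverse direction with apex component $\alpha_0\colon B\to A$ and cells $m_{\alpha_0(b)}\Rightarrow n_b$, $b\in B$. The diagonal double functors $\Delta\colon\mathbb{D}\to\mathbb{F}\mathrm{am}(\mathbb{D})$ and $\Delta\colon\mathbb{D}\to\mathbb{F}\mathrm{am}^*(\mathbb{D})$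 send an object or proarrow to the family, indexed by a singleton, consisting of it alone. $\mathbb{D}$ *has lax products* if $\Delta\colon\mathbb{D}\to\mathbb{F}\mathrm{am}^*(\mathbb{D})$ has a lax right adjoint, that is, a right adjoint in the 2-category of double categories, lax double functors and natural transformations. $\mathbb{D}$ *has colax coproducts* if $\Delta\colon\mathbb{D}\to\mathbb{F}\mathrm{am}(\mathbb{D})$ has a colax left adjoint, that is, a left adjoint in the 2-category of double categories, colax double functors and natural transformations. The finite versions use only families indexed by finite sets and by spans of finite sets. **Theorem (Products of spans).** Let $\mathsf{S}$ be a category. 1. If $\mathsf{S}$ is complete, then $\mathbb{S}\mathrm{pan}(\mathsf{S})$ has lax products. If $\mathsf{S}$ is finitely complete, then $\mathbb{S}\mathrm{pan}(\mathsf{S})$ has lax finite products. 2. In both cases, let $\Pi$ be any lax right adjoint of $\Delta$. For every family $(I,\vec x)$ of objects, the counit exhibits $\Pi\vec x$ as the product $\prod_{i\in I}x_i$ in $\mathsf{S}$. For every family of spans $(A,\vec m)\colon(I,\vec x)\nrightarrow(J,\vec y)$ with $m_a = (x_{\ell(a)}\xleftarrow{\ell_a}s_a\xrightarrow{r_a}y_{r(a)})$,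 let $F\colon\{\bullet\leftarrow\bullet\to\bullet\}\to\mathsf{Set}$ be the functor given by the indexing span $I\leftarrow A\to J$, let $\int F$ be its category of elements, and let $M\colon\int F\to\mathsf{S}$ be the diagram consisting of the objects $x_i$ ($i\in I$), $y_j$ ($j\in J$), $s_a$ ($a\in A$) and the arrows $\ell_a$, $r_a$ ($a\in A$). Then the apex of the product span $\Pi\vec x\xleftarrow{\ell}\Pi\vec m\xrightarrow{r}\Pi\vec y$ is the limit $$\Pi\vec m=\lim_{\int F}M,$$ with limit projections $\pi_i\circ\ell$ to $x_i$, $\pi_j\circ r$ to $y_j$, and to $s_a$ the components of the counit cell at $(A,\vec m)$. 3. If $\mathsf{S}$ is cocomplete, then $\mathbb{C}\mathrm{ospan}(\mathsf{S})$ has colax coproducts. If $\mathsf{S}$ is finitely cocomplete, then $\mathbb{C}\mathrm{ospan}(\mathsf{S})$ has colax finite coproducts. -/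

import Mathlib

set_option linter.checkUnivs false

open CategoryTheory CategoryTheory.Limits

universe w u v u₀ v₀ u₁ v₁ u₂ v₂ u₃ v₃ u₄ v₄ u₅ v₅

/-! ### Pseudo double categories -/

/-- The underlying data of a double category: a category of objects and arrows, proarrows between
objects, and cells, each with a left arrow `f`, a right arrow `g`, a domain proarrow `m` and a
codomain proarrow `n`. -/
structure DblQuiver where
  Obj : Type u₀
  [cat : Category.{v₀} Obj]
  Pro : Obj → Obj → Type u₁
  Cell : ∀ {x y w z : Obj}, (x ⟶ w) → (y ⟶ z) → Pro x y → Pro w z → Type v₁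

attribute [instance] DblQuiver.cat

/-- A cell with domain `m` and codomain `n` and arbitrary side arrows: a morphism `m ⟶ n` in
the category of proarrows and cells. Equations between cells whose side arrows agree only
propositionally are stated as equations in this type. -/
structure DblQuiver.Sq (D : DblQuiver.{u₀, v₀, u₁, v₁}) {x y w z : D.Obj}
    (m : D.Pro x y) (n : D.Pro w z) where
  left : x ⟶ w
  right : y ⟶ z
  cell : D.Cell left right m n

/-- A cell, viewed as a morphism in the category of proarrows and cells. -/
abbrev DblQuiver.sq (D : DblQuiver.{u₀, v₀, u₁, v₁}) {x y w z : D.Obj} {f : x ⟶ w} {g : y ⟶ z}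
    {m : D.Pro x y} {n : D.Pro w z} (α : D.Cell f g m n) : D.Sq m n :=
  ⟨f, g, α⟩

/-- A (pseudo) double category. Both compositions are written in diagrammatic order; composition
of arrows and cells (`vcomp`) is strict, composition of proarrows (`hcomp`) is associative and
unital up to coherent globular isomorphism. -/
structure DblCat extends DblQuiver.{u₀, v₀, u₁, v₁} where
  /-- identity cell on a proarrow -/
  vid : ∀ {x y : Obj} (m : Pro x y), Cell (𝟙 x) (𝟙 y) m m
  /-- composition of cells along a proarrow -/
  vcomp : ∀ {x y x' y' x'' y'' : Obj} {f : x ⟶ x'} {g : y ⟶ y'} {f' : x' ⟶ x''} {g' : y' ⟶ y''}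
    {m : Pro x y} {n : Pro x' y'} {p : Pro x'' y''},
    Cell f g m n → Cell f' g' n p → Cell (f ≫ f') (g ≫ g') m p
  vid_vcomp : ∀ {x y w z : Obj} {f : x ⟶ w} {g : y ⟶ z} {m : Pro x y} {n : Pro w z}
    (α : Cell f g m n), toDblQuiver.sq (vcomp (vid m) α) = toDblQuiver.sq α
  vcomp_vid : ∀ {x y w z : Obj} {f : x ⟶ w} {g : y ⟶ z} {m : Pro x y} {n : Pro w z}
    (α : Cell f g m n), toDblQuiver.sq (vcomp α (vid n)) = toDblQuiver.sq α
  vcomp_assoc : ∀ {x₀ y₀ x₁ y₁ x₂ y₂ x₃ y₃ : Obj} {f₁ : x₀ ⟶ x₁} {g₁ : y₀ ⟶ y₁}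
    {f₂ : x₁ ⟶ x₂} {g₂ : y₁ ⟶ y₂} {f₃ : x₂ ⟶ x₃} {g₃ : y₂ ⟶ y₃}
    {m₀ : Pro x₀ y₀} {m₁ : Pro x₁ y₁} {m₂ : Pro x₂ y₂} {m₃ : Pro x₃ y₃}
    (α : Cell f₁ g₁ m₀ m₁) (β : Cell f₂ g₂ m₁ m₂) (γ : Cell f₃ g₃ m₂ m₃),
    toDblQuiver.sq (vcomp (vcomp α β) γ) = toDblQuiver.sq (vcomp α (vcomp β γ))
  /-- identity proarrow -/
  hid : ∀ x : Obj, Pro x x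
  /-- identity cell on an arrow -/
  hidCell : ∀ {x y : Obj} (f : x ⟶ y), Cell f f (hid x) (hid y)
  /-- external composition of proarrows -/
  hcomp : ∀ {x y z : Obj}, Pro x y → Pro y z → Pro x z
  /-- external composition of cells -/
  hcompCell : ∀ {x y z x' y' z' : Obj} {f : x ⟶ x'} {g : y ⟶ y'} {h : z ⟶ z'}
    {m : Pro x y} {n : Pro y z} {m' : Pro x' y'} {n' : Pro y' z'},
    Cell f g m m' → Cell g h n n' → Cell f h (hcomp m n) (hcomp m' n')
  hidCell_id : ∀ x : Obj, hidCell (𝟙 x) = vid (hid x)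
  hidCell_comp : ∀ {x y z : Obj} (f : x ⟶ y) (g : y ⟶ z),
    hidCell (f ≫ g) = vcomp (hidCell f) (hidCell g)
  hcompCell_vid : ∀ {x y z : Obj} (m : Pro x y) (n : Pro y z),
    hcompCell (vid m) (vid n) = vid (hcomp m n)
  interchange : ∀ {x y z x' y' z' x'' y'' z'' : Obj} {f : x ⟶ x'} {g : y ⟶ y'} {h : z ⟶ z'}
    {f' : x' ⟶ x''} {g' : y' ⟶ y''} {h' : z' ⟶ z''}
    {m : Pro x y} {n : Pro y z} {m' : Pro x' y'} {n' : Pro y' z'}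
    {m'' : Pro x'' y''} {n'' : Pro y'' z''}
    (α : Cell f g m m') (β : Cell g h n n') (α' : Cell f' g' m' m'') (β' : Cell g' h' n' n''),
    hcompCell (vcomp α α') (vcomp β β') = vcomp (hcompCell α β) (hcompCell α' β')
  /-- associator and its inverse -/
  assocHom : ∀ {x y z t : Obj} (m : Pro x y) (n : Pro y z) (p : Pro z t),
    Cell (𝟙 x) (𝟙 t) (hcomp (hcomp m n) p) (hcomp m (hcomp n p))
  assocInv : ∀ {x y z t : Obj} (m : Pro x y) (n : Pro y z) (p : Pro z t),
    Cell (𝟙 x) (𝟙 t) (hcomp m (hcomp n p)) (hcomp (hcomp m n) p)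
  /-- left unitor and its inverse -/
  lunitHom : ∀ {x y : Obj} (m : Pro x y), Cell (𝟙 x) (𝟙 y) (hcomp (hid x) m) m
  lunitInv : ∀ {x y : Obj} (m : Pro x y), Cell (𝟙 x) (𝟙 y) m (hcomp (hid x) m)
  /-- right unitor and its inverse -/
  runitHom : ∀ {x y : Obj} (m : Pro x y), Cell (𝟙 x) (𝟙 y) (hcomp m (hid y)) m
  runitInv : ∀ {x y : Obj} (m : Pro x y), Cell (𝟙 x) (𝟙 y) m (hcomp m (hid y))
  assoc_hom_inv : ∀ {x y z t : Obj} (m : Pro x y) (n : Pro y z) (p : Pro z t),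
    toDblQuiver.sq (vcomp (assocHom m n p) (assocInv m n p)) =
      toDblQuiver.sq (vid (hcomp (hcomp m n) p))
  assoc_inv_hom : ∀ {x y z t : Obj} (m : Pro x y) (n : Pro y z) (p : Pro z t),
    toDblQuiver.sq (vcomp (assocInv m n p) (assocHom m n p)) =
      toDblQuiver.sq (vid (hcomp m (hcomp n p)))
  lunit_hom_inv : ∀ {x y : Obj} (m : Pro x y),
    toDblQuiver.sq (vcomp (lunitHom m) (lunitInv m)) = toDblQuiver.sq (vid (hcomp (hid x) m))
  lunit_inv_hom : ∀ {x y : Obj} (m : Pro x y),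
    toDblQuiver.sq (vcomp (lunitInv m) (lunitHom m)) = toDblQuiver.sq (vid m)
  runit_hom_inv : ∀ {x y : Obj} (m : Pro x y),
    toDblQuiver.sq (vcomp (runitHom m) (runitInv m)) = toDblQuiver.sq (vid (hcomp m (hid y)))
  runit_inv_hom : ∀ {x y : Obj} (m : Pro x y),
    toDblQuiver.sq (vcomp (runitInv m) (runitHom m)) = toDblQuiver.sq (vid m)
  assoc_naturality : ∀ {x y z t x' y' z' t' : Obj} {f : x ⟶ x'} {g : y ⟶ y'} {h : z ⟶ z'}
    {k : t ⟶ t'} {m : Pro x y} {n : Pro y z} {p : Pro z t}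
    {m' : Pro x' y'} {n' : Pro y' z'} {p' : Pro z' t'}
    (α : Cell f g m m') (β : Cell g h n n') (γ : Cell h k p p'),
    toDblQuiver.sq (vcomp (hcompCell (hcompCell α β) γ) (assocHom m' n' p')) =
      toDblQuiver.sq (vcomp (assocHom m n p) (hcompCell α (hcompCell β γ)))
  lunit_naturality : ∀ {x y x' y' : Obj} {f : x ⟶ x'} {g : y ⟶ y'} {m : Pro x y}
    {m' : Pro x' y'} (α : Cell f g m m'),
    toDblQuiver.sq (vcomp (hcompCell (hidCell f) α) (lunitHom m')) =
      toDblQuiver.sq (vcomp (lunitHom m) α)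
  runit_naturality : ∀ {x y x' y' : Obj} {f : x ⟶ x'} {g : y ⟶ y'} {m : Pro x y}
    {m' : Pro x' y'} (α : Cell f g m m'),
    toDblQuiver.sq (vcomp (hcompCell α (hidCell g)) (runitHom m')) =
      toDblQuiver.sq (vcomp (runitHom m) α)
  pentagon : ∀ {x y z t s : Obj} (m : Pro x y) (n : Pro y z) (p : Pro z t) (q : Pro t s),
    toDblQuiver.sq (vcomp (hcompCell (assocHom m n p) (vid q))
      (vcomp (assocHom m (hcomp n p) q) (hcompCell (vid m) (assocHom n p q)))) =
      toDblQuiver.sq (vcomp (assocHom (hcomp m n) p q) (assocHom m n (hcomp p q)))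
  triangle : ∀ {x y z : Obj} (m : Pro x y) (n : Pro y z),
    toDblQuiver.sq (vcomp (assocHom m (hid y) n) (hcompCell (vid m) (lunitHom n))) =
      toDblQuiver.sq (hcompCell (runitHom m) (vid n))

namespace DblCat

section Lemmas

variable {D : DblCat.{u₀, v₀, u₁, v₁}}

theorem heq_of_sq {x y w z : D.Obj} {f f' : x ⟶ w} {g g' : y ⟶ z} {m : D.Pro x y}
    {n : D.Pro w z} {α : D.Cell f g m n} {β : D.Cell f' g' m n} (h : D.sq α = D.sq β) :
    HEq α β := by
  injection h

theorem sq_of_heq {x y w z : D.Obj} {f f' : x ⟶ w} {g g' : y ⟶ z} {m : D.Pro x y}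
    {n : D.Pro w z} {α : D.Cell f g m n} {β : D.Cell f' g' m n} (hf : f = f') (hg : g = g')
    (h : HEq α β) : D.sq α = D.sq β := by
  subst hf hg; cases h; rfl

theorem vcomp_congr {x y x' y' x'' y'' : D.Obj} {f₁ f₂ : x ⟶ x'} {g₁ g₂ : y ⟶ y'}
    {f₁' f₂' : x' ⟶ x''} {g₁' g₂' : y' ⟶ y''} {m : D.Pro x y} {n : D.Pro x' y'}
    {p : D.Pro x'' y''} {α₁ : D.Cell f₁ g₁ m n} {α₂ : D.Cell f₂ g₂ m n}
    {β₁ : D.Cell f₁' g₁' n p} {β₂ : D.Cell f₂' g₂' n p}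
    (h : D.sq α₁ = D.sq α₂) (h' : D.sq β₁ = D.sq β₂) :
    D.sq (D.vcomp α₁ β₁) = D.sq (D.vcomp α₂ β₂) := by
  cases h; cases h'; rfl

theorem hcompCell_congr {x y z x' y' z' : D.Obj} {f₁ f₂ : x ⟶ x'} {g₁ g₂ : y ⟶ y'}
    {h₁ h₂ : z ⟶ z'} {m : D.Pro x y} {n : D.Pro y z} {m' : D.Pro x' y'} {n' : D.Pro y' z'}
    {α₁ : D.Cell f₁ g₁ m m'} {α₂ : D.Cell f₂ g₂ m m'}
    {β₁ : D.Cell g₁ h₁ n n'} {β₂ : D.Cell g₂ h₂ n n'}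
    (h : D.sq α₁ = D.sq α₂) (h' : D.sq β₁ = D.sq β₂) :
    D.sq (D.hcompCell α₁ β₁) = D.sq (D.hcompCell α₂ β₂) := by
  cases h; cases h'; rfl

/-- Transport of a cell along equalities of its side arrows. -/
def recast {x y w z : D.Obj} {f f' : x ⟶ w} {g g' : y ⟶ z} {m : D.Pro x y}
    {n : D.Pro w z} (hf : f = f') (hg : g = g') (α : D.Cell f g m n) : D.Cell f' g' m n :=
  hf ▸ hg ▸ α

@[simp]
theorem sq_recast {x y w z : D.Obj} {f f' : x ⟶ w} {g g' : y ⟶ z} {m : D.Pro x y}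
    {n : D.Pro w z} (hf : f = f') (hg : g = g') (α : D.Cell f g m n) :
    D.sq (recast hf hg α) = D.sq α := by
  subst hf hg; rfl

end Lemmas

/-- The objects of the category of proarrows and cells of a double category. -/
structure Proarrow (D : DblCat.{u₀, v₀, u₁, v₁}) where
  {src : D.Obj}
  {tgt : D.Obj}
  pro : D.Pro src tgt

/-- The category of proarrows and cells of a double category. -/
instance (D : DblCat.{u₀, v₀, u₁, v₁}) : Category (Proarrow D) where
  Hom P Q := D.Sq P.pro Q.pro
  id P := D.sq (D.vid P.pro)
  comp S T := D.sq (D.vcomp S.cell T.cell)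
  id_comp S := D.vid_vcomp S.cell
  comp_id S := D.vcomp_vid S.cell
  assoc S T U := D.vcomp_assoc S.cell T.cell U.cell

end DblCat

namespace DblCat

/-- A cell, as a morphism in the category of proarrows and cells. -/
abbrev hom {D : DblCat.{u₀, v₀, u₁, v₁}} {x y w z : D.Obj} {f : x ⟶ w} {g : y ⟶ z}
    {m : D.Pro x y} {n : D.Pro w z} (α : D.Cell f g m n) :
    (Proarrow.mk m : Proarrow D) ⟶ Proarrow.mk n :=
  D.sq α

theorem hom_vcomp {D : DblCat.{u₀, v₀, u₁, v₁}} {x y x' y' x'' y'' : D.Obj} {f : x ⟶ x'}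
    {g : y ⟶ y'} {f' : x' ⟶ x''} {g' : y' ⟶ y''} {m : D.Pro x y} {n : D.Pro x' y'}
    {p : D.Pro x'' y''} (α : D.Cell f g m n) (β : D.Cell f' g' n p) :
    hom (D.vcomp α β) = hom α ≫ hom β :=
  rfl

theorem hom_vid {D : DblCat.{u₀, v₀, u₁, v₁}} {x y : D.Obj} (m : D.Pro x y) :
    hom (D.vid m) = 𝟙 (Proarrow.mk m) :=
  rfl

theorem hom_recast {D : DblCat.{u₀, v₀, u₁, v₁}} {x y w z : D.Obj} {f f' : x ⟶ w} {g g' : y ⟶ z}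
    {m : D.Pro x y} {n : D.Pro w z} (hf : f = f') (hg : g = g') (α : D.Cell f g m n) :
    hom (recast hf hg α) = hom α :=
  sq_recast hf hg α

end DblCat

/-! ### Lax and colax double functors, natural transformations, adjunctions -/

/-- A lax double functor. -/
structure LaxDblFunctor (D : DblCat.{u₀, v₀, u₁, v₁}) (E : DblCat.{u₂, v₂, u₃, v₃}) where
  obj : D.Obj → E.Obj
  map : ∀ {x y : D.Obj}, (x ⟶ y) → (obj x ⟶ obj y)
  pro : ∀ {x y : D.Obj}, D.Pro x y → E.Pro (obj x) (obj y)
  cell : ∀ {x y w z : D.Obj} {f : x ⟶ w} {g : y ⟶ z} {m : D.Pro x y} {n : D.Pro w z},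
    D.Cell f g m n → E.Cell (map f) (map g) (pro m) (pro n)
  map_id : ∀ x : D.Obj, map (𝟙 x) = 𝟙 (obj x)
  map_comp : ∀ {x y z : D.Obj} (f : x ⟶ y) (g : y ⟶ z), map (f ≫ g) = map f ≫ map g
  cell_vid : ∀ {x y : D.Obj} (m : D.Pro x y), E.sq (cell (D.vid m)) = E.sq (E.vid (pro m))
  cell_vcomp : ∀ {x y x' y' x'' y'' : D.Obj} {f : x ⟶ x'} {g : y ⟶ y'} {f' : x' ⟶ x''}
    {g' : y' ⟶ y''} {m : D.Pro x y} {n : D.Pro x' y'} {p : D.Pro x'' y''}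
    (α : D.Cell f g m n) (β : D.Cell f' g' n p),
    E.sq (cell (D.vcomp α β)) = E.sq (E.vcomp (cell α) (cell β))
  /-- composition comparison -/
  laxComp : ∀ {x y z : D.Obj} (m : D.Pro x y) (n : D.Pro y z),
    E.Cell (𝟙 (obj x)) (𝟙 (obj z)) (E.hcomp (pro m) (pro n)) (pro (D.hcomp m n))
  /-- identity comparison -/
  laxId : ∀ x : D.Obj, E.Cell (𝟙 (obj x)) (𝟙 (obj x)) (E.hid (obj x)) (pro (D.hid x))
  laxComp_naturality : ∀ {x y z x' y' z' : D.Obj} {f : x ⟶ x'} {g : y ⟶ y'} {h : z ⟶ z'}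
    {m : D.Pro x y} {n : D.Pro y z} {m' : D.Pro x' y'} {n' : D.Pro y' z'}
    (α : D.Cell f g m m') (β : D.Cell g h n n'),
    E.sq (E.vcomp (E.hcompCell (cell α) (cell β)) (laxComp m' n')) =
      E.sq (E.vcomp (laxComp m n) (cell (D.hcompCell α β)))
  laxId_naturality : ∀ {x y : D.Obj} (f : x ⟶ y),
    E.sq (E.vcomp (E.hidCell (map f)) (laxId y)) = E.sq (E.vcomp (laxId x) (cell (D.hidCell f)))
  associativity : ∀ {x y z t : D.Obj} (m : D.Pro x y) (n : D.Pro y z) (p : D.Pro z t),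
    E.sq (E.vcomp (E.hcompCell (laxComp m n) (E.vid (pro p)))
      (E.vcomp (laxComp (D.hcomp m n) p) (cell (D.assocHom m n p)))) =
    E.sq (E.vcomp (E.assocHom (pro m) (pro n) (pro p))
      (E.vcomp (E.hcompCell (E.vid (pro m)) (laxComp n p)) (laxComp m (D.hcomp n p))))
  left_unitality : ∀ {x y : D.Obj} (m : D.Pro x y),
    E.sq (E.vcomp (E.hcompCell (laxId x) (E.vid (pro m)))
      (E.vcomp (laxComp (D.hid x) m) (cell (D.lunitHom m)))) = E.sq (E.lunitHom (pro m))
  right_unitality : ∀ {x y : D.Obj} (m : D.Pro x y),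
    E.sq (E.vcomp (E.hcompCell (E.vid (pro m)) (laxId y))
      (E.vcomp (laxComp m (D.hid y)) (cell (D.runitHom m)))) = E.sq (E.runitHom (pro m))

/-- A colax double functor. -/
structure ColaxDblFunctor (D : DblCat.{u₀, v₀, u₁, v₁}) (E : DblCat.{u₂, v₂, u₃, v₃}) where
  obj : D.Obj → E.Obj
  map : ∀ {x y : D.Obj}, (x ⟶ y) → (obj x ⟶ obj y)
  pro : ∀ {x y : D.Obj}, D.Pro x y → E.Pro (obj x) (obj y)
  cell : ∀ {x y w z : D.Obj} {f : x ⟶ w} {g : y ⟶ z} {m : D.Pro x y} {n : D.Pro w z},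
    D.Cell f g m n → E.Cell (map f) (map g) (pro m) (pro n)
  map_id : ∀ x : D.Obj, map (𝟙 x) = 𝟙 (obj x)
  map_comp : ∀ {x y z : D.Obj} (f : x ⟶ y) (g : y ⟶ z), map (f ≫ g) = map f ≫ map g
  cell_vid : ∀ {x y : D.Obj} (m : D.Pro x y), E.sq (cell (D.vid m)) = E.sq (E.vid (pro m))
  cell_vcomp : ∀ {x y x' y' x'' y'' : D.Obj} {f : x ⟶ x'} {g : y ⟶ y'} {f' : x' ⟶ x''}
    {g' : y' ⟶ y''} {m : D.Pro x y} {n : D.Pro x' y'} {p : D.Pro x'' y''}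
    (α : D.Cell f g m n) (β : D.Cell f' g' n p),
    E.sq (cell (D.vcomp α β)) = E.sq (E.vcomp (cell α) (cell β))
  /-- composition comparison -/
  colaxComp : ∀ {x y z : D.Obj} (m : D.Pro x y) (n : D.Pro y z),
    E.Cell (𝟙 (obj x)) (𝟙 (obj z)) (pro (D.hcomp m n)) (E.hcomp (pro m) (pro n))
  /-- identity comparison -/
  colaxId : ∀ x : D.Obj, E.Cell (𝟙 (obj x)) (𝟙 (obj x)) (pro (D.hid x)) (E.hid (obj x))
  colaxComp_naturality : ∀ {x y z x' y' z' : D.Obj} {f : x ⟶ x'} {g : y ⟶ y'} {h : z ⟶ z'}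
    {m : D.Pro x y} {n : D.Pro y z} {m' : D.Pro x' y'} {n' : D.Pro y' z'}
    (α : D.Cell f g m m') (β : D.Cell g h n n'),
    E.sq (E.vcomp (colaxComp m n) (E.hcompCell (cell α) (cell β))) =
      E.sq (E.vcomp (cell (D.hcompCell α β)) (colaxComp m' n'))
  colaxId_naturality : ∀ {x y : D.Obj} (f : x ⟶ y),
    E.sq (E.vcomp (colaxId x) (E.hidCell (map f))) =
      E.sq (E.vcomp (cell (D.hidCell f)) (colaxId y))
  associativity : ∀ {x y z t : D.Obj} (m : D.Pro x y) (n : D.Pro y z) (p : D.Pro z t),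
    E.sq (E.vcomp (colaxComp (D.hcomp m n) p)
      (E.vcomp (E.hcompCell (colaxComp m n) (E.vid (pro p)))
        (E.assocHom (pro m) (pro n) (pro p)))) =
    E.sq (E.vcomp (cell (D.assocHom m n p))
      (E.vcomp (colaxComp m (D.hcomp n p)) (E.hcompCell (E.vid (pro m)) (colaxComp n p))))
  left_unitality : ∀ {x y : D.Obj} (m : D.Pro x y),
    E.sq (E.vcomp (colaxComp (D.hid x) m)
      (E.vcomp (E.hcompCell (colaxId x) (E.vid (pro m))) (E.lunitHom (pro m)))) =
    E.sq (cell (D.lunitHom m))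
  right_unitality : ∀ {x y : D.Obj} (m : D.Pro x y),
    E.sq (E.vcomp (colaxComp m (D.hid y))
      (E.vcomp (E.hcompCell (E.vid (pro m)) (colaxId y)) (E.runitHom (pro m)))) =
    E.sq (cell (D.runitHom m))

namespace LaxDblFunctor

variable {D : DblCat.{u₀, v₀, u₁, v₁}} {E : DblCat.{u₂, v₂, u₃, v₃}} {K : DblCat.{u₄, v₄, u₅, v₅}}

theorem cell_congr (F : LaxDblFunctor D E) {x y w z : D.Obj} {f f' : x ⟶ w} {g g' : y ⟶ z}
    {m : D.Pro x y} {n : D.Pro w z} {α : D.Cell f g m n} {β : D.Cell f' g' m n}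
    (h : D.sq α = D.sq β) : E.sq (F.cell α) = E.sq (F.cell β) := by
  cases h; rfl

/-- The identity double functor, as a lax functor. -/
def id (D : DblCat.{u₀, v₀, u₁, v₁}) : LaxDblFunctor D D where
  obj x := x
  map f := f
  pro m := m
  cell α := α
  map_id _ := rfl
  map_comp _ _ := rfl
  cell_vid _ := rfl
  cell_vcomp _ _ := rfl
  laxComp m n := D.vid (D.hcomp m n)
  laxId x := D.vid (D.hid x)
  laxComp_naturality α β := (D.vcomp_vid _).trans (D.vid_vcomp _).symm
  laxId_naturality f := (D.vcomp_vid _).trans (D.vid_vcomp _).symm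
  associativity m n p := by
    rw [D.hcompCell_vid, D.hcompCell_vid]
    refine ((D.vid_vcomp _).trans (D.vid_vcomp _)).trans ?_
    exact ((DblCat.vcomp_congr rfl (D.vid_vcomp _)).trans (D.vcomp_vid _)).symm
  left_unitality m := by
    rw [D.hcompCell_vid]
    exact (D.vid_vcomp _).trans (D.vid_vcomp _)
  right_unitality m := by
    rw [D.hcompCell_vid]
    exact (D.vid_vcomp _).trans (D.vid_vcomp _)

theorem hom_cell_vcomp (F : LaxDblFunctor D E) {x y x' y' x'' y'' : D.Obj} {f : x ⟶ x'}
    {g : y ⟶ y'} {f' : x' ⟶ x''} {g' : y' ⟶ y''} {m : D.Pro x y} {n : D.Pro x' y'}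
    {p : D.Pro x'' y''} (α : D.Cell f g m n) (β : D.Cell f' g' n p) :
    DblCat.hom (F.cell (D.vcomp α β)) = DblCat.hom (F.cell α) ≫ DblCat.hom (F.cell β) :=
  F.cell_vcomp α β

theorem comp_whisker_right (G : LaxDblFunctor E K) {x y z : E.Obj}
    {m m' : E.Pro x y} {n : E.Pro y z} {a : K.Pro (G.obj x) (G.obj y)}
    (α : K.Cell (𝟙 _) (𝟙 _) a (G.pro m)) (β : E.Cell (𝟙 _) (𝟙 _) m m')
    (hf : 𝟙 (G.obj x) ≫ G.map (𝟙 x) = 𝟙 (G.obj x)) (hg : 𝟙 (G.obj y) ≫ G.map (𝟙 y) = 𝟙 (G.obj y)) :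
    DblCat.hom (K.hcompCell (DblCat.recast hf hg (K.vcomp α (G.cell β))) (K.vid (G.pro n))) =
      DblCat.hom (K.hcompCell α (K.vid (G.pro n))) ≫
        DblCat.hom (K.hcompCell (G.cell β) (G.cell (E.vid n))) := by
  rw [← DblCat.hom_vcomp, ← K.interchange]
  refine DblCat.hcompCell_congr (DblCat.sq_recast _ _ _) ?_
  exact ((K.vid_vcomp _).trans (G.cell_vid _)).symm

theorem comp_whisker_left (G : LaxDblFunctor E K) {x y z : E.Obj}
    {m : E.Pro x y} {n n' : E.Pro y z} {a : K.Pro (G.obj y) (G.obj z)}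
    (α : K.Cell (𝟙 _) (𝟙 _) a (G.pro n)) (β : E.Cell (𝟙 _) (𝟙 _) n n')
    (hf : 𝟙 (G.obj y) ≫ G.map (𝟙 y) = 𝟙 (G.obj y)) (hg : 𝟙 (G.obj z) ≫ G.map (𝟙 z) = 𝟙 (G.obj z)) :
    DblCat.hom (K.hcompCell (K.vid (G.pro m)) (DblCat.recast hf hg (K.vcomp α (G.cell β)))) =
      DblCat.hom (K.hcompCell (K.vid (G.pro m)) α) ≫
        DblCat.hom (K.hcompCell (G.cell (E.vid m)) (G.cell β)) := by
  rw [← DblCat.hom_vcomp, ← K.interchange]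
  refine DblCat.hcompCell_congr ?_ (DblCat.sq_recast _ _ _)
  exact ((K.vid_vcomp _).trans (G.cell_vid _)).symm

theorem hom_laxComp_naturality (G : LaxDblFunctor D E) {x y z x' y' z' : D.Obj} {f : x ⟶ x'}
    {g : y ⟶ y'} {h : z ⟶ z'} {m : D.Pro x y} {n : D.Pro y z} {m' : D.Pro x' y'}
    {n' : D.Pro y' z'} (α : D.Cell f g m m') (β : D.Cell g h n n') :
    DblCat.hom (E.hcompCell (G.cell α) (G.cell β)) ≫ DblCat.hom (G.laxComp m' n') =
      DblCat.hom (G.laxComp m n) ≫ DblCat.hom (G.cell (D.hcompCell α β)) :=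
  G.laxComp_naturality α β

/-- Composition of lax double functors, in diagrammatic order. -/
def comp (F : LaxDblFunctor D E) (G : LaxDblFunctor E K) : LaxDblFunctor D K where
  obj x := G.obj (F.obj x)
  map f := G.map (F.map f)
  pro m := G.pro (F.pro m)
  cell α := G.cell (F.cell α)
  map_id x := by rw [F.map_id, G.map_id]
  map_comp f g := by rw [F.map_comp, G.map_comp]
  cell_vid m := (G.cell_congr (F.cell_vid m)).trans (G.cell_vid _)
  cell_vcomp α β := (G.cell_congr (F.cell_vcomp α β)).trans (G.cell_vcomp _ _)
  laxComp m n := DblCat.recast (by simp [G.map_id]) (by simp [G.map_id])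
    (K.vcomp (G.laxComp (F.pro m) (F.pro n)) (G.cell (F.laxComp m n)))
  laxId x := DblCat.recast (by simp [G.map_id]) (by simp [G.map_id])
    (K.vcomp (G.laxId (F.obj x)) (G.cell (F.laxId x)))
  laxComp_naturality {x y z x' y' z' f g h m n m' n'} α β := by
    change DblCat.hom _ ≫ DblCat.hom (DblCat.recast _ _ _) =
      DblCat.hom (DblCat.recast _ _ _) ≫ DblCat.hom _
    rw [DblCat.hom_recast, DblCat.hom_recast, DblCat.hom_vcomp, DblCat.hom_vcomp,
      ← Category.assoc, G.hom_laxComp_naturality, Category.assoc, Category.assoc]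
    congr 1
    rw [← G.hom_cell_vcomp, ← G.hom_cell_vcomp]
    exact G.cell_congr (F.laxComp_naturality α β)
  laxId_naturality {x y} f := by
    change DblCat.hom _ ≫ DblCat.hom (DblCat.recast _ _ _) =
      DblCat.hom (DblCat.recast _ _ _) ≫ DblCat.hom _
    rw [DblCat.hom_recast, DblCat.hom_recast, DblCat.hom_vcomp, DblCat.hom_vcomp,
      ← Category.assoc]
    have h : DblCat.hom (K.hidCell (G.map (F.map f))) ≫ DblCat.hom (G.laxId (F.obj y)) =
      DblCat.hom (G.laxId (F.obj x)) ≫ DblCat.hom (G.cell (E.hidCell (F.map f))) :=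
      G.laxId_naturality (F.map f)
    rw [h, Category.assoc, Category.assoc]
    congr 1
    rw [← G.hom_cell_vcomp, ← G.hom_cell_vcomp]
    exact G.cell_congr (F.laxId_naturality f)
  associativity m n p := by
    change DblCat.hom _ ≫ DblCat.hom (DblCat.recast _ _ _) ≫ DblCat.hom _ =
      DblCat.hom _ ≫ DblCat.hom _ ≫ DblCat.hom (DblCat.recast _ _ _)
    rw [DblCat.hom_recast, DblCat.hom_recast, comp_whisker_right, comp_whisker_left,
      DblCat.hom_vcomp, DblCat.hom_vcomp]
    simp only [Category.assoc]
    have e₁ := G.hom_laxComp_naturality (F.laxComp m n) (E.vid (F.pro p))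
    have e₂ := G.hom_laxComp_naturality (E.vid (F.pro m)) (F.laxComp n p)
    rw [reassoc_of% e₁, reassoc_of% e₂]
    have e₃ : DblCat.hom (K.hcompCell (G.laxComp (F.pro m) (F.pro n)) (K.vid (G.pro (F.pro p)))) ≫
        DblCat.hom (G.laxComp (E.hcomp (F.pro m) (F.pro n)) (F.pro p)) ≫
          DblCat.hom (G.cell (E.assocHom (F.pro m) (F.pro n) (F.pro p))) =
        DblCat.hom (K.assocHom (G.pro (F.pro m)) (G.pro (F.pro n)) (G.pro (F.pro p))) ≫
          DblCat.hom (K.hcompCell (K.vid (G.pro (F.pro m))) (G.laxComp (F.pro n) (F.pro p))) ≫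
            DblCat.hom (G.laxComp (F.pro m) (E.hcomp (F.pro n) (F.pro p))) :=
      G.associativity _ _ _
    rw [← reassoc_of% e₃]
    congr 2
    simp only [← G.hom_cell_vcomp]
    exact G.cell_congr (F.associativity m n p)
  left_unitality {x y} m := by
    change DblCat.hom _ ≫ DblCat.hom (DblCat.recast _ _ _) ≫ DblCat.hom _ = DblCat.hom _
    rw [DblCat.hom_recast, comp_whisker_right, DblCat.hom_vcomp]
    simp only [Category.assoc]
    have e₁ := G.hom_laxComp_naturality (F.laxId x) (E.vid (F.pro m))
    rw [reassoc_of% e₁]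
    have e₂ : DblCat.hom (K.hcompCell (G.laxId (F.obj x)) (K.vid (G.pro (F.pro m)))) ≫
        DblCat.hom (G.laxComp (E.hid (F.obj x)) (F.pro m)) ≫
          DblCat.hom (G.cell (E.lunitHom (F.pro m))) =
        DblCat.hom (K.lunitHom (G.pro (F.pro m))) := G.left_unitality _
    rw [← e₂]
    congr 2
    simp only [← G.hom_cell_vcomp]
    exact G.cell_congr (F.left_unitality m)
  right_unitality {x y} m := by
    change DblCat.hom _ ≫ DblCat.hom (DblCat.recast _ _ _) ≫ DblCat.hom _ = DblCat.hom _
    rw [DblCat.hom_recast, comp_whisker_left, DblCat.hom_vcomp]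
    simp only [Category.assoc]
    have e₁ := G.hom_laxComp_naturality (E.vid (F.pro m)) (F.laxId y)
    rw [reassoc_of% e₁]
    have e₂ : DblCat.hom (K.hcompCell (K.vid (G.pro (F.pro m))) (G.laxId (F.obj y))) ≫
        DblCat.hom (G.laxComp (F.pro m) (E.hid (F.obj y))) ≫
          DblCat.hom (G.cell (E.runitHom (F.pro m))) =
        DblCat.hom (K.runitHom (G.pro (F.pro m))) := G.right_unitality _
    rw [← e₂]
    congr 2
    simp only [← G.hom_cell_vcomp]
    exact G.cell_congr (F.right_unitality m)

end LaxDblFunctor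

namespace ColaxDblFunctor

variable {D : DblCat.{u₀, v₀, u₁, v₁}} {E : DblCat.{u₂, v₂, u₃, v₃}} {K : DblCat.{u₄, v₄, u₅, v₅}}

theorem cell_congr (F : ColaxDblFunctor D E) {x y w z : D.Obj} {f f' : x ⟶ w} {g g' : y ⟶ z}
    {m : D.Pro x y} {n : D.Pro w z} {α : D.Cell f g m n} {β : D.Cell f' g' m n}
    (h : D.sq α = D.sq β) : E.sq (F.cell α) = E.sq (F.cell β) := by
  cases h; rfl

/-- The identity double functor, as a colax functor. -/
def id (D : DblCat.{u₀, v₀, u₁, v₁}) : ColaxDblFunctor D D where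
  obj x := x
  map f := f
  pro m := m
  cell α := α
  map_id _ := rfl
  map_comp _ _ := rfl
  cell_vid _ := rfl
  cell_vcomp _ _ := rfl
  colaxComp m n := D.vid (D.hcomp m n)
  colaxId x := D.vid (D.hid x)
  colaxComp_naturality α β := (D.vid_vcomp _).trans (D.vcomp_vid _).symm
  colaxId_naturality f := (D.vid_vcomp _).trans (D.vcomp_vid _).symm
  associativity m n p := by
    rw [D.hcompCell_vid, D.hcompCell_vid]
    refine ((D.vid_vcomp _).trans (D.vid_vcomp _)).trans ?_
    exact ((DblCat.vcomp_congr rfl (D.vid_vcomp _)).trans (D.vcomp_vid _)).symm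
  left_unitality m := by
    rw [D.hcompCell_vid]
    exact (D.vid_vcomp _).trans (D.vid_vcomp _)
  right_unitality m := by
    rw [D.hcompCell_vid]
    exact (D.vid_vcomp _).trans (D.vid_vcomp _)

theorem hom_cell_vcomp (F : ColaxDblFunctor D E) {x y x' y' x'' y'' : D.Obj} {f : x ⟶ x'}
    {g : y ⟶ y'} {f' : x' ⟶ x''} {g' : y' ⟶ y''} {m : D.Pro x y} {n : D.Pro x' y'}
    {p : D.Pro x'' y''} (α : D.Cell f g m n) (β : D.Cell f' g' n p) :
    DblCat.hom (F.cell (D.vcomp α β)) = DblCat.hom (F.cell α) ≫ DblCat.hom (F.cell β) :=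
  F.cell_vcomp α β

theorem comp_whisker_right (G : ColaxDblFunctor E K) {x y z : E.Obj}
    {m m' : E.Pro x y} {n : E.Pro y z} {a : K.Pro (G.obj x) (G.obj y)}
    (α : K.Cell (𝟙 _) (𝟙 _) (G.pro m') a) (β : E.Cell (𝟙 _) (𝟙 _) m m')
    (hf : G.map (𝟙 x) ≫ 𝟙 (G.obj x) = 𝟙 (G.obj x))
    (hg : G.map (𝟙 y) ≫ 𝟙 (G.obj y) = 𝟙 (G.obj y)) :
    DblCat.hom (K.hcompCell (DblCat.recast hf hg (K.vcomp (G.cell β) α)) (K.vid (G.pro n))) =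
      DblCat.hom (K.hcompCell (G.cell β) (G.cell (E.vid n))) ≫
        DblCat.hom (K.hcompCell α (K.vid (G.pro n))) := by
  rw [← DblCat.hom_vcomp, ← K.interchange]
  refine DblCat.hcompCell_congr (DblCat.sq_recast _ _ _) ?_
  exact ((K.vcomp_vid _).trans (G.cell_vid _)).symm

theorem comp_whisker_left (G : ColaxDblFunctor E K) {x y z : E.Obj}
    {m : E.Pro x y} {n n' : E.Pro y z} {a : K.Pro (G.obj y) (G.obj z)}
    (α : K.Cell (𝟙 _) (𝟙 _) (G.pro n') a) (β : E.Cell (𝟙 _) (𝟙 _) n n')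
    (hf : G.map (𝟙 y) ≫ 𝟙 (G.obj y) = 𝟙 (G.obj y))
    (hg : G.map (𝟙 z) ≫ 𝟙 (G.obj z) = 𝟙 (G.obj z)) :
    DblCat.hom (K.hcompCell (K.vid (G.pro m)) (DblCat.recast hf hg (K.vcomp (G.cell β) α))) =
      DblCat.hom (K.hcompCell (G.cell (E.vid m)) (G.cell β)) ≫
        DblCat.hom (K.hcompCell (K.vid (G.pro m)) α) := by
  rw [← DblCat.hom_vcomp, ← K.interchange]
  refine DblCat.hcompCell_congr ?_ (DblCat.sq_recast _ _ _)
  exact ((K.vcomp_vid _).trans (G.cell_vid _)).symm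

theorem hom_colaxComp_naturality (G : ColaxDblFunctor D E) {x y z x' y' z' : D.Obj} {f : x ⟶ x'}
    {g : y ⟶ y'} {h : z ⟶ z'} {m : D.Pro x y} {n : D.Pro y z} {m' : D.Pro x' y'}
    {n' : D.Pro y' z'} (α : D.Cell f g m m') (β : D.Cell g h n n') :
    DblCat.hom (G.colaxComp m n) ≫ DblCat.hom (E.hcompCell (G.cell α) (G.cell β)) =
      DblCat.hom (G.cell (D.hcompCell α β)) ≫ DblCat.hom (G.colaxComp m' n') :=
  G.colaxComp_naturality α β

/-- Composition of colax double functors, in diagrammatic order. -/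
def comp (F : ColaxDblFunctor D E) (G : ColaxDblFunctor E K) : ColaxDblFunctor D K where
  obj x := G.obj (F.obj x)
  map f := G.map (F.map f)
  pro m := G.pro (F.pro m)
  cell α := G.cell (F.cell α)
  map_id x := by rw [F.map_id, G.map_id]
  map_comp f g := by rw [F.map_comp, G.map_comp]
  cell_vid m := (G.cell_congr (F.cell_vid m)).trans (G.cell_vid _)
  cell_vcomp α β := (G.cell_congr (F.cell_vcomp α β)).trans (G.cell_vcomp _ _)
  colaxComp m n := DblCat.recast (by simp [G.map_id]) (by simp [G.map_id])
    (K.vcomp (G.cell (F.colaxComp m n)) (G.colaxComp (F.pro m) (F.pro n)))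
  colaxId x := DblCat.recast (by simp [G.map_id]) (by simp [G.map_id])
    (K.vcomp (G.cell (F.colaxId x)) (G.colaxId (F.obj x)))
  colaxComp_naturality {x y z x' y' z' f g h m n m' n'} α β := by
    change DblCat.hom (DblCat.recast _ _ _) ≫ DblCat.hom _ =
      DblCat.hom _ ≫ DblCat.hom (DblCat.recast _ _ _)
    rw [DblCat.hom_recast, DblCat.hom_recast, DblCat.hom_vcomp, DblCat.hom_vcomp,
      Category.assoc, G.hom_colaxComp_naturality, ← Category.assoc, ← Category.assoc]
    congr 1
    rw [← G.hom_cell_vcomp, ← G.hom_cell_vcomp]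
    exact G.cell_congr (F.colaxComp_naturality α β)
  colaxId_naturality {x y} f := by
    change DblCat.hom (DblCat.recast _ _ _) ≫ DblCat.hom _ =
      DblCat.hom _ ≫ DblCat.hom (DblCat.recast _ _ _)
    rw [DblCat.hom_recast, DblCat.hom_recast, DblCat.hom_vcomp, DblCat.hom_vcomp,
      Category.assoc]
    have h : DblCat.hom (G.colaxId (F.obj x)) ≫ DblCat.hom (K.hidCell (G.map (F.map f))) =
      DblCat.hom (G.cell (E.hidCell (F.map f))) ≫ DblCat.hom (G.colaxId (F.obj y)) :=
      G.colaxId_naturality (F.map f)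
    rw [h, ← Category.assoc, ← Category.assoc]
    congr 1
    rw [← G.hom_cell_vcomp, ← G.hom_cell_vcomp]
    exact G.cell_congr (F.colaxId_naturality f)
  associativity m n p := by
    change DblCat.hom (DblCat.recast _ _ _) ≫ DblCat.hom _ ≫ DblCat.hom _ =
      DblCat.hom _ ≫ DblCat.hom (DblCat.recast _ _ _) ≫ DblCat.hom _
    rw [DblCat.hom_recast, DblCat.hom_recast, comp_whisker_right, comp_whisker_left,
      DblCat.hom_vcomp, DblCat.hom_vcomp]
    simp only [Category.assoc]
    have e₁ := G.hom_colaxComp_naturality (F.colaxComp m n) (E.vid (F.pro p))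
    have e₂ := G.hom_colaxComp_naturality (E.vid (F.pro m)) (F.colaxComp n p)
    rw [reassoc_of% e₁, reassoc_of% e₂]
    have e₃ : DblCat.hom (G.colaxComp (E.hcomp (F.pro m) (F.pro n)) (F.pro p)) ≫
        DblCat.hom (K.hcompCell (G.colaxComp (F.pro m) (F.pro n)) (K.vid (G.pro (F.pro p)))) ≫
          DblCat.hom (K.assocHom (G.pro (F.pro m)) (G.pro (F.pro n)) (G.pro (F.pro p))) =
        DblCat.hom (G.cell (E.assocHom (F.pro m) (F.pro n) (F.pro p))) ≫
          DblCat.hom (G.colaxComp (F.pro m) (E.hcomp (F.pro n) (F.pro p))) ≫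
            DblCat.hom (K.hcompCell (K.vid (G.pro (F.pro m))) (G.colaxComp (F.pro n) (F.pro p))) :=
      G.associativity _ _ _
    rw [e₃]
    simp only [← Category.assoc]
    congr 2
    simp only [← G.hom_cell_vcomp]
    refine G.cell_congr (Eq.trans ?_ ((F.associativity m n p).trans ?_))
    · exact E.vcomp_assoc _ _ _
    · exact (E.vcomp_assoc _ _ _).symm
  left_unitality {x y} m := by
    change DblCat.hom (DblCat.recast _ _ _) ≫ DblCat.hom _ ≫ DblCat.hom _ = DblCat.hom _
    rw [DblCat.hom_recast, comp_whisker_right, DblCat.hom_vcomp]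
    simp only [Category.assoc]
    have e₁ := G.hom_colaxComp_naturality (F.colaxId x) (E.vid (F.pro m))
    rw [reassoc_of% e₁]
    have e₂ : DblCat.hom (G.colaxComp (E.hid (F.obj x)) (F.pro m)) ≫
        DblCat.hom (K.hcompCell (G.colaxId (F.obj x)) (K.vid (G.pro (F.pro m)))) ≫
          DblCat.hom (K.lunitHom (G.pro (F.pro m))) =
        DblCat.hom (G.cell (E.lunitHom (F.pro m))) := G.left_unitality _
    rw [e₂]
    simp only [← G.hom_cell_vcomp]
    exact G.cell_congr (F.left_unitality m)
  right_unitality {x y} m := by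
    change DblCat.hom (DblCat.recast _ _ _) ≫ DblCat.hom _ ≫ DblCat.hom _ = DblCat.hom _
    rw [DblCat.hom_recast, comp_whisker_left, DblCat.hom_vcomp]
    simp only [Category.assoc]
    have e₁ := G.hom_colaxComp_naturality (E.vid (F.pro m)) (F.colaxId y)
    rw [reassoc_of% e₁]
    have e₂ : DblCat.hom (G.colaxComp (F.pro m) (E.hid (F.obj y))) ≫
        DblCat.hom (K.hcompCell (K.vid (G.pro (F.pro m))) (G.colaxId (F.obj y))) ≫
          DblCat.hom (K.runitHom (G.pro (F.pro m))) =
        DblCat.hom (G.cell (E.runitHom (F.pro m))) := G.right_unitality _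
    rw [e₂]
    simp only [← G.hom_cell_vcomp]
    exact G.cell_congr (F.right_unitality m)

end ColaxDblFunctor

/-- A natural transformation between lax double functors. -/
structure LaxDblTrans {D : DblCat.{u₀, v₀, u₁, v₁}} {E : DblCat.{u₂, v₂, u₃, v₃}}
    (F G : LaxDblFunctor D E) where
  app : ∀ x : D.Obj, F.obj x ⟶ G.obj x
  appPro : ∀ {x y : D.Obj} (m : D.Pro x y), E.Cell (app x) (app y) (F.pro m) (G.pro m)
  naturality : ∀ {x y : D.Obj} (f : x ⟶ y), F.map f ≫ app y = app x ≫ G.map f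
  naturality_cell : ∀ {x y w z : D.Obj} {f : x ⟶ w} {g : y ⟶ z} {m : D.Pro x y} {n : D.Pro w z}
    (α : D.Cell f g m n),
    E.sq (E.vcomp (F.cell α) (appPro n)) = E.sq (E.vcomp (appPro m) (G.cell α))
  laxComp_app : ∀ {x y z : D.Obj} (m : D.Pro x y) (n : D.Pro y z),
    E.sq (E.vcomp (F.laxComp m n) (appPro (D.hcomp m n))) =
      E.sq (E.vcomp (E.hcompCell (appPro m) (appPro n)) (G.laxComp m n))
  laxId_app : ∀ x : D.Obj,
    E.sq (E.vcomp (F.laxId x) (appPro (D.hid x))) =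
      E.sq (E.vcomp (E.hidCell (app x)) (G.laxId x))

/-- A natural transformation between colax double functors. -/
structure ColaxDblTrans {D : DblCat.{u₀, v₀, u₁, v₁}} {E : DblCat.{u₂, v₂, u₃, v₃}}
    (F G : ColaxDblFunctor D E) where
  app : ∀ x : D.Obj, F.obj x ⟶ G.obj x
  appPro : ∀ {x y : D.Obj} (m : D.Pro x y), E.Cell (app x) (app y) (F.pro m) (G.pro m)
  naturality : ∀ {x y : D.Obj} (f : x ⟶ y), F.map f ≫ app y = app x ≫ G.map f
  naturality_cell : ∀ {x y w z : D.Obj} {f : x ⟶ w} {g : y ⟶ z} {m : D.Pro x y} {n : D.Pro w z}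
    (α : D.Cell f g m n),
    E.sq (E.vcomp (F.cell α) (appPro n)) = E.sq (E.vcomp (appPro m) (G.cell α))
  colaxComp_app : ∀ {x y z : D.Obj} (m : D.Pro x y) (n : D.Pro y z),
    E.sq (E.vcomp (F.colaxComp m n) (E.hcompCell (appPro m) (appPro n))) =
      E.sq (E.vcomp (appPro (D.hcomp m n)) (G.colaxComp m n))
  colaxId_app : ∀ x : D.Obj,
    E.sq (E.vcomp (F.colaxId x) (E.hidCell (app x))) =
      E.sq (E.vcomp (appPro (D.hid x)) (G.colaxId x))

/-- An adjunction `F ⊣ G` in the 2-category of double categories, lax double functors and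
natural transformations, given by unit and counit satisfying the triangle identities (on objects
and on proarrows). -/
structure LaxDblAdjunction {D : DblCat.{u₀, v₀, u₁, v₁}} {E : DblCat.{u₂, v₂, u₃, v₃}}
    (F : LaxDblFunctor D E) (G : LaxDblFunctor E D) where
  unit : LaxDblTrans (LaxDblFunctor.id D) (F.comp G)
  counit : LaxDblTrans (G.comp F) (LaxDblFunctor.id E)
  left_triangle : ∀ x : D.Obj, F.map (unit.app x) ≫ counit.app (F.obj x) = 𝟙 (F.obj x)
  left_triangle_pro : ∀ {x y : D.Obj} (m : D.Pro x y),
    E.sq (E.vcomp (F.cell (unit.appPro m)) (counit.appPro (F.pro m))) = E.sq (E.vid (F.pro m))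
  right_triangle : ∀ y : E.Obj, unit.app (G.obj y) ≫ G.map (counit.app y) = 𝟙 (G.obj y)
  right_triangle_pro : ∀ {x y : E.Obj} (m : E.Pro x y),
    D.sq (D.vcomp (unit.appPro (G.pro m)) (G.cell (counit.appPro m))) = D.sq (D.vid (G.pro m))

/-- An adjunction `F ⊣ G` in the 2-category of double categories, colax double functors and
natural transformations, given by unit and counit satisfying the triangle identities (on objects
and on proarrows). -/
structure ColaxDblAdjunction {D : DblCat.{u₀, v₀, u₁, v₁}} {E : DblCat.{u₂, v₂, u₃, v₃}}
    (F : ColaxDblFunctor D E) (G : ColaxDblFunctor E D) where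
  unit : ColaxDblTrans (ColaxDblFunctor.id D) (F.comp G)
  counit : ColaxDblTrans (G.comp F) (ColaxDblFunctor.id E)
  left_triangle : ∀ x : D.Obj, F.map (unit.app x) ≫ counit.app (F.obj x) = 𝟙 (F.obj x)
  left_triangle_pro : ∀ {x y : D.Obj} (m : D.Pro x y),
    E.sq (E.vcomp (F.cell (unit.appPro m)) (counit.appPro (F.pro m))) = E.sq (E.vid (F.pro m))
  right_triangle : ∀ y : E.Obj, unit.app (G.obj y) ≫ G.map (counit.app y) = 𝟙 (G.obj y)
  right_triangle_pro : ∀ {x y : E.Obj} (m : E.Pro x y),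
    D.sq (D.vcomp (unit.appPro (G.pro m)) (G.cell (counit.appPro m))) = D.sq (D.vid (G.pro m))

/-! ### Double categories of spans and of cospans -/

section Spans

attribute [local simp] pullback.lift_fst pullback.lift_snd pullback.lift_fst_assoc pullback.lift_snd_assoc

variable {S : Type u} [Category.{v} S]

/-- A span `x ⟵ apex ⟶ y`. -/
structure SpanIn (x y : S) where
  apex : S
  l : apex ⟶ x
  r : apex ⟶ y

namespace SpanIn

/-- A map of spans with given maps between the feet. -/
@[ext]
structure Cell {x y w z : S} (f : x ⟶ w) (g : y ⟶ z) (m : SpanIn x y) (n : SpanIn w z) where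
  hom : m.apex ⟶ n.apex
  hom_l : hom ≫ n.l = m.l ≫ f
  hom_r : hom ≫ n.r = m.r ≫ g

theorem Cell.hom_l_assoc {x y w z t : S} {f : x ⟶ w} {g : y ⟶ z} {m : SpanIn x y}
    {n : SpanIn w z} (α : Cell f g m n) (h : w ⟶ t) : α.hom ≫ n.l ≫ h = m.l ≫ f ≫ h := by
  rw [← Category.assoc, α.hom_l, Category.assoc]

theorem Cell.hom_r_assoc {x y w z t : S} {f : x ⟶ w} {g : y ⟶ z} {m : SpanIn x y}
    {n : SpanIn w z} (α : Cell f g m n) (h : z ⟶ t) : α.hom ≫ n.r ≫ h = m.r ≫ g ≫ h := by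
  rw [← Category.assoc, α.hom_r, Category.assoc]

attribute [simp] Cell.hom_l Cell.hom_r Cell.hom_l_assoc Cell.hom_r_assoc

/-- identity map of a span -/
@[simps]
def Cell.vid {x y : S} (m : SpanIn x y) : Cell (𝟙 x) (𝟙 y) m m where
  hom := 𝟙 m.apex
  hom_l := by simp
  hom_r := by simp

/-- composition of maps of spans -/
@[simps]
def Cell.vcomp {x y x' y' x'' y'' : S} {f : x ⟶ x'} {g : y ⟶ y'} {f' : x' ⟶ x''} {g' : y' ⟶ y''}
    {m : SpanIn x y} {n : SpanIn x' y'} {p : SpanIn x'' y''} (α : Cell f g m n)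
    (β : Cell f' g' n p) : Cell (f ≫ f') (g ≫ g') m p where
  hom := α.hom ≫ β.hom
  hom_l := by simp
  hom_r := by simp

/-- the identity span -/
abbrev hid (x : S) : SpanIn x x where
  apex := x
  l := 𝟙 x
  r := 𝟙 x

/-- the identity map of spans on an arrow -/
@[simps]
def Cell.hid {x y : S} (f : x ⟶ y) : Cell f f (hid x) (hid y) where
  hom := f
  hom_l := by simp
  hom_r := by simp

variable [HasPullbacks S]

/-- composition of spans, by pullback -/
noncomputable abbrev hcomp {x y z : S} (m : SpanIn x y) (n : SpanIn y z) : SpanIn x z where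
  apex := pullback m.r n.l
  l := pullback.fst m.r n.l ≫ m.l
  r := pullback.snd m.r n.l ≫ n.r

/-- external composition of maps of spans -/
@[simps]
noncomputable def Cell.hcomp {x y z x' y' z' : S} {f : x ⟶ x'} {g : y ⟶ y'} {h : z ⟶ z'}
    {m : SpanIn x y} {n : SpanIn y z} {m' : SpanIn x' y'} {n' : SpanIn y' z'}
    (α : Cell f g m m') (β : Cell g h n n') : Cell f h (m.hcomp n) (m'.hcomp n') where
  hom := pullback.lift (pullback.fst m.r n.l ≫ α.hom) (pullback.snd m.r n.l ≫ β.hom)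
    (by simp [pullback.condition_assoc])
  hom_l := by simp
  hom_r := by simp

/-- associator -/
@[simps]
noncomputable def assocHom {x y z t : S} (m : SpanIn x y) (n : SpanIn y z) (p : SpanIn z t) :
    Cell (𝟙 x) (𝟙 t) ((m.hcomp n).hcomp p) (m.hcomp (n.hcomp p)) where
  hom := pullback.lift (pullback.fst (m.hcomp n).r p.l ≫ pullback.fst m.r n.l)
    (pullback.lift (pullback.fst (m.hcomp n).r p.l ≫ pullback.snd m.r n.l)
      (pullback.snd (m.hcomp n).r p.l) (by simpa using pullback.condition (f := (m.hcomp n).r)))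
    (by simp [pullback.condition])
  hom_l := by simp
  hom_r := by simp

/-- inverse associator -/
@[simps]
noncomputable def assocInv {x y z t : S} (m : SpanIn x y) (n : SpanIn y z) (p : SpanIn z t) :
    Cell (𝟙 x) (𝟙 t) (m.hcomp (n.hcomp p)) ((m.hcomp n).hcomp p) where
  hom := pullback.lift
    (pullback.lift (pullback.fst m.r (n.hcomp p).l)
      (pullback.snd m.r (n.hcomp p).l ≫ pullback.fst n.r p.l)
      (by simpa using pullback.condition (g := (n.hcomp p).l)))
    (pullback.snd m.r (n.hcomp p).l ≫ pullback.snd n.r p.l)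
    (by simp [pullback.condition])
  hom_l := by simp
  hom_r := by simp

/-- left unitor -/
@[simps]
noncomputable def lunitHom {x y : S} (m : SpanIn x y) : Cell (𝟙 x) (𝟙 y) ((hid x).hcomp m) m where
  hom := pullback.snd (hid x).r m.l
  hom_l := by simpa using (pullback.condition (f := (hid x).r) (g := m.l)).symm
  hom_r := by simp

/-- inverse left unitor -/
@[simps]
noncomputable def lunitInv {x y : S} (m : SpanIn x y) : Cell (𝟙 x) (𝟙 y) m ((hid x).hcomp m) where
  hom := pullback.lift m.l (𝟙 m.apex) (by simp)
  hom_l := by simp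
  hom_r := by simp

/-- right unitor -/
@[simps]
noncomputable def runitHom {x y : S} (m : SpanIn x y) : Cell (𝟙 x) (𝟙 y) (m.hcomp (hid y)) m where
  hom := pullback.fst m.r (hid y).l
  hom_l := by simp
  hom_r := by simpa using pullback.condition (f := m.r) (g := (hid y).l)

/-- inverse right unitor -/
@[simps]
noncomputable def runitInv {x y : S} (m : SpanIn x y) : Cell (𝟙 x) (𝟙 y) m (m.hcomp (hid y)) where
  hom := pullback.lift (𝟙 m.apex) m.r (by simp)
  hom_l := by simp
  hom_r := by simp

theorem hcompCell_vid {x y z : S} (m : SpanIn x y) (n : SpanIn y z) :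
    (Cell.vid m).hcomp (Cell.vid n) = Cell.vid (m.hcomp n) := by
  apply Cell.ext
  apply pullback.hom_ext <;> simp

theorem interchange {x y z x' y' z' x'' y'' z'' : S} {f : x ⟶ x'} {g : y ⟶ y'} {h : z ⟶ z'}
    {f' : x' ⟶ x''} {g' : y' ⟶ y''} {h' : z' ⟶ z''}
    {m : SpanIn x y} {n : SpanIn y z} {m' : SpanIn x' y'} {n' : SpanIn y' z'}
    {m'' : SpanIn x'' y''} {n'' : SpanIn y'' z''}
    (α : Cell f g m m') (β : Cell g h n n') (α' : Cell f' g' m' m'') (β' : Cell g' h' n' n'') :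
    (α.vcomp α').hcomp (β.vcomp β') = (α.hcomp β).vcomp (α'.hcomp β') := by
  apply Cell.ext
  apply pullback.hom_ext <;> simp

theorem assoc_hom_inv {x y z t : S} (m : SpanIn x y) (n : SpanIn y z) (p : SpanIn z t) :
    ((assocHom m n p).vcomp (assocInv m n p)).hom = 𝟙 ((m.hcomp n).hcomp p).apex := by
  apply pullback.hom_ext
  · apply pullback.hom_ext <;> simp
  · simp

theorem assoc_inv_hom {x y z t : S} (m : SpanIn x y) (n : SpanIn y z) (p : SpanIn z t) :
    ((assocInv m n p).vcomp (assocHom m n p)).hom = 𝟙 (m.hcomp (n.hcomp p)).apex := by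
  apply pullback.hom_ext
  · simp
  · apply pullback.hom_ext <;> simp

theorem lunit_hom_inv {x y : S} (m : SpanIn x y) :
    ((lunitHom m).vcomp (lunitInv m)).hom = 𝟙 ((hid x).hcomp m).apex := by
  apply pullback.hom_ext
  · simpa using (pullback.condition (f := (hid x).r) (g := m.l)).symm
  · simp

theorem lunit_inv_hom {x y : S} (m : SpanIn x y) :
    ((lunitInv m).vcomp (lunitHom m)).hom = 𝟙 m.apex := by
  simp

theorem runit_hom_inv {x y : S} (m : SpanIn x y) :
    ((runitHom m).vcomp (runitInv m)).hom = 𝟙 (m.hcomp (hid y)).apex := by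
  apply pullback.hom_ext
  · simp
  · simpa using pullback.condition (f := m.r) (g := (hid y).l)

theorem runit_inv_hom {x y : S} (m : SpanIn x y) :
    ((runitInv m).vcomp (runitHom m)).hom = 𝟙 m.apex := by
  simp

theorem assoc_naturality {x y z t x' y' z' t' : S} {f : x ⟶ x'} {g : y ⟶ y'} {h : z ⟶ z'}
    {k : t ⟶ t'} {m : SpanIn x y} {n : SpanIn y z} {p : SpanIn z t}
    {m' : SpanIn x' y'} {n' : SpanIn y' z'} {p' : SpanIn z' t'}
    (α : Cell f g m m') (β : Cell g h n n') (γ : Cell h k p p') :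
    (((α.hcomp β).hcomp γ).vcomp (assocHom m' n' p')).hom =
      ((assocHom m n p).vcomp (α.hcomp (β.hcomp γ))).hom := by
  apply pullback.hom_ext
  · simp
  · apply pullback.hom_ext <;> simp

theorem lunit_naturality {x y x' y' : S} {f : x ⟶ x'} {g : y ⟶ y'} {m : SpanIn x y}
    {m' : SpanIn x' y'} (α : Cell f g m m') :
    (((Cell.hid f).hcomp α).vcomp (lunitHom m')).hom = ((lunitHom m).vcomp α).hom := by
  simp

theorem runit_naturality {x y x' y' : S} {f : x ⟶ x'} {g : y ⟶ y'} {m : SpanIn x y}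
    {m' : SpanIn x' y'} (α : Cell f g m m') :
    ((α.hcomp (Cell.hid g)).vcomp (runitHom m')).hom = ((runitHom m).vcomp α).hom := by
  simp

theorem pentagon {x y z t s : S} (m : SpanIn x y) (n : SpanIn y z) (p : SpanIn z t)
    (q : SpanIn t s) :
    (((assocHom m n p).hcomp (Cell.vid q)).vcomp
      ((assocHom m (n.hcomp p) q).vcomp ((Cell.vid m).hcomp (assocHom n p q)))).hom =
    ((assocHom (m.hcomp n) p q).vcomp (assocHom m n (p.hcomp q))).hom := by
  apply pullback.hom_ext
  · simp
  · apply pullback.hom_ext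
    · simp
    · apply pullback.hom_ext <;> simp

theorem triangle {x y z : S} (m : SpanIn x y) (n : SpanIn y z) :
    ((assocHom m (hid y) n).vcomp ((Cell.vid m).hcomp (lunitHom n))).hom =
      ((runitHom m).hcomp (Cell.vid n)).hom := by
  apply pullback.hom_ext <;> simp

end SpanIn

variable (S) in
/-- Objects, arrows, spans and maps of spans in a category. -/
@[reducible]
def spanQuiver : DblQuiver.{u, v, max u v, v} where
  Obj := S
  Pro := SpanIn
  Cell f g m n := SpanIn.Cell f g m n

theorem SpanIn.sq_ext {x y w z : S} {m : SpanIn x y} {n : SpanIn w z} {f f' : x ⟶ w}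
    {g g' : y ⟶ z} {α : SpanIn.Cell f g m n} {β : SpanIn.Cell f' g' m n} (hf : f = f')
    (hg : g = g') (h : α.hom = β.hom) : (spanQuiver S).sq α = (spanQuiver S).sq β := by
  subst hf hg
  congr 1
  exact SpanIn.Cell.ext h

variable (S) in
/-- The double category of spans in a category with pullbacks. -/
noncomputable def spanDbl [HasPullbacks S] : DblCat.{u, v, max u v, v} where
  toDblQuiver := spanQuiver S
  vid := SpanIn.Cell.vid (S := S)
  vcomp := SpanIn.Cell.vcomp (S := S)
  vid_vcomp _ := SpanIn.sq_ext (Category.id_comp _) (Category.id_comp _) (Category.id_comp _)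
  vcomp_vid _ := SpanIn.sq_ext (Category.comp_id _) (Category.comp_id _) (Category.comp_id _)
  vcomp_assoc _ _ _ :=
    SpanIn.sq_ext (Category.assoc _ _ _) (Category.assoc _ _ _) (Category.assoc _ _ _)
  hid := SpanIn.hid (S := S)
  hidCell := SpanIn.Cell.hid (S := S)
  hcomp := SpanIn.hcomp (S := S)
  hcompCell := SpanIn.Cell.hcomp (S := S)
  assocHom := SpanIn.assocHom (S := S)
  assocInv := SpanIn.assocInv (S := S)
  lunitHom := SpanIn.lunitHom (S := S)
  lunitInv := SpanIn.lunitInv (S := S)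
  runitHom := SpanIn.runitHom (S := S)
  runitInv := SpanIn.runitInv (S := S)
  hidCell_id _ := rfl
  hidCell_comp _ _ := rfl
  hcompCell_vid := SpanIn.hcompCell_vid (S := S)
  interchange := SpanIn.interchange (S := S)
  assoc_hom_inv m n p := SpanIn.sq_ext (Category.comp_id _) (Category.comp_id _) (SpanIn.assoc_hom_inv m n p)
  assoc_inv_hom m n p := SpanIn.sq_ext (Category.comp_id _) (Category.comp_id _) (SpanIn.assoc_inv_hom m n p)
  lunit_hom_inv m := SpanIn.sq_ext (Category.comp_id _) (Category.comp_id _) (SpanIn.lunit_hom_inv m)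
  lunit_inv_hom m := SpanIn.sq_ext (Category.comp_id _) (Category.comp_id _) (SpanIn.lunit_inv_hom m)
  runit_hom_inv m := SpanIn.sq_ext (Category.comp_id _) (Category.comp_id _) (SpanIn.runit_hom_inv m)
  runit_inv_hom m := SpanIn.sq_ext (Category.comp_id _) (Category.comp_id _) (SpanIn.runit_inv_hom m)
  assoc_naturality α β γ := SpanIn.sq_ext ((Category.comp_id _).trans (Category.id_comp _).symm)
    ((Category.comp_id _).trans (Category.id_comp _).symm) (SpanIn.assoc_naturality α β γ)
  lunit_naturality α := SpanIn.sq_ext ((Category.comp_id _).trans (Category.id_comp _).symm)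
    ((Category.comp_id _).trans (Category.id_comp _).symm) (SpanIn.lunit_naturality α)
  runit_naturality α := SpanIn.sq_ext ((Category.comp_id _).trans (Category.id_comp _).symm)
    ((Category.comp_id _).trans (Category.id_comp _).symm) (SpanIn.runit_naturality α)
  pentagon m n p q := SpanIn.sq_ext (Category.id_comp _) (Category.id_comp _)
    (SpanIn.pentagon m n p q)
  triangle m n := SpanIn.sq_ext (Category.id_comp _) (Category.id_comp _) (SpanIn.triangle m n)

end Spans

section Cospans

attribute [local simp] pushout.inl_desc pushout.inr_desc pushout.inl_desc_assoc pushout.inr_desc_assoc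

variable {S : Type u} [Category.{v} S]

/-- A cospan `x ⟶ apex ⟵ y`. -/
structure CospanIn (x y : S) where
  apex : S
  l : x ⟶ apex
  r : y ⟶ apex

namespace CospanIn

/-- A map of cospans with given maps between the feet. -/
@[ext]
structure Cell {x y w z : S} (f : x ⟶ w) (g : y ⟶ z) (m : CospanIn x y) (n : CospanIn w z) where
  hom : m.apex ⟶ n.apex
  l_hom : m.l ≫ hom = f ≫ n.l
  r_hom : m.r ≫ hom = g ≫ n.r

theorem Cell.l_hom_assoc {x y w z t : S} {f : x ⟶ w} {g : y ⟶ z} {m : CospanIn x y}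
    {n : CospanIn w z} (α : Cell f g m n) (h : n.apex ⟶ t) :
    m.l ≫ α.hom ≫ h = f ≫ n.l ≫ h := by
  rw [← Category.assoc, α.l_hom, Category.assoc]

theorem Cell.r_hom_assoc {x y w z t : S} {f : x ⟶ w} {g : y ⟶ z} {m : CospanIn x y}
    {n : CospanIn w z} (α : Cell f g m n) (h : n.apex ⟶ t) :
    m.r ≫ α.hom ≫ h = g ≫ n.r ≫ h := by
  rw [← Category.assoc, α.r_hom, Category.assoc]

attribute [simp] Cell.l_hom Cell.r_hom Cell.l_hom_assoc Cell.r_hom_assoc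

/-- identity map of a cospan -/
@[simps]
def Cell.vid {x y : S} (m : CospanIn x y) : Cell (𝟙 x) (𝟙 y) m m where
  hom := 𝟙 m.apex
  l_hom := by simp
  r_hom := by simp

/-- composition of maps of cospans -/
@[simps]
def Cell.vcomp {x y x' y' x'' y'' : S} {f : x ⟶ x'} {g : y ⟶ y'} {f' : x' ⟶ x''} {g' : y' ⟶ y''}
    {m : CospanIn x y} {n : CospanIn x' y'} {p : CospanIn x'' y''} (α : Cell f g m n)
    (β : Cell f' g' n p) : Cell (f ≫ f') (g ≫ g') m p where
  hom := α.hom ≫ β.hom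
  l_hom := by simp
  r_hom := by simp

/-- the identity cospan -/
abbrev hid (x : S) : CospanIn x x where
  apex := x
  l := 𝟙 x
  r := 𝟙 x

/-- the identity map of cospans on an arrow -/
@[simps]
def Cell.hid {x y : S} (f : x ⟶ y) : Cell f f (hid x) (hid y) where
  hom := f
  l_hom := by simp
  r_hom := by simp

variable [HasPushouts S]

/-- composition of cospans, by pushout -/
noncomputable abbrev hcomp {x y z : S} (m : CospanIn x y) (n : CospanIn y z) : CospanIn x z where
  apex := pushout m.r n.l
  l := m.l ≫ pushout.inl m.r n.l
  r := n.r ≫ pushout.inr m.r n.l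

/-- external composition of maps of cospans -/
@[simps]
noncomputable def Cell.hcomp {x y z x' y' z' : S} {f : x ⟶ x'} {g : y ⟶ y'} {h : z ⟶ z'}
    {m : CospanIn x y} {n : CospanIn y z} {m' : CospanIn x' y'} {n' : CospanIn y' z'}
    (α : Cell f g m m') (β : Cell g h n n') : Cell f h (m.hcomp n) (m'.hcomp n') where
  hom := pushout.desc (α.hom ≫ pushout.inl m'.r n'.l) (β.hom ≫ pushout.inr m'.r n'.l)
    (by simp [pushout.condition])
  l_hom := by simp
  r_hom := by simp

/-- associator -/
@[simps]
noncomputable def assocHom {x y z t : S} (m : CospanIn x y) (n : CospanIn y z)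
    (p : CospanIn z t) : Cell (𝟙 x) (𝟙 t) ((m.hcomp n).hcomp p) (m.hcomp (n.hcomp p)) where
  hom := pushout.desc
    (pushout.desc (pushout.inl m.r (n.hcomp p).l)
      (pushout.inl n.r p.l ≫ pushout.inr m.r (n.hcomp p).l)
      (by simpa using pushout.condition (f := m.r) (g := (n.hcomp p).l)))
    (pushout.inr n.r p.l ≫ pushout.inr m.r (n.hcomp p).l)
    (by simp [pushout.condition_assoc])
  l_hom := by simp
  r_hom := by simp

/-- inverse associator -/
@[simps]
noncomputable def assocInv {x y z t : S} (m : CospanIn x y) (n : CospanIn y z)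
    (p : CospanIn z t) : Cell (𝟙 x) (𝟙 t) (m.hcomp (n.hcomp p)) ((m.hcomp n).hcomp p) where
  hom := pushout.desc (pushout.inl m.r n.l ≫ pushout.inl (m.hcomp n).r p.l)
    (pushout.desc (pushout.inr m.r n.l ≫ pushout.inl (m.hcomp n).r p.l)
      (pushout.inr (m.hcomp n).r p.l)
      (by simpa using pushout.condition (f := (m.hcomp n).r) (g := p.l)))
    (by simp [pushout.condition_assoc])
  l_hom := by simp
  r_hom := by simp

/-- left unitor -/
@[simps]
noncomputable def lunitHom {x y : S} (m : CospanIn x y) :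
    Cell (𝟙 x) (𝟙 y) ((hid x).hcomp m) m where
  hom := pushout.desc m.l (𝟙 m.apex) (by simp)
  l_hom := by simp
  r_hom := by simp

/-- inverse left unitor -/
@[simps]
noncomputable def lunitInv {x y : S} (m : CospanIn x y) :
    Cell (𝟙 x) (𝟙 y) m ((hid x).hcomp m) where
  hom := pushout.inr (hid x).r m.l
  l_hom := by simpa using (pushout.condition (f := (hid x).r) (g := m.l)).symm
  r_hom := by simp

/-- right unitor -/
@[simps]
noncomputable def runitHom {x y : S} (m : CospanIn x y) :
    Cell (𝟙 x) (𝟙 y) (m.hcomp (hid y)) m where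
  hom := pushout.desc (𝟙 m.apex) m.r (by simp)
  l_hom := by simp
  r_hom := by simp

/-- inverse right unitor -/
@[simps]
noncomputable def runitInv {x y : S} (m : CospanIn x y) :
    Cell (𝟙 x) (𝟙 y) m (m.hcomp (hid y)) where
  hom := pushout.inl m.r (hid y).l
  l_hom := by simp
  r_hom := by simpa using pushout.condition (f := m.r) (g := (hid y).l)

theorem hcompCell_vid {x y z : S} (m : CospanIn x y) (n : CospanIn y z) :
    (Cell.vid m).hcomp (Cell.vid n) = Cell.vid (m.hcomp n) := by
  apply Cell.ext
  apply pushout.hom_ext <;> simp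

theorem interchange {x y z x' y' z' x'' y'' z'' : S} {f : x ⟶ x'} {g : y ⟶ y'} {h : z ⟶ z'}
    {f' : x' ⟶ x''} {g' : y' ⟶ y''} {h' : z' ⟶ z''}
    {m : CospanIn x y} {n : CospanIn y z} {m' : CospanIn x' y'} {n' : CospanIn y' z'}
    {m'' : CospanIn x'' y''} {n'' : CospanIn y'' z''}
    (α : Cell f g m m') (β : Cell g h n n') (α' : Cell f' g' m' m'') (β' : Cell g' h' n' n'') :
    (α.vcomp α').hcomp (β.vcomp β') = (α.hcomp β).vcomp (α'.hcomp β') := by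
  apply Cell.ext
  apply pushout.hom_ext <;> simp

theorem assoc_hom_inv {x y z t : S} (m : CospanIn x y) (n : CospanIn y z) (p : CospanIn z t) :
    ((assocHom m n p).vcomp (assocInv m n p)).hom = 𝟙 ((m.hcomp n).hcomp p).apex := by
  apply pushout.hom_ext
  · apply pushout.hom_ext <;> simp
  · simp

theorem assoc_inv_hom {x y z t : S} (m : CospanIn x y) (n : CospanIn y z) (p : CospanIn z t) :
    ((assocInv m n p).vcomp (assocHom m n p)).hom = 𝟙 (m.hcomp (n.hcomp p)).apex := by
  apply pushout.hom_ext
  · simp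
  · apply pushout.hom_ext <;> simp

theorem lunit_hom_inv {x y : S} (m : CospanIn x y) :
    ((lunitHom m).vcomp (lunitInv m)).hom = 𝟙 ((hid x).hcomp m).apex := by
  apply pushout.hom_ext
  · simpa using (pushout.condition (f := (hid x).r) (g := m.l)).symm
  · simp

theorem lunit_inv_hom {x y : S} (m : CospanIn x y) :
    ((lunitInv m).vcomp (lunitHom m)).hom = 𝟙 m.apex := by
  simp

theorem runit_hom_inv {x y : S} (m : CospanIn x y) :
    ((runitHom m).vcomp (runitInv m)).hom = 𝟙 (m.hcomp (hid y)).apex := by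
  apply pushout.hom_ext
  · simp
  · simpa using pushout.condition (f := m.r) (g := (hid y).l)

theorem runit_inv_hom {x y : S} (m : CospanIn x y) :
    ((runitInv m).vcomp (runitHom m)).hom = 𝟙 m.apex := by
  simp

theorem assoc_naturality {x y z t x' y' z' t' : S} {f : x ⟶ x'} {g : y ⟶ y'} {h : z ⟶ z'}
    {k : t ⟶ t'} {m : CospanIn x y} {n : CospanIn y z} {p : CospanIn z t}
    {m' : CospanIn x' y'} {n' : CospanIn y' z'} {p' : CospanIn z' t'}
    (α : Cell f g m m') (β : Cell g h n n') (γ : Cell h k p p') :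
    (((α.hcomp β).hcomp γ).vcomp (assocHom m' n' p')).hom =
      ((assocHom m n p).vcomp (α.hcomp (β.hcomp γ))).hom := by
  apply pushout.hom_ext
  · apply pushout.hom_ext <;> simp
  · simp

theorem lunit_naturality {x y x' y' : S} {f : x ⟶ x'} {g : y ⟶ y'} {m : CospanIn x y}
    {m' : CospanIn x' y'} (α : Cell f g m m') :
    (((Cell.hid f).hcomp α).vcomp (lunitHom m')).hom = ((lunitHom m).vcomp α).hom := by
  apply pushout.hom_ext <;> simp

theorem runit_naturality {x y x' y' : S} {f : x ⟶ x'} {g : y ⟶ y'} {m : CospanIn x y}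
    {m' : CospanIn x' y'} (α : Cell f g m m') :
    ((α.hcomp (Cell.hid g)).vcomp (runitHom m')).hom = ((runitHom m).vcomp α).hom := by
  apply pushout.hom_ext <;> simp

theorem pentagon {x y z t s : S} (m : CospanIn x y) (n : CospanIn y z) (p : CospanIn z t)
    (q : CospanIn t s) :
    (((assocHom m n p).hcomp (Cell.vid q)).vcomp
      ((assocHom m (n.hcomp p) q).vcomp ((Cell.vid m).hcomp (assocHom n p q)))).hom =
    ((assocHom (m.hcomp n) p q).vcomp (assocHom m n (p.hcomp q))).hom := by
  apply pushout.hom_ext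
  · apply pushout.hom_ext
    · apply pushout.hom_ext <;> simp
    · simp
  · simp

theorem triangle {x y z : S} (m : CospanIn x y) (n : CospanIn y z) :
    ((assocHom m (hid y) n).vcomp ((Cell.vid m).hcomp (lunitHom n))).hom =
      ((runitHom m).hcomp (Cell.vid n)).hom := by
  apply pushout.hom_ext
  · apply pushout.hom_ext
    · simp
    · simpa using (pushout.condition (f := m.r) (g := n.l)).symm
  · simp

end CospanIn

variable (S) in
/-- Objects, arrows, cospans and maps of cospans in a category. -/
@[reducible]
def cospanQuiver : DblQuiver.{u, v, max u v, v} where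
  Obj := S
  Pro := CospanIn
  Cell f g m n := CospanIn.Cell f g m n

theorem CospanIn.sq_ext {x y w z : S} {m : CospanIn x y} {n : CospanIn w z} {f f' : x ⟶ w}
    {g g' : y ⟶ z} {α : CospanIn.Cell f g m n} {β : CospanIn.Cell f' g' m n} (hf : f = f')
    (hg : g = g') (h : α.hom = β.hom) : (cospanQuiver S).sq α = (cospanQuiver S).sq β := by
  subst hf hg
  congr 1
  exact CospanIn.Cell.ext h

variable (S) in
/-- The double category of cospans in a category with pushouts. -/
noncomputable def cospanDbl [HasPushouts S] : DblCat.{u, v, max u v, v} where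
  toDblQuiver := cospanQuiver S
  vid := CospanIn.Cell.vid (S := S)
  vcomp := CospanIn.Cell.vcomp (S := S)
  vid_vcomp _ := CospanIn.sq_ext (Category.id_comp _) (Category.id_comp _) (Category.id_comp _)
  vcomp_vid _ := CospanIn.sq_ext (Category.comp_id _) (Category.comp_id _) (Category.comp_id _)
  vcomp_assoc _ _ _ :=
    CospanIn.sq_ext (Category.assoc _ _ _) (Category.assoc _ _ _) (Category.assoc _ _ _)
  hid := CospanIn.hid (S := S)
  hidCell := CospanIn.Cell.hid (S := S)
  hcomp := CospanIn.hcomp (S := S)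
  hcompCell := CospanIn.Cell.hcomp (S := S)
  assocHom := CospanIn.assocHom (S := S)
  assocInv := CospanIn.assocInv (S := S)
  lunitHom := CospanIn.lunitHom (S := S)
  lunitInv := CospanIn.lunitInv (S := S)
  runitHom := CospanIn.runitHom (S := S)
  runitInv := CospanIn.runitInv (S := S)
  hidCell_id _ := rfl
  hidCell_comp _ _ := rfl
  hcompCell_vid := CospanIn.hcompCell_vid (S := S)
  interchange := CospanIn.interchange (S := S)
  assoc_hom_inv m n p := CospanIn.sq_ext (Category.comp_id _) (Category.comp_id _) (CospanIn.assoc_hom_inv m n p)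
  assoc_inv_hom m n p := CospanIn.sq_ext (Category.comp_id _) (Category.comp_id _) (CospanIn.assoc_inv_hom m n p)
  lunit_hom_inv m := CospanIn.sq_ext (Category.comp_id _) (Category.comp_id _) (CospanIn.lunit_hom_inv m)
  lunit_inv_hom m := CospanIn.sq_ext (Category.comp_id _) (Category.comp_id _) (CospanIn.lunit_inv_hom m)
  runit_hom_inv m := CospanIn.sq_ext (Category.comp_id _) (Category.comp_id _) (CospanIn.runit_hom_inv m)
  runit_inv_hom m := CospanIn.sq_ext (Category.comp_id _) (Category.comp_id _) (CospanIn.runit_inv_hom m)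
  assoc_naturality α β γ := CospanIn.sq_ext ((Category.comp_id _).trans (Category.id_comp _).symm)
    ((Category.comp_id _).trans (Category.id_comp _).symm) (CospanIn.assoc_naturality α β γ)
  lunit_naturality α := CospanIn.sq_ext ((Category.comp_id _).trans (Category.id_comp _).symm)
    ((Category.comp_id _).trans (Category.id_comp _).symm) (CospanIn.lunit_naturality α)
  runit_naturality α := CospanIn.sq_ext ((Category.comp_id _).trans (Category.id_comp _).symm)
    ((Category.comp_id _).trans (Category.id_comp _).symm) (CospanIn.runit_naturality α)
  pentagon m n p q := CospanIn.sq_ext (Category.id_comp _) (Category.id_comp _)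
    (CospanIn.pentagon m n p q)
  triangle m n := CospanIn.sq_ext (Category.id_comp _) (Category.id_comp _) (CospanIn.triangle m n)

end Cospans

/-! ### Indexing sets and indexing spans -/

/-- A class of indexing sets that contains the singleton and is closed under pullbacks. -/
structure IndexClass where
  mem : Type w → Prop
  mem_punit : mem PUnit
  mem_sub : ∀ {A J B : Type w}, mem A → mem J → mem B →
    ∀ p : A × J × B → Prop, mem { t : A × J × B // p t }

/-- All (small) indexing sets. -/
def IndexClass.all : IndexClass.{w} where
  mem _ := True
  mem_punit := trivial
  mem_sub _ _ _ _ := trivial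

/-- The finite indexing sets. -/
def IndexClass.finite : IndexClass.{w} where
  mem I := Finite I
  mem_punit := inferInstance
  mem_sub hA hJ hB p := by
    have := hA
    have := hJ
    have := hB
    infer_instance

/-- A span of sets `I ⟵ apex ⟶ J`. -/
structure SetSpan (I J : Type w) where
  apex : Type w
  l : apex → I
  r : apex → J

namespace SetSpan

/-- The elements `a : i ⇸ j` of a span of sets: elements of the apex lying over `i` and `j`. -/
structure El {I J : Type w} (A : SetSpan I J) (i : I) (j : J) where
  val : A.apex
  hl : A.l val = i
  hr : A.r val = j

/-- The action of a map of spans on elements. -/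
def El.map {I J K L : Type w} {A : SetSpan I J} {B : SetSpan K L} (h : A.apex → B.apex)
    (f : I → K) (g : J → L) (hl : ∀ a, B.l (h a) = f (A.l a)) (hr : ∀ a, B.r (h a) = g (A.r a))
    {i : I} {j : J} (a : A.El i j) : B.El (f i) (g j) :=
  ⟨h a.val, (hl a.val).trans (congrArg f a.hl), (hr a.val).trans (congrArg g a.hr)⟩

/-- The identity span. -/
def one (I : Type w) : SetSpan I I :=
  ⟨I, fun i => i, fun i => i⟩

/-- Composition of spans by pullback: the apex consists of `(a, j, b)` with `a` and `b` both lying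
over `j`. -/
def comp {I J K : Type w} (A : SetSpan I J) (B : SetSpan J K) : SetSpan I K where
  apex := { t : A.apex × J × B.apex // A.r t.1 = t.2.1 ∧ B.l t.2.2 = t.2.1 }
  l t := A.l t.1.1
  r t := B.r t.1.2.2

variable {I J K : Type w} {A : SetSpan I J} {B : SetSpan J K}

/-- The middle of an element `i ⇸ j ⇸ k` of a composite span. -/
def El.mid {i : I} {k : K} (e : (A.comp B).El i k) : J := e.val.1.2.1

/-- The first component of an element `i ⇸ j ⇸ k` of a composite span. -/
def El.fst {i : I} {k : K} (e : (A.comp B).El i k) : A.El i e.mid :=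
  ⟨e.val.1.1, e.hl, e.val.2.1⟩

/-- The second component of an element `i ⇸ j ⇸ k` of a composite span. -/
def El.snd {i : I} {k : K} (e : (A.comp B).El i k) : B.El e.mid k :=
  ⟨e.val.1.2.2, e.val.2.2, e.hr⟩

theorem one_comp_ind {motive : ∀ (i : I) (j : J), ((one I).comp A).El i j → Prop}
    (h : ∀ (b : A.apex), motive (A.l b) (A.r b) ⟨⟨(A.l b, A.l b, b), rfl, rfl⟩, rfl, rfl⟩) :
    ∀ (i : I) (j : J) (e : ((one I).comp A).El i j), motive i j e := by
  rintro i j ⟨⟨⟨a, i', b⟩, h₁, h₂⟩, h₃, h₄⟩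
  have h₁' : a = i' := h₁
  have h₂' : A.l b = i' := h₂
  have h₃' : a = i := h₃
  have h₄' : A.r b = j := h₄
  subst h₂' h₁' h₃' h₄'
  exact h b

theorem comp_one_ind {motive : ∀ (i : I) (j : J), (A.comp (one J)).El i j → Prop}
    (h : ∀ (a : A.apex), motive (A.l a) (A.r a) ⟨⟨(a, A.r a, A.r a), rfl, rfl⟩, rfl, rfl⟩) :
    ∀ (i : I) (j : J) (e : (A.comp (one J)).El i j), motive i j e := by
  rintro i j ⟨⟨⟨a, j', b⟩, h₁, h₂⟩, h₃, h₄⟩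
  have h₁' : A.r a = j' := h₁
  have h₂' : b = j' := h₂
  have h₃' : A.l a = i := h₃
  have h₄' : b = j := h₄
  subst h₁' h₂' h₃' h₄'
  exact h a

theorem one_comp_apex_ind {motive : ((one I).comp A).apex → Prop}
    (h : ∀ (b : A.apex), motive ⟨(A.l b, A.l b, b), rfl, rfl⟩) :
    ∀ t, motive t := by
  rintro ⟨⟨a, i', b⟩, h₁, h₂⟩
  have h₁' : a = i' := h₁
  have h₂' : A.l b = i' := h₂
  subst h₂' h₁'
  exact h b

theorem comp_one_apex_ind {motive : (A.comp (one J)).apex → Prop}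
    (h : ∀ (a : A.apex), motive ⟨(a, A.r a, A.r a), rfl, rfl⟩) :
    ∀ t, motive t := by
  rintro ⟨⟨a, j', b⟩, h₁, h₂⟩
  have h₁' : A.r a = j' := h₁
  have h₂' : b = j' := h₂
  subst h₁' h₂'
  exact h a

theorem comp_one_comp_ind
    {motive : ∀ (i : I) (k : K), ((A.comp (one J)).comp B).El i k → Prop}
    (h : ∀ (a : A.apex) (b : B.apex) (h : B.l b = A.r a), motive (A.l a) (B.r b)
      ⟨⟨(⟨(a, A.r a, A.r a), rfl, rfl⟩, A.r a, b), rfl, h⟩, rfl, rfl⟩) :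
    ∀ (i : I) (k : K) (e : ((A.comp (one J)).comp B).El i k), motive i k e := by
  rintro i k ⟨⟨⟨⟨⟨a, j, c⟩, h₁, h₂⟩, j', b⟩, h₃, h₄⟩, h₅, h₆⟩
  have h₁' : A.r a = j := h₁
  have h₂' : c = j := h₂
  have h₃' : c = j' := h₃
  have h₅' : A.l a = i := h₅
  have h₆' : B.r b = k := h₆
  subst h₁' h₂' h₃' h₅' h₆'
  exact h a b h₄

theorem comp_one_comp_apex_ind {motive : ((A.comp (one J)).comp B).apex → Prop}
    (h : ∀ (a : A.apex) (b : B.apex) (h : B.l b = A.r a), motive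
      ⟨(⟨(a, A.r a, A.r a), rfl, rfl⟩, A.r a, b), rfl, h⟩) :
    ∀ t, motive t := by
  rintro ⟨⟨⟨⟨a, j, c⟩, h₁, h₂⟩, j', b⟩, h₃, h₄⟩
  have h₁' : A.r a = j := h₁
  have h₂' : c = j := h₂
  have h₃' : c = j' := h₃
  subst h₁' h₂' h₃'
  exact h a b h₄

end SetSpan

/-! ### The double category of families -/

section Families

variable (κ : IndexClass.{w}) (D : DblCat.{u₀, v₀, u₁, v₁})

/-- A family of objects. -/
structure FamObj where
  I : Type w
  memI : κ.mem I
  x : I → D.Obj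

variable {κ D}

/-- A family of proarrows: an indexing span together with a proarrow `m a : x i ⇸ y j` for each
element `a : i ⇸ j` of the indexing span. -/
structure FamPro (X Y : FamObj κ D) where
  A : SetSpan X.I Y.I
  memA : κ.mem A.apex
  m : ∀ {i : X.I} {j : Y.I}, A.El i j → D.Pro (X.x i) (Y.x j)

/-- The constituents of an identity proarrow family: `id_{x i} : x i ⇸ x i`. -/
def idPro {I : Type w} (x : I → D.Obj) : ∀ {i j : I}, (SetSpan.one I).El i j → D.Pro (x i) (x j)
  | _, _, ⟨i, rfl, rfl⟩ => D.hid (x i)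

/-- The identity proarrow on a family of objects. -/
def FamPro.hid (X : FamObj κ D) : FamPro X X where
  A := SetSpan.one X.I
  memA := X.memI
  m := idPro X.x

/-- Composition of families of proarrows: `(m ⊙ n) (a, b) = m a ⊙ n b`. -/
def FamPro.hcomp {X Y Z : FamObj κ D} (M : FamPro X Y) (N : FamPro Y Z) : FamPro X Z where
  A := M.A.comp N.A
  memA := κ.mem_sub M.memA Y.memI N.memA _
  m e := D.hcomp (M.m e.fst) (N.m e.snd)

/-- A morphism of (covariant) families. -/
@[ext]
structure FamHom (X Y : FamObj κ D) where
  f₀ : X.I → Y.I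
  f : ∀ i : X.I, X.x i ⟶ Y.x (f₀ i)

namespace FamHom

def id (X : FamObj κ D) : FamHom X X := ⟨fun i => i, fun i => 𝟙 (X.x i)⟩

def comp {X Y Z : FamObj κ D} (F : FamHom X Y) (G : FamHom Y Z) : FamHom X Z :=
  ⟨fun i => G.f₀ (F.f₀ i), fun i => F.f i ≫ G.f (F.f₀ i)⟩

theorem mk_eq {X Y : FamObj κ D} {f₀ : X.I → Y.I} {f f' : ∀ i : X.I, X.x i ⟶ Y.x (f₀ i)}
    (h : ∀ i, f i = f' i) : FamHom.mk f₀ f = FamHom.mk f₀ f' := by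
  obtain rfl : f = f' := funext h
  rfl

end FamHom

/-- A cell of (covariant) families. -/
structure FamCell {X Y W Z : FamObj κ D} (F : FamHom X W) (G : FamHom Y Z) (M : FamPro X Y)
    (N : FamPro W Z) where
  α₀ : M.A.apex → N.A.apex
  hl : ∀ a, N.A.l (α₀ a) = F.f₀ (M.A.l a)
  hr : ∀ a, N.A.r (α₀ a) = G.f₀ (M.A.r a)
  α : ∀ {i : X.I} {j : Y.I} (a : M.A.El i j),
    D.Cell (F.f i) (G.f j) (M.m a) (N.m (a.map α₀ F.f₀ G.f₀ hl hr))

variable (κ D) in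
/-- The category of families of objects. -/
@[reducible]
def famCat : Category (FamObj κ D) where
  Hom := FamHom
  id := FamHom.id
  comp := FamHom.comp
  id_comp _ := FamHom.mk_eq fun _ => Category.id_comp _
  comp_id _ := FamHom.mk_eq fun _ => Category.comp_id _
  assoc _ _ _ := FamHom.mk_eq fun _ => Category.assoc _ _ _

variable (κ D) in
/-- The data of the double category of families. -/
@[reducible]
def famQuiver : DblQuiver.{max u₀ (w + 1), max v₀ w, max u₁ (w + 1), max v₁ w} where
  Obj := FamObj κ D
  cat := famCat κ D
  Pro := FamPro
  Cell F G M N := FamCell F G M N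

theorem FamCell.sq_ext {X Y W Z : FamObj κ D} {M : FamPro X Y} {N : FamPro W Z}
    {F F' : FamHom X W} {G G' : FamHom Y Z} {α : FamCell F G M N} {β : FamCell F' G' M N}
    (hF : F = F') (hG : G = G') (h₀ : ∀ a, α.α₀ a = β.α₀ a)
    (h : ∀ (i : X.I) (j : Y.I) (a : M.A.El i j), HEq (α.α a) (β.α a)) :
    (famQuiver κ D).sq α = (famQuiver κ D).sq β := by
  subst hF hG
  congr 1
  obtain ⟨α₀, _, _, α⟩ := α
  obtain ⟨β₀, _, _, β⟩ := β
  obtain rfl : α₀ = β₀ := funext h₀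
  congr 1
  funext i j a
  exact eq_of_heq (h i j a)

namespace FamCell

theorem ext' {X Y W Z : FamObj κ D} {M : FamPro X Y} {N : FamPro W Z}
    {F : FamHom X W} {G : FamHom Y Z} {α β : FamCell F G M N} (h₀ : ∀ a, α.α₀ a = β.α₀ a)
    (h : ∀ (i : X.I) (j : Y.I) (a : M.A.El i j), HEq (α.α a) (β.α a)) : α = β := by
  obtain ⟨α₀, _, _, α⟩ := α
  obtain ⟨β₀, _, _, β⟩ := β
  obtain rfl : α₀ = β₀ := funext h₀
  congr 1
  funext i j a
  exact eq_of_heq (h i j a)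

def vid {X Y : FamObj κ D} (M : FamPro X Y) : FamCell (FamHom.id X) (FamHom.id Y) M M where
  α₀ a := a
  hl _ := rfl
  hr _ := rfl
  α a := D.vid (M.m a)

def vcomp {X Y X' Y' X'' Y'' : FamObj κ D} {F : FamHom X X'} {G : FamHom Y Y'}
    {F' : FamHom X' X''} {G' : FamHom Y' Y''} {M : FamPro X Y} {N : FamPro X' Y'}
    {P : FamPro X'' Y''} (φ : FamCell F G M N) (ψ : FamCell F' G' N P) :
    FamCell (F.comp F') (G.comp G') M P where
  α₀ a := ψ.α₀ (φ.α₀ a)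
  hl a := (ψ.hl _).trans (congrArg F'.f₀ (φ.hl a))
  hr a := (ψ.hr _).trans (congrArg G'.f₀ (φ.hr a))
  α a := D.vcomp (φ.α a) (ψ.α (a.map φ.α₀ F.f₀ G.f₀ φ.hl φ.hr))

/-- constituents of an identity cell -/
def hidAt {X Y : FamObj κ D} (F : FamHom X Y) : ∀ {i j : X.I} (a : (SetSpan.one X.I).El i j),
    D.Cell (F.f i) (F.f j) (idPro X.x a)
      (idPro Y.x (a.map (B := SetSpan.one Y.I) F.f₀ F.f₀ F.f₀ (fun _ => rfl) (fun _ => rfl)))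
  | _, _, ⟨i, rfl, rfl⟩ => D.hidCell (F.f i)

def hid {X Y : FamObj κ D} (F : FamHom X Y) : FamCell F F (FamPro.hid X) (FamPro.hid Y) where
  α₀ := F.f₀
  hl _ := rfl
  hr _ := rfl
  α a := hidAt F a

def hcomp {X Y Z X' Y' Z' : FamObj κ D} {F : FamHom X X'} {G : FamHom Y Y'} {H : FamHom Z Z'}
    {M : FamPro X Y} {N : FamPro Y Z} {M' : FamPro X' Y'} {N' : FamPro Y' Z'}
    (φ : FamCell F G M M') (ψ : FamCell G H N N') :
    FamCell F H (M.hcomp N) (M'.hcomp N') where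
  α₀ t := ⟨(φ.α₀ t.1.1, G.f₀ t.1.2.1, ψ.α₀ t.1.2.2),
    (φ.hr _).trans (congrArg G.f₀ t.2.1), (ψ.hl _).trans (congrArg G.f₀ t.2.2)⟩
  hl t := φ.hl t.1.1
  hr t := ψ.hr t.1.2.2
  α e := D.hcompCell (φ.α e.fst) (ψ.α e.snd)

def assocHom {X Y Z T : FamObj κ D} (M : FamPro X Y) (N : FamPro Y Z) (P : FamPro Z T) :
    FamCell (FamHom.id X) (FamHom.id T) ((M.hcomp N).hcomp P) (M.hcomp (N.hcomp P)) where
  α₀ t := ⟨(t.1.1.1.1, t.1.1.1.2.1, ⟨(t.1.1.1.2.2, t.1.2.1, t.1.2.2), t.2.1, t.2.2⟩),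
    t.1.1.2.1, t.1.1.2.2⟩
  hl _ := rfl
  hr _ := rfl
  α e := D.assocHom (M.m e.fst.fst) (N.m e.fst.snd) (P.m e.snd)

def assocInv {X Y Z T : FamObj κ D} (M : FamPro X Y) (N : FamPro Y Z) (P : FamPro Z T) :
    FamCell (FamHom.id X) (FamHom.id T) (M.hcomp (N.hcomp P)) ((M.hcomp N).hcomp P) where
  α₀ t := ⟨(⟨(t.1.1, t.1.2.1, t.1.2.2.1.1), t.2.1, t.2.2⟩, t.1.2.2.1.2.1, t.1.2.2.1.2.2),
    t.1.2.2.2.1, t.1.2.2.2.2⟩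
  hl _ := rfl
  hr _ := rfl
  α e := D.assocInv (M.m e.fst) (N.m e.snd.fst) (P.m e.snd.snd)

/-- constituents of the left unitor -/
def lunitHomAt {X Y : FamObj κ D} (M : FamPro X Y) : ∀ {i i' : X.I} {j : Y.I}
    (a : (SetSpan.one X.I).El i i') (b : M.A.El i' j) (h : M.A.l b.val = i),
    D.Cell (𝟙 (X.x i)) (𝟙 (Y.x j)) (D.hcomp (idPro X.x a) (M.m b)) (M.m ⟨b.val, h, b.hr⟩)
  | _, _, _, ⟨_, rfl, rfl⟩, b, _ => D.lunitHom (M.m b)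

/-- constituents of the right unitor -/
def runitHomAt {X Y : FamObj κ D} (M : FamPro X Y) : ∀ {i : X.I} {j j' : Y.I}
    (a : M.A.El i j) (b : (SetSpan.one Y.I).El j j') (h : M.A.r a.val = j'),
    D.Cell (𝟙 (X.x i)) (𝟙 (Y.x j')) (D.hcomp (M.m a) (idPro Y.x b)) (M.m ⟨a.val, a.hl, h⟩)
  | _, _, _, a, ⟨_, rfl, rfl⟩, _ => D.runitHom (M.m a)

/-- constituents of the inverse left unitor -/
def lunitInvAt {X Y : FamObj κ D} (M : FamPro X Y) : ∀ {i : X.I} {j : Y.I} (a : M.A.El i j),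
    D.Cell (𝟙 (X.x i)) (𝟙 (Y.x j)) (M.m a)
      (D.hcomp (idPro X.x ⟨M.A.l a.val, a.hl, rfl⟩) (M.m ⟨a.val, rfl, a.hr⟩))
  | _, _, ⟨a, rfl, h⟩ => D.lunitInv (M.m ⟨a, rfl, h⟩)

/-- constituents of the inverse right unitor -/
def runitInvAt {X Y : FamObj κ D} (M : FamPro X Y) : ∀ {i : X.I} {j : Y.I} (a : M.A.El i j),
    D.Cell (𝟙 (X.x i)) (𝟙 (Y.x j)) (M.m a)
      (D.hcomp (M.m ⟨a.val, a.hl, rfl⟩) (idPro Y.x ⟨M.A.r a.val, rfl, a.hr⟩))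
  | _, _, ⟨a, h, rfl⟩ => D.runitInv (M.m ⟨a, h, rfl⟩)

def lunitHom {X Y : FamObj κ D} (M : FamPro X Y) :
    FamCell (FamHom.id X) (FamHom.id Y) ((FamPro.hid X).hcomp M) M where
  α₀ t := t.1.2.2
  hl t := t.2.2.trans t.2.1.symm
  hr _ := rfl
  α e := lunitHomAt M e.fst e.snd _

def lunitInv {X Y : FamObj κ D} (M : FamPro X Y) :
    FamCell (FamHom.id X) (FamHom.id Y) M ((FamPro.hid X).hcomp M) where
  α₀ a := ⟨(M.A.l a, M.A.l a, a), rfl, rfl⟩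
  hl _ := rfl
  hr _ := rfl
  α a := lunitInvAt M a

def runitHom {X Y : FamObj κ D} (M : FamPro X Y) :
    FamCell (FamHom.id X) (FamHom.id Y) (M.hcomp (FamPro.hid Y)) M where
  α₀ t := t.1.1
  hl _ := rfl
  hr t := t.2.1.trans t.2.2.symm
  α e := runitHomAt M e.fst e.snd _

def runitInv {X Y : FamObj κ D} (M : FamPro X Y) :
    FamCell (FamHom.id X) (FamHom.id Y) M (M.hcomp (FamPro.hid Y)) where
  α₀ a := ⟨(a, M.A.r a, M.A.r a), rfl, rfl⟩
  hl _ := rfl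
  hr _ := rfl
  α a := runitInvAt M a

end FamCell

open DblCat (heq_of_sq)

variable (κ D) in
/-- The double category `Fam(D)` of (covariant) families in `D`, indexed by the sets in `κ`. -/
def famDbl : DblCat.{max u₀ (w + 1), max v₀ w, max u₁ (w + 1), max v₁ w} where
  toDblQuiver := famQuiver κ D
  vid := FamCell.vid (κ := κ) (D := D)
  vcomp := FamCell.vcomp (κ := κ) (D := D)
  vid_vcomp _ := FamCell.sq_ext (FamHom.mk_eq fun _ => Category.id_comp _)
    (FamHom.mk_eq fun _ => Category.id_comp _) (fun _ => rfl)
    fun _ _ _ => heq_of_sq (D.vid_vcomp _)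
  vcomp_vid _ := FamCell.sq_ext (FamHom.mk_eq fun _ => Category.comp_id _)
    (FamHom.mk_eq fun _ => Category.comp_id _) (fun _ => rfl)
    fun _ _ _ => heq_of_sq (D.vcomp_vid _)
  vcomp_assoc _ _ _ := FamCell.sq_ext (FamHom.mk_eq fun _ => Category.assoc _ _ _)
    (FamHom.mk_eq fun _ => Category.assoc _ _ _) (fun _ => rfl)
    fun _ _ _ => heq_of_sq (D.vcomp_assoc _ _ _)
  hid := FamPro.hid (κ := κ) (D := D)
  hidCell := FamCell.hid (κ := κ) (D := D)
  hcomp := FamPro.hcomp (κ := κ) (D := D)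
  hcompCell := FamCell.hcomp (κ := κ) (D := D)
  assocHom := FamCell.assocHom (κ := κ) (D := D)
  assocInv := FamCell.assocInv (κ := κ) (D := D)
  lunitHom := FamCell.lunitHom (κ := κ) (D := D)
  lunitInv := FamCell.lunitInv (κ := κ) (D := D)
  runitHom := FamCell.runitHom (κ := κ) (D := D)
  runitInv := FamCell.runitInv (κ := κ) (D := D)
  hidCell_id X := FamCell.ext' (fun _ => rfl) (by
    rintro _ _ ⟨i, rfl, rfl⟩
    exact heq_of_eq (D.hidCell_id (X.x i)))
  hidCell_comp F G := FamCell.ext' (fun _ => rfl) (by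
    rintro _ _ ⟨i, rfl, rfl⟩
    exact heq_of_eq (D.hidCell_comp (F.f i) (G.f (F.f₀ i))))
  hcompCell_vid M N := FamCell.ext' (fun _ => rfl) fun _ _ _ => heq_of_eq (D.hcompCell_vid _ _)
  interchange _ _ _ _ := FamCell.ext' (fun _ => rfl)
    fun _ _ _ => heq_of_eq (D.interchange _ _ _ _)
  assoc_hom_inv _ _ _ := FamCell.sq_ext (FamHom.mk_eq fun _ => Category.id_comp _)
    (FamHom.mk_eq fun _ => Category.id_comp _) (fun _ => rfl)
    fun _ _ _ => heq_of_sq (D.assoc_hom_inv _ _ _)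
  assoc_inv_hom _ _ _ := FamCell.sq_ext (FamHom.mk_eq fun _ => Category.id_comp _)
    (FamHom.mk_eq fun _ => Category.id_comp _) (fun _ => rfl)
    fun _ _ _ => heq_of_sq (D.assoc_inv_hom _ _ _)
  lunit_hom_inv M := FamCell.sq_ext (FamHom.mk_eq fun _ => Category.id_comp _)
    (FamHom.mk_eq fun _ => Category.id_comp _)
    (SetSpan.one_comp_apex_ind fun _ => rfl)
    (SetSpan.one_comp_ind fun b => heq_of_sq (D.lunit_hom_inv (M.m ⟨b, rfl, rfl⟩)))
  lunit_inv_hom M := FamCell.sq_ext (FamHom.mk_eq fun _ => Category.id_comp _)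
    (FamHom.mk_eq fun _ => Category.id_comp _) (fun _ => rfl)
    (by rintro _ _ ⟨a, rfl, rfl⟩; exact heq_of_sq (D.lunit_inv_hom (M.m ⟨a, rfl, rfl⟩)))
  runit_hom_inv M := FamCell.sq_ext (FamHom.mk_eq fun _ => Category.id_comp _)
    (FamHom.mk_eq fun _ => Category.id_comp _)
    (SetSpan.comp_one_apex_ind fun _ => rfl)
    (SetSpan.comp_one_ind fun a => heq_of_sq (D.runit_hom_inv (M.m ⟨a, rfl, rfl⟩)))
  runit_inv_hom M := FamCell.sq_ext (FamHom.mk_eq fun _ => Category.id_comp _)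
    (FamHom.mk_eq fun _ => Category.id_comp _) (fun _ => rfl)
    (by rintro _ _ ⟨a, rfl, rfl⟩; exact heq_of_sq (D.runit_inv_hom (M.m ⟨a, rfl, rfl⟩)))
  assoc_naturality α β γ := FamCell.sq_ext
    (FamHom.mk_eq fun _ => (Category.comp_id _).trans (Category.id_comp _).symm)
    (FamHom.mk_eq fun _ => (Category.comp_id _).trans (Category.id_comp _).symm)
    (fun _ => rfl) fun _ _ _ => heq_of_sq (D.assoc_naturality _ _ _)
  lunit_naturality α := FamCell.sq_ext
    (FamHom.mk_eq fun _ => (Category.comp_id _).trans (Category.id_comp _).symm)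
    (FamHom.mk_eq fun _ => (Category.comp_id _).trans (Category.id_comp _).symm)
    (fun _ => rfl) (SetSpan.one_comp_ind fun b =>
      heq_of_sq (D.lunit_naturality (α.α ⟨b, rfl, rfl⟩)))
  runit_naturality α := FamCell.sq_ext
    (FamHom.mk_eq fun _ => (Category.comp_id _).trans (Category.id_comp _).symm)
    (FamHom.mk_eq fun _ => (Category.comp_id _).trans (Category.id_comp _).symm)
    (fun _ => rfl) (SetSpan.comp_one_ind fun a =>
      heq_of_sq (D.runit_naturality (α.α ⟨a, rfl, rfl⟩)))
  pentagon _ _ _ _ := FamCell.sq_ext (FamHom.mk_eq fun _ => Category.id_comp _)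
    (FamHom.mk_eq fun _ => Category.id_comp _) (fun _ => rfl)
    fun _ _ _ => heq_of_sq (D.pentagon _ _ _ _)
  triangle M N := FamCell.sq_ext (FamHom.mk_eq fun _ => Category.id_comp _)
    (FamHom.mk_eq fun _ => Category.id_comp _)
    (SetSpan.comp_one_comp_apex_ind fun _ _ _ => rfl)
    (SetSpan.comp_one_comp_ind fun a b h =>
      heq_of_sq (D.triangle (M.m ⟨a, rfl, rfl⟩) (N.m ⟨b, h, rfl⟩)))

end Families

/-! ### The double category of contravariant families -/

section OpFamilies

variable {κ : IndexClass.{w}} {D : DblCat.{u₀, v₀, u₁, v₁}}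

/-- A morphism of contravariant families: a function between the indexing sets in the opposite
direction together with arrows `x (f₀ j) ⟶ y j`. -/
@[ext]
structure OpFamHom (X Y : FamObj κ D) where
  f₀ : Y.I → X.I
  f : ∀ j : Y.I, X.x (f₀ j) ⟶ Y.x j

namespace OpFamHom

def id (X : FamObj κ D) : OpFamHom X X := ⟨fun i => i, fun i => 𝟙 (X.x i)⟩

def comp {X Y Z : FamObj κ D} (F : OpFamHom X Y) (G : OpFamHom Y Z) : OpFamHom X Z :=
  ⟨fun k => F.f₀ (G.f₀ k), fun k => F.f (G.f₀ k) ≫ G.f k⟩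

theorem mk_eq {X Y : FamObj κ D} {f₀ : Y.I → X.I} {f f' : ∀ j : Y.I, X.x (f₀ j) ⟶ Y.x j}
    (h : ∀ i, f i = f' i) : OpFamHom.mk f₀ f = OpFamHom.mk f₀ f' := by
  obtain rfl : f = f' := funext h
  rfl

end OpFamHom

/-- A cell of contravariant families. -/
structure OpFamCell {X Y W Z : FamObj κ D} (F : OpFamHom X W) (G : OpFamHom Y Z) (M : FamPro X Y)
    (N : FamPro W Z) where
  α₀ : N.A.apex → M.A.apex
  hl : ∀ b, M.A.l (α₀ b) = F.f₀ (N.A.l b)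
  hr : ∀ b, M.A.r (α₀ b) = G.f₀ (N.A.r b)
  α : ∀ {k : W.I} {l : Z.I} (b : N.A.El k l),
    D.Cell (F.f k) (G.f l) (M.m (b.map α₀ F.f₀ G.f₀ hl hr)) (N.m b)

variable (κ D) in
/-- The category of contravariant families of objects. -/
@[reducible]
def opFamCat : Category (FamObj κ D) where
  Hom := OpFamHom
  id := OpFamHom.id
  comp := OpFamHom.comp
  id_comp _ := OpFamHom.mk_eq fun _ => Category.id_comp _
  comp_id _ := OpFamHom.mk_eq fun _ => Category.comp_id _
  assoc _ _ _ := OpFamHom.mk_eq fun _ => Category.assoc _ _ _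

variable (κ D) in
/-- The data of the double category of contravariant families. -/
@[reducible]
def opFamQuiver : DblQuiver.{max u₀ (w + 1), max v₀ w, max u₁ (w + 1), max v₁ w} where
  Obj := FamObj κ D
  cat := opFamCat κ D
  Pro := FamPro
  Cell F G M N := OpFamCell F G M N

namespace OpFamCell

theorem ext' {X Y W Z : FamObj κ D} {M : FamPro X Y} {N : FamPro W Z}
    {F : OpFamHom X W} {G : OpFamHom Y Z} {α β : OpFamCell F G M N}
    (h₀ : ∀ b, α.α₀ b = β.α₀ b)
    (h : ∀ (k : W.I) (l : Z.I) (b : N.A.El k l), HEq (α.α b) (β.α b)) : α = β := by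
  obtain ⟨α₀, _, _, α⟩ := α
  obtain ⟨β₀, _, _, β⟩ := β
  obtain rfl : α₀ = β₀ := funext h₀
  congr 1
  funext i j a
  exact eq_of_heq (h i j a)

theorem sq_ext {X Y W Z : FamObj κ D} {M : FamPro X Y} {N : FamPro W Z}
    {F F' : OpFamHom X W} {G G' : OpFamHom Y Z} {α : OpFamCell F G M N} {β : OpFamCell F' G' M N}
    (hF : F = F') (hG : G = G') (h₀ : ∀ b, α.α₀ b = β.α₀ b)
    (h : ∀ (k : W.I) (l : Z.I) (b : N.A.El k l), HEq (α.α b) (β.α b)) :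
    (opFamQuiver κ D).sq α = (opFamQuiver κ D).sq β := by
  subst hF hG
  congr 1
  exact ext' h₀ h

def vid {X Y : FamObj κ D} (M : FamPro X Y) : OpFamCell (OpFamHom.id X) (OpFamHom.id Y) M M where
  α₀ a := a
  hl _ := rfl
  hr _ := rfl
  α a := D.vid (M.m a)

def vcomp {X Y X' Y' X'' Y'' : FamObj κ D} {F : OpFamHom X X'} {G : OpFamHom Y Y'}
    {F' : OpFamHom X' X''} {G' : OpFamHom Y' Y''} {M : FamPro X Y} {N : FamPro X' Y'}
    {P : FamPro X'' Y''} (φ : OpFamCell F G M N) (ψ : OpFamCell F' G' N P) :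
    OpFamCell (F.comp F') (G.comp G') M P where
  α₀ c := φ.α₀ (ψ.α₀ c)
  hl c := (φ.hl _).trans (congrArg F.f₀ (ψ.hl c))
  hr c := (φ.hr _).trans (congrArg G.f₀ (ψ.hr c))
  α c := D.vcomp (φ.α (c.map ψ.α₀ F'.f₀ G'.f₀ ψ.hl ψ.hr)) (ψ.α c)

/-- constituents of an identity cell -/
def hidAt {X Y : FamObj κ D} (F : OpFamHom X Y) : ∀ {i j : Y.I} (a : (SetSpan.one Y.I).El i j),
    D.Cell (F.f i) (F.f j)
      (idPro X.x (a.map (B := SetSpan.one X.I) F.f₀ F.f₀ F.f₀ (fun _ => rfl) (fun _ => rfl)))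
      (idPro Y.x a)
  | _, _, ⟨i, rfl, rfl⟩ => D.hidCell (F.f i)

def hid {X Y : FamObj κ D} (F : OpFamHom X Y) :
    OpFamCell F F (FamPro.hid X) (FamPro.hid Y) where
  α₀ := F.f₀
  hl _ := rfl
  hr _ := rfl
  α a := hidAt F a

def hcomp {X Y Z X' Y' Z' : FamObj κ D} {F : OpFamHom X X'} {G : OpFamHom Y Y'}
    {H : OpFamHom Z Z'} {M : FamPro X Y} {N : FamPro Y Z} {M' : FamPro X' Y'} {N' : FamPro Y' Z'}
    (φ : OpFamCell F G M M') (ψ : OpFamCell G H N N') :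
    OpFamCell F H (M.hcomp N) (M'.hcomp N') where
  α₀ t := ⟨(φ.α₀ t.1.1, G.f₀ t.1.2.1, ψ.α₀ t.1.2.2),
    (φ.hr _).trans (congrArg G.f₀ t.2.1), (ψ.hl _).trans (congrArg G.f₀ t.2.2)⟩
  hl t := φ.hl t.1.1
  hr t := ψ.hr t.1.2.2
  α e := D.hcompCell (φ.α e.fst) (ψ.α e.snd)

def assocHom {X Y Z T : FamObj κ D} (M : FamPro X Y) (N : FamPro Y Z) (P : FamPro Z T) :
    OpFamCell (OpFamHom.id X) (OpFamHom.id T) ((M.hcomp N).hcomp P) (M.hcomp (N.hcomp P)) where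
  α₀ t := ⟨(⟨(t.1.1, t.1.2.1, t.1.2.2.1.1), t.2.1, t.2.2⟩, t.1.2.2.1.2.1, t.1.2.2.1.2.2),
    t.1.2.2.2.1, t.1.2.2.2.2⟩
  hl _ := rfl
  hr _ := rfl
  α e := D.assocHom (M.m e.fst) (N.m e.snd.fst) (P.m e.snd.snd)

def assocInv {X Y Z T : FamObj κ D} (M : FamPro X Y) (N : FamPro Y Z) (P : FamPro Z T) :
    OpFamCell (OpFamHom.id X) (OpFamHom.id T) (M.hcomp (N.hcomp P)) ((M.hcomp N).hcomp P) where
  α₀ t := ⟨(t.1.1.1.1, t.1.1.1.2.1, ⟨(t.1.1.1.2.2, t.1.2.1, t.1.2.2), t.2.1, t.2.2⟩),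
    t.1.1.2.1, t.1.1.2.2⟩
  hl _ := rfl
  hr _ := rfl
  α e := D.assocInv (M.m e.fst.fst) (N.m e.fst.snd) (P.m e.snd)

/-- constituents of the left unitor -/
def lunitHomAt {X Y : FamObj κ D} (M : FamPro X Y) : ∀ {i : X.I} {j : Y.I} (a : M.A.El i j),
    D.Cell (𝟙 (X.x i)) (𝟙 (Y.x j))
      (D.hcomp (idPro X.x ⟨M.A.l a.val, a.hl, rfl⟩) (M.m ⟨a.val, rfl, a.hr⟩)) (M.m a)
  | _, _, ⟨a, rfl, h⟩ => D.lunitHom (M.m ⟨a, rfl, h⟩)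

/-- constituents of the right unitor -/
def runitHomAt {X Y : FamObj κ D} (M : FamPro X Y) : ∀ {i : X.I} {j : Y.I} (a : M.A.El i j),
    D.Cell (𝟙 (X.x i)) (𝟙 (Y.x j))
      (D.hcomp (M.m ⟨a.val, a.hl, rfl⟩) (idPro Y.x ⟨M.A.r a.val, rfl, a.hr⟩)) (M.m a)
  | _, _, ⟨a, h, rfl⟩ => D.runitHom (M.m ⟨a, h, rfl⟩)

/-- constituents of the inverse left unitor -/
def lunitInvAt {X Y : FamObj κ D} (M : FamPro X Y) : ∀ {i i' : X.I} {j : Y.I}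
    (a : (SetSpan.one X.I).El i i') (b : M.A.El i' j) (h : M.A.l b.val = i),
    D.Cell (𝟙 (X.x i)) (𝟙 (Y.x j)) (M.m ⟨b.val, h, b.hr⟩) (D.hcomp (idPro X.x a) (M.m b))
  | _, _, _, ⟨_, rfl, rfl⟩, b, _ => D.lunitInv (M.m b)

/-- constituents of the inverse right unitor -/
def runitInvAt {X Y : FamObj κ D} (M : FamPro X Y) : ∀ {i : X.I} {j j' : Y.I}
    (a : M.A.El i j) (b : (SetSpan.one Y.I).El j j') (h : M.A.r a.val = j'),
    D.Cell (𝟙 (X.x i)) (𝟙 (Y.x j')) (M.m ⟨a.val, a.hl, h⟩) (D.hcomp (M.m a) (idPro Y.x b))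
  | _, _, _, a, ⟨_, rfl, rfl⟩, _ => D.runitInv (M.m a)

def lunitHom {X Y : FamObj κ D} (M : FamPro X Y) :
    OpFamCell (OpFamHom.id X) (OpFamHom.id Y) ((FamPro.hid X).hcomp M) M where
  α₀ a := ⟨(M.A.l a, M.A.l a, a), rfl, rfl⟩
  hl _ := rfl
  hr _ := rfl
  α a := lunitHomAt M a

def lunitInv {X Y : FamObj κ D} (M : FamPro X Y) :
    OpFamCell (OpFamHom.id X) (OpFamHom.id Y) M ((FamPro.hid X).hcomp M) where
  α₀ t := t.1.2.2
  hl t := t.2.2.trans t.2.1.symm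
  hr _ := rfl
  α e := lunitInvAt M e.fst e.snd _

def runitHom {X Y : FamObj κ D} (M : FamPro X Y) :
    OpFamCell (OpFamHom.id X) (OpFamHom.id Y) (M.hcomp (FamPro.hid Y)) M where
  α₀ a := ⟨(a, M.A.r a, M.A.r a), rfl, rfl⟩
  hl _ := rfl
  hr _ := rfl
  α a := runitHomAt M a

def runitInv {X Y : FamObj κ D} (M : FamPro X Y) :
    OpFamCell (OpFamHom.id X) (OpFamHom.id Y) M (M.hcomp (FamPro.hid Y)) where
  α₀ t := t.1.1
  hl _ := rfl
  hr t := t.2.1.trans t.2.2.symm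
  α e := runitInvAt M e.fst e.snd _

theorem lunitHomAt_vcomp {X Y : FamObj κ D} (M : FamPro X Y) {i : X.I} {j : Y.I}
    (a : M.A.El i j) {x' y' : D.Obj} {f : X.x i ⟶ x'} {g : Y.x j ⟶ y'} {n : D.Pro x' y'}
    (β : D.Cell f g (M.m a) n) :
    HEq (D.vcomp (D.lunitHom (M.m a)) β) (D.vcomp (lunitHomAt M a) β) := by
  obtain ⟨a, rfl, h⟩ := a
  exact HEq.rfl

theorem runitHomAt_vcomp {X Y : FamObj κ D} (M : FamPro X Y) {i : X.I} {j : Y.I}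
    (a : M.A.El i j) {x' y' : D.Obj} {f : X.x i ⟶ x'} {g : Y.x j ⟶ y'} {n : D.Pro x' y'}
    (β : D.Cell f g (M.m a) n) :
    HEq (D.vcomp (D.runitHom (M.m a)) β) (D.vcomp (runitHomAt M a) β) := by
  obtain ⟨a, h, rfl⟩ := a
  exact HEq.rfl

theorem triangle_aux {X Y Z : FamObj κ D} (M : FamPro X Y) (N : FamPro Y Z) {i : X.I} {j : Y.I}
    {k : Z.I} (a : M.A.El i j) (b : N.A.El j k) :
    HEq (D.vcomp (D.assocHom (M.m a) (idPro Y.x ⟨N.A.l b.val, b.hl, rfl⟩)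
        (N.m ⟨b.val, rfl, b.hr⟩)) (D.hcompCell (D.vid (M.m a)) (lunitHomAt N b)))
      (D.hcompCell (runitHomAt M a) (D.vid (N.m b))) := by
  have h₁ : HEq (D.vcomp (D.assocHom (M.m a) (idPro Y.x ⟨N.A.l b.val, b.hl, rfl⟩)
        (N.m ⟨b.val, rfl, b.hr⟩)) (D.hcompCell (D.vid (M.m a)) (lunitHomAt N b)))
      (D.vcomp (D.assocHom (M.m a) (D.hid _) (N.m b))
        (D.hcompCell (D.vid (M.m a)) (D.lunitHom (N.m b)))) := by
    obtain ⟨b, rfl, h⟩ := b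
    exact HEq.rfl
  have h₂ : HEq (D.hcompCell (D.runitHom (M.m a)) (D.vid (N.m b)))
      (D.hcompCell (runitHomAt M a) (D.vid (N.m b))) := by
    obtain ⟨a, h, rfl⟩ := a
    exact HEq.rfl
  exact h₁.trans ((DblCat.heq_of_sq (D.triangle (M.m a) (N.m b))).trans h₂)

end OpFamCell

open DblCat (heq_of_sq)

variable (κ D) in
/-- The double category `Fam*(D)` of contravariant families in `D`, indexed by the sets in `κ`.
It has the same objects and proarrows as `Fam(D)`. -/
def opFamDbl : DblCat.{max u₀ (w + 1), max v₀ w, max u₁ (w + 1), max v₁ w} where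
  toDblQuiver := opFamQuiver κ D
  vid := OpFamCell.vid (κ := κ) (D := D)
  vcomp := OpFamCell.vcomp (κ := κ) (D := D)
  vid_vcomp _ := OpFamCell.sq_ext (OpFamHom.mk_eq fun _ => Category.id_comp _)
    (OpFamHom.mk_eq fun _ => Category.id_comp _) (fun _ => rfl)
    fun _ _ _ => heq_of_sq (D.vid_vcomp _)
  vcomp_vid _ := OpFamCell.sq_ext (OpFamHom.mk_eq fun _ => Category.comp_id _)
    (OpFamHom.mk_eq fun _ => Category.comp_id _) (fun _ => rfl)
    fun _ _ _ => heq_of_sq (D.vcomp_vid _)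
  vcomp_assoc _ _ _ := OpFamCell.sq_ext (OpFamHom.mk_eq fun _ => Category.assoc _ _ _)
    (OpFamHom.mk_eq fun _ => Category.assoc _ _ _) (fun _ => rfl)
    fun _ _ _ => heq_of_sq (D.vcomp_assoc _ _ _)
  hid := FamPro.hid (κ := κ) (D := D)
  hidCell := OpFamCell.hid (κ := κ) (D := D)
  hcomp := FamPro.hcomp (κ := κ) (D := D)
  hcompCell := OpFamCell.hcomp (κ := κ) (D := D)
  assocHom := OpFamCell.assocHom (κ := κ) (D := D)
  assocInv := OpFamCell.assocInv (κ := κ) (D := D)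
  lunitHom := OpFamCell.lunitHom (κ := κ) (D := D)
  lunitInv := OpFamCell.lunitInv (κ := κ) (D := D)
  runitHom := OpFamCell.runitHom (κ := κ) (D := D)
  runitInv := OpFamCell.runitInv (κ := κ) (D := D)
  hidCell_id X := OpFamCell.ext' (fun _ => rfl) (by
    rintro _ _ ⟨i, rfl, rfl⟩
    exact heq_of_eq (D.hidCell_id (X.x i)))
  hidCell_comp F G := OpFamCell.ext' (fun _ => rfl) (by
    rintro _ _ ⟨i, rfl, rfl⟩
    exact heq_of_eq (D.hidCell_comp (F.f (G.f₀ i)) (G.f i)))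
  hcompCell_vid M N := OpFamCell.ext' (fun _ => rfl) fun _ _ _ => heq_of_eq (D.hcompCell_vid _ _)
  interchange _ _ _ _ := OpFamCell.ext' (fun _ => rfl)
    fun _ _ _ => heq_of_eq (D.interchange _ _ _ _)
  assoc_hom_inv _ _ _ := OpFamCell.sq_ext (OpFamHom.mk_eq fun _ => Category.id_comp _)
    (OpFamHom.mk_eq fun _ => Category.id_comp _) (fun _ => rfl)
    fun _ _ _ => heq_of_sq (D.assoc_hom_inv _ _ _)
  assoc_inv_hom _ _ _ := OpFamCell.sq_ext (OpFamHom.mk_eq fun _ => Category.id_comp _)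
    (OpFamHom.mk_eq fun _ => Category.id_comp _) (fun _ => rfl)
    fun _ _ _ => heq_of_sq (D.assoc_inv_hom _ _ _)
  lunit_hom_inv M := OpFamCell.sq_ext (OpFamHom.mk_eq fun _ => Category.id_comp _)
    (OpFamHom.mk_eq fun _ => Category.id_comp _)
    (SetSpan.one_comp_apex_ind fun _ => rfl)
    (SetSpan.one_comp_ind fun b => heq_of_sq (D.lunit_hom_inv (M.m ⟨b, rfl, rfl⟩)))
  lunit_inv_hom M := OpFamCell.sq_ext (OpFamHom.mk_eq fun _ => Category.id_comp _)
    (OpFamHom.mk_eq fun _ => Category.id_comp _) (fun _ => rfl)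
    (by rintro _ _ ⟨a, rfl, rfl⟩; exact heq_of_sq (D.lunit_inv_hom (M.m ⟨a, rfl, rfl⟩)))
  runit_hom_inv M := OpFamCell.sq_ext (OpFamHom.mk_eq fun _ => Category.id_comp _)
    (OpFamHom.mk_eq fun _ => Category.id_comp _)
    (SetSpan.comp_one_apex_ind fun _ => rfl)
    (SetSpan.comp_one_ind fun a => heq_of_sq (D.runit_hom_inv (M.m ⟨a, rfl, rfl⟩)))
  runit_inv_hom M := OpFamCell.sq_ext (OpFamHom.mk_eq fun _ => Category.id_comp _)
    (OpFamHom.mk_eq fun _ => Category.id_comp _) (fun _ => rfl)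
    (by rintro _ _ ⟨a, rfl, rfl⟩; exact heq_of_sq (D.runit_inv_hom (M.m ⟨a, rfl, rfl⟩)))
  assoc_naturality _ _ _ := OpFamCell.sq_ext
    (OpFamHom.mk_eq fun _ => (Category.comp_id _).trans (Category.id_comp _).symm)
    (OpFamHom.mk_eq fun _ => (Category.comp_id _).trans (Category.id_comp _).symm)
    (fun _ => rfl) fun _ _ _ => heq_of_sq (D.assoc_naturality _ _ _)
  lunit_naturality {_ _ _ _ _ _ M _} α := OpFamCell.sq_ext
    (OpFamHom.mk_eq fun _ => (Category.comp_id _).trans (Category.id_comp _).symm)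
    (OpFamHom.mk_eq fun _ => (Category.comp_id _).trans (Category.id_comp _).symm)
    (fun b => Subtype.ext (Prod.ext (α.hl b).symm (Prod.ext (α.hl b).symm rfl)))
    (by
      rintro _ _ ⟨b, rfl, rfl⟩
      exact (heq_of_sq (D.lunit_naturality (α.α ⟨b, rfl, rfl⟩))).trans
        (OpFamCell.lunitHomAt_vcomp M _ _))
  runit_naturality {_ _ _ _ _ _ M _} α := OpFamCell.sq_ext
    (OpFamHom.mk_eq fun _ => (Category.comp_id _).trans (Category.id_comp _).symm)
    (OpFamHom.mk_eq fun _ => (Category.comp_id _).trans (Category.id_comp _).symm)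
    (fun b => Subtype.ext (Prod.ext rfl (Prod.ext (α.hr b).symm (α.hr b).symm)))
    (by
      rintro _ _ ⟨b, rfl, rfl⟩
      exact (heq_of_sq (D.runit_naturality (α.α ⟨b, rfl, rfl⟩))).trans
        (OpFamCell.runitHomAt_vcomp M _ _))
  pentagon _ _ _ _ := OpFamCell.sq_ext (OpFamHom.mk_eq fun _ => Category.id_comp _)
    (OpFamHom.mk_eq fun _ => Category.id_comp _) (fun _ => rfl)
    fun _ _ _ => heq_of_sq (D.pentagon _ _ _ _)
  triangle M N := OpFamCell.sq_ext (OpFamHom.mk_eq fun _ => Category.id_comp _)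
    (OpFamHom.mk_eq fun _ => Category.id_comp _)
    (fun t => Subtype.ext (Prod.ext (Subtype.ext (Prod.ext rfl
      (Prod.ext t.2.1.symm (t.2.2.trans t.2.1.symm)))) (Prod.ext t.2.2 rfl)))
    fun _ _ e => OpFamCell.triangle_aux M N e.fst e.snd

end OpFamilies

/-! ### Diagonals, lax products and colax coproducts -/

section Diagonal

variable (κ : IndexClass.{w}) (D : DblCat.{u₀, v₀, u₁, v₁})

open DblCat (heq_of_sq)

variable {D} in
/-- The family consisting of a single object. -/
def FamObj.single (x : D.Obj) : FamObj κ D where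
  I := PUnit
  memI := κ.mem_punit
  x _ := x

variable {D} in
/-- The family consisting of a single proarrow, indexed by the identity span on a singleton. -/
def FamPro.single {x y : D.Obj} (m : D.Pro x y) :
    FamPro (FamObj.single κ x) (FamObj.single κ y) where
  A := SetSpan.one PUnit
  memA := κ.mem_punit
  m _ := m

variable {κ D} in
/-- constituent of the identity comparison of the contravariant diagonal -/
def OpFamCell.singleIdAt (x : D.Obj) : ∀ {i j : PUnit.{w + 1}} (a : (SetSpan.one PUnit).El i j),
    D.Cell (𝟙 x) (𝟙 x) (idPro (fun _ => x) a) (D.hid x)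
  | _, _, ⟨_, rfl, rfl⟩ => D.vid (D.hid x)

variable {κ D} in
/-- constituent of the identity comparison of the covariant diagonal -/
def FamCell.singleIdAt (x : D.Obj) : ∀ {i j : PUnit.{w + 1}} (a : (SetSpan.one PUnit).El i j),
    D.Cell (𝟙 x) (𝟙 x) (D.hid x) (idPro (fun _ => x) a)
  | _, _, ⟨_, rfl, rfl⟩ => D.vid (D.hid x)

/-- The diagonal `D → Fam*(D)`, sending each object and each proarrow to the family consisting of
it alone. Its comparison cells have identities of `D` as constituents. -/
def deltaOp : LaxDblFunctor D (opFamDbl κ D) where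
  obj x := FamObj.single κ x
  map {x y} f := (⟨fun i => i, fun _ => f⟩ : OpFamHom (FamObj.single κ x) (FamObj.single κ y))
  pro m := FamPro.single κ m
  cell {x y w z f g m n} α :=
    (⟨fun a => a, fun _ => rfl, fun _ => rfl, fun _ => α⟩ :
      OpFamCell (X := FamObj.single κ x) (Y := FamObj.single κ y) (W := FamObj.single κ w)
        (Z := FamObj.single κ z) ⟨fun i => i, fun _ => f⟩ ⟨fun i => i, fun _ => g⟩
        (FamPro.single κ m) (FamPro.single κ n))
  map_id _ := rfl
  map_comp _ _ := rfl
  cell_vid _ := rfl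
  cell_vcomp _ _ := rfl
  laxComp {x y z} m n :=
    (⟨fun _ => ⟨(PUnit.unit, PUnit.unit, PUnit.unit), rfl, rfl⟩, fun _ => rfl, fun _ => rfl,
        fun _ => D.vid (D.hcomp m n)⟩ :
      OpFamCell (OpFamHom.id _) (OpFamHom.id _)
        ((FamPro.single κ m).hcomp (FamPro.single κ n)) (FamPro.single κ (D.hcomp m n)))
  laxId x :=
    (⟨fun a => a, fun _ => rfl, fun _ => rfl, fun a => OpFamCell.singleIdAt x a⟩ :
      OpFamCell (OpFamHom.id _) (OpFamHom.id _)
        (FamPro.hid (FamObj.single κ x)) (FamPro.single κ (D.hid x)))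
  laxComp_naturality α β := OpFamCell.sq_ext
    (OpFamHom.mk_eq fun _ => (Category.comp_id _).trans (Category.id_comp _).symm)
    (OpFamHom.mk_eq fun _ => (Category.comp_id _).trans (Category.id_comp _).symm)
    (fun _ => rfl) fun _ _ _ => heq_of_sq ((D.vcomp_vid _).trans (D.vid_vcomp _).symm)
  laxId_naturality f := OpFamCell.sq_ext
    (OpFamHom.mk_eq fun _ => (Category.comp_id _).trans (Category.id_comp _).symm)
    (OpFamHom.mk_eq fun _ => (Category.comp_id _).trans (Category.id_comp _).symm)
    (fun _ => rfl) (by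
      rintro _ _ ⟨_, rfl, rfl⟩
      exact heq_of_sq ((D.vcomp_vid _).trans (D.vid_vcomp _).symm))
  associativity m n p := OpFamCell.sq_ext
    (OpFamHom.mk_eq fun _ => rfl) (OpFamHom.mk_eq fun _ => rfl)
    (fun _ => rfl) fun _ _ _ => heq_of_sq ((LaxDblFunctor.id D).associativity m n p)
  left_unitality m := OpFamCell.sq_ext
    (OpFamHom.mk_eq fun _ => (Category.id_comp _).trans (Category.id_comp _))
    (OpFamHom.mk_eq fun _ => (Category.id_comp _).trans (Category.id_comp _))
    (fun _ => rfl) (by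
      rintro _ _ ⟨_, rfl, rfl⟩
      exact heq_of_sq ((LaxDblFunctor.id D).left_unitality m))
  right_unitality m := OpFamCell.sq_ext
    (OpFamHom.mk_eq fun _ => (Category.id_comp _).trans (Category.id_comp _))
    (OpFamHom.mk_eq fun _ => (Category.id_comp _).trans (Category.id_comp _))
    (fun _ => rfl) (by
      rintro _ _ ⟨_, rfl, rfl⟩
      exact heq_of_sq ((LaxDblFunctor.id D).right_unitality m))

/-- The diagonal `D → Fam(D)`, sending each object and each proarrow to the family consisting of
it alone. Its comparison cells have identities of `D` as constituents. -/
def delta : ColaxDblFunctor D (famDbl κ D) where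
  obj x := FamObj.single κ x
  map {x y} f := (⟨fun i => i, fun _ => f⟩ : FamHom (FamObj.single κ x) (FamObj.single κ y))
  pro m := FamPro.single κ m
  cell {x y w z f g m n} α :=
    (⟨fun a => a, fun _ => rfl, fun _ => rfl, fun _ => α⟩ :
      FamCell (X := FamObj.single κ x) (Y := FamObj.single κ y) (W := FamObj.single κ w)
        (Z := FamObj.single κ z) ⟨fun i => i, fun _ => f⟩ ⟨fun i => i, fun _ => g⟩
        (FamPro.single κ m) (FamPro.single κ n))
  map_id _ := rfl
  map_comp _ _ := rfl
  cell_vid _ := rfl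
  cell_vcomp _ _ := rfl
  colaxComp {x y z} m n :=
    (⟨fun _ => ⟨(PUnit.unit, PUnit.unit, PUnit.unit), rfl, rfl⟩, fun _ => rfl, fun _ => rfl,
        fun _ => D.vid (D.hcomp m n)⟩ :
      FamCell (FamHom.id _) (FamHom.id _)
        (FamPro.single κ (D.hcomp m n)) ((FamPro.single κ m).hcomp (FamPro.single κ n)))
  colaxId x :=
    (⟨fun a => a, fun _ => rfl, fun _ => rfl, fun a => FamCell.singleIdAt x a⟩ :
      FamCell (FamHom.id _) (FamHom.id _)
        (FamPro.single κ (D.hid x)) (FamPro.hid (FamObj.single κ x)))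
  colaxComp_naturality α β := FamCell.sq_ext
    (FamHom.mk_eq fun _ => (Category.id_comp _).trans (Category.comp_id _).symm)
    (FamHom.mk_eq fun _ => (Category.id_comp _).trans (Category.comp_id _).symm)
    (fun _ => rfl) fun _ _ _ => heq_of_sq ((D.vid_vcomp _).trans (D.vcomp_vid _).symm)
  colaxId_naturality f := FamCell.sq_ext
    (FamHom.mk_eq fun _ => (Category.id_comp _).trans (Category.comp_id _).symm)
    (FamHom.mk_eq fun _ => (Category.id_comp _).trans (Category.comp_id _).symm)
    (fun _ => rfl) (by
      rintro _ _ ⟨_, rfl, rfl⟩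
      exact heq_of_sq ((D.vid_vcomp _).trans (D.vcomp_vid _).symm))
  associativity m n p := FamCell.sq_ext
    (FamHom.mk_eq fun _ => rfl) (FamHom.mk_eq fun _ => rfl)
    (fun _ => rfl) fun _ _ _ => heq_of_sq ((ColaxDblFunctor.id D).associativity m n p)
  left_unitality m := FamCell.sq_ext
    (FamHom.mk_eq fun _ => (Category.id_comp _).trans (Category.id_comp _))
    (FamHom.mk_eq fun _ => (Category.id_comp _).trans (Category.id_comp _))
    (fun _ => rfl) (by
      rintro _ _ ⟨_, rfl, rfl⟩
      exact heq_of_sq ((ColaxDblFunctor.id D).left_unitality m))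
  right_unitality m := FamCell.sq_ext
    (FamHom.mk_eq fun _ => (Category.id_comp _).trans (Category.id_comp _))
    (FamHom.mk_eq fun _ => (Category.id_comp _).trans (Category.id_comp _))
    (fun _ => rfl) (by
      rintro _ _ ⟨_, rfl, rfl⟩
      exact heq_of_sq ((ColaxDblFunctor.id D).right_unitality m))

/-- A double category has lax products, indexed by the sets in `κ`, when the diagonal
`D → Fam*(D)` has a lax right adjoint. -/
def HasLaxProducts : Prop :=
  ∃ P : LaxDblFunctor (opFamDbl κ D) D, Nonempty (LaxDblAdjunction (deltaOp κ D) P)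

/-- A double category has colax coproducts, indexed by the sets in `κ`, when the diagonal
`D → Fam(D)` has a colax left adjoint. -/
def HasColaxCoproducts : Prop :=
  ∃ C : ColaxDblFunctor (famDbl κ D) D, Nonempty (ColaxDblAdjunction C (delta κ D))

end Diagonal

/-! ### Products of spans as limits over categories of elements -/

section ElementsDiagram

variable {κ : IndexClass.{w}} {S : Type u} [Category.{v} S] [HasPullbacks S]

/-- A span of sets `I ⟵ apex ⟶ J`, viewed as a copresheaf on the walking span. -/
abbrev SetSpan.copresheaf {I J : Type w} (A : SetSpan I J) : WalkingSpan ⥤ Type w :=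
  span (TypeCat.ofHom A.l) (TypeCat.ofHom A.r)

variable {X Y : FamObj κ (spanDbl S)}

/-- The member `x (l a) ⟵ s a ⟶ y (r a)` of a family of spans at an element `a` of the apex of the
indexing span. -/
abbrev spanAt (M : FamPro X Y) (a : M.A.apex) :
    SpanIn (S := S) (X.x (M.A.l a)) (Y.x (M.A.r a)) :=
  M.m ⟨a, rfl, rfl⟩

/-- The objects of the diagram determined by a family of spans. -/
def elementsObj (M : FamPro X Y) : M.A.copresheaf.Elements → S
  | ⟨none, a⟩ => (spanAt M a).apex
  | ⟨some WalkingPair.left, i⟩ => X.x i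
  | ⟨some WalkingPair.right, j⟩ => Y.x j

/-- The arrows of the diagram determined by a family of spans. -/
def elementsMap (M : FamPro X Y) : ∀ {c d : WalkingSpan} (f : c ⟶ d) (a : M.A.copresheaf.obj c)
    (b : M.A.copresheaf.obj d), M.A.copresheaf.map f a = b →
    (elementsObj M ⟨c, a⟩ ⟶ elementsObj M ⟨d, b⟩)
  | c, _, WidePushoutShape.Hom.id _, a, b, h =>
      eqToHom (congrArg (fun t => elementsObj M ⟨c, t⟩)
        (show a = b from (M.A.copresheaf.map_id_apply _ a).symm.trans h))
  | _, _, WidePushoutShape.Hom.init WalkingPair.left, a, _, h =>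
      (spanAt M a).l ≫ eqToHom (congrArg X.x h)
  | _, _, WidePushoutShape.Hom.init WalkingPair.right, a, _, h =>
      (spanAt M a).r ≫ eqToHom (congrArg Y.x h)

/-- The diagram `∫ F ⥤ S`, on the category of elements of the indexing span `F` of a family of
spans, consisting of the objects `x i`, `y j` and `s a`, and the legs `x (l a) ⟵ s a ⟶ y (r a)`. -/
def elementsDiagram (M : FamPro X Y) : M.A.copresheaf.Elements ⥤ S where
  obj := elementsObj M
  map f := elementsMap M f.val _ _ f.property
  map_id p := rfl
  map_comp := by
    rintro ⟨c, a⟩ ⟨d, b⟩ ⟨e, t⟩ ⟨f, hf⟩ ⟨g, hg⟩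
    change WidePushoutShape.Hom c d at f
    cases f with
    | id =>
      obtain rfl : a = b := (M.A.copresheaf.map_id_apply _ a).symm.trans hf
      exact (Category.id_comp _).symm
    | init i =>
      change WidePushoutShape.Hom (some i) e at g
      cases g
      obtain rfl : b = t := (M.A.copresheaf.map_id_apply _ b).symm.trans hg
      exact (Category.comp_id _).symm

/-- A cell from the one-member family on a span `n` to a family of spans `M` determines a cone over
the diagram of `M` with apex the apex of `n`. -/
def elementsCone (M : FamPro X Y) {x y : S} (n : SpanIn x y)
    {F : OpFamHom (FamObj.single κ (D := spanDbl S) x) X}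
    {G : OpFamHom (FamObj.single κ (D := spanDbl S) y) Y}
    (γ : OpFamCell F G (FamPro.single κ (D := spanDbl S) n) M) : Cone (elementsDiagram M) where
  pt := n.apex
  π :=
    { app := fun p => match p with
        | ⟨none, a⟩ => SpanIn.Cell.hom (S := S) (γ.α ⟨a, rfl, rfl⟩)
        | ⟨some WalkingPair.left, i⟩ => n.l ≫ F.f i
        | ⟨some WalkingPair.right, j⟩ => n.r ≫ G.f j
      naturality := by
        rintro ⟨c, a⟩ ⟨d, b⟩ ⟨f, hf⟩
        refine (Category.id_comp _).trans ?_
        change WidePushoutShape.Hom c d at f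
        cases f with
        | id =>
          obtain rfl : a = b := (M.A.copresheaf.map_id_apply _ a).symm.trans hf
          exact (Category.comp_id _).symm
        | init i =>
          cases i with
          | left =>
            obtain rfl : M.A.l a = b := hf
            exact (SpanIn.Cell.hom_l (S := S) (γ.α ⟨a, rfl, rfl⟩)).symm.trans
              (congrArg _ (Category.comp_id _).symm)
          | right =>
            obtain rfl : M.A.r a = b := hf
            exact (SpanIn.Cell.hom_r (S := S) (γ.α ⟨a, rfl, rfl⟩)).symm.trans
              (congrArg _ (Category.comp_id _).symm) }

variable (κ S) in
/-- Lax products of spans are computed by limits: for every lax right adjoint `P` of the diagonal,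
the counit exhibits the product `P x` of a family of objects as a product in `S`, and the apex of
the product `P m` of a family of spans as the limit of its diagram over the category of elements
of the indexing span. -/
def LaxProductsAreLimits : Prop :=
  ∀ (P : LaxDblFunctor (opFamDbl κ (spanDbl S)) (spanDbl S))
    (adj : LaxDblAdjunction (deltaOp κ (spanDbl S)) P),
    (∀ X : FamObj κ (spanDbl S),
      Nonempty (IsLimit (Fan.mk (P.obj X : S) fun i : X.I =>
        (OpFamHom.f (D := spanDbl S) (adj.counit.app X) i : (P.obj X : S) ⟶ X.x i)))) ∧
    ∀ {X Y : FamObj κ (spanDbl S)} (M : FamPro X Y),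
      Nonempty (IsLimit (elementsCone M (P.pro M) (adj.counit.appPro M)))

end ElementsDiagram

/-! ### Lax right adjoints from universal arrows -/

namespace DblCat

variable {D : DblCat.{u₀, v₀, u₁, v₁}}

/-! An adjunction of double categories can be built from universal arrows alone. The comparison
cells of the diagonal `Δ` are invertible, since their constituents are identities. For a lax functor
`F` of this kind it is enough to give, for each object `Y`, a universal arrow from `F` to `Y` and,
for each proarrow `M`, a universal cell from `F` to `M` whose side arrows are the universal arrows
of the ends of `M`. Universal cells must represent cells with arbitrary side arrows, so that the
ordinary theory of universal arrows applies in the category of proarrows and cells. The right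
adjoint then acts by transposition. Its lax comparisons are the mates of the inverse comparisons of
`F`: the transpose of the inverse comparison of `F` followed by the external composite of counit
cells. Each coherence law is an equation between cells into a universal proarrow, hence may be
checked after applying `F` and composing with the counit cell, where it becomes a coherence law of
the inverse comparisons. This is `UniversalTo.adjunction`; `UniversalFrom.adjunction` is the dual
for colax left adjoints.

For spans, an arrow from a one-member family to a family is a tuple of arrows, because an index
function into a singleton carries no information. So universal objects are products in `S`. Likewise
a cell from a single span `n` to a family `(A, m)` consists of tuples of arrows on the feet and
arrows from the apex of `n` to each `s a`, compatible with the legs. It is represented by the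
pullback of `∏ x × ∏ y ⟶ ∏ₐ (x (l a) × y (r a)) ⟵ ∏ₐ s a`, which exists when `S` has pullbacks,
binary products and products indexed by the allowed sets. Cospans are dual.

For the description of an arbitrary lax right adjoint, its counit is universal on objects and on
proarrows (`LaxDblAdjunction.universalTo`), and only this is needed. Universality on objects is the
product property. For proarrows, an arrow `t ⟶ apex (Π m)` is the same as a cell from the identity
span on `t` to `Π m` with freely varying side arrows. By universality it is the same as a cell of
families from that identity span to `m`, and such a cell is exactly a cone with vertex `t` over the
diagram on the category of elements. -/

theorem hom_hcompCell_vcomp {x y z x' y' z' x'' y'' z'' : D.Obj} {f : x ⟶ x'} {g : y ⟶ y'}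
    {h : z ⟶ z'} {f' : x' ⟶ x''} {g' : y' ⟶ y''} {h' : z' ⟶ z''}
    {m : D.Pro x y} {n : D.Pro y z} {m' : D.Pro x' y'} {n' : D.Pro y' z'}
    {m'' : D.Pro x'' y''} {n'' : D.Pro y'' z''}
    (α : D.Cell f g m m') (β : D.Cell g h n n') (α' : D.Cell f' g' m' m'')
    (β' : D.Cell g' h' n' n'') :
    hom (D.hcompCell (D.vcomp α α') (D.vcomp β β')) =
      hom (D.hcompCell α β) ≫ hom (D.hcompCell α' β') := by
  rw [D.interchange]
  rfl

theorem hom_hidCell_comp {x y z : D.Obj} (f : x ⟶ y) (g : y ⟶ z) :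
    hom (D.hidCell (f ≫ g)) = hom (D.hidCell f) ≫ hom (D.hidCell g) := by
  rw [D.hidCell_comp]
  rfl

theorem hom_hcompCell_vid {x y z : D.Obj} (m : D.Pro x y) (n : D.Pro y z) :
    hom (D.hcompCell (D.vid m) (D.vid n)) = 𝟙 (Proarrow.mk (D.hcomp m n)) := by
  rw [D.hcompCell_vid]
  rfl

theorem hom_hidCell_id (x : D.Obj) : hom (D.hidCell (𝟙 x)) = 𝟙 (Proarrow.mk (D.hid x)) := by
  rw [D.hidCell_id]
  rfl

/-- The two identity cells have different side arrows and hence different types; as morphisms of the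
category of proarrows they can be compared. -/
theorem hom_hidCell_congr {x y : D.Obj} {f g : x ⟶ y} (h : f = g) :
    hom (D.hidCell f) = hom (D.hidCell g) := by
  subst h
  rfl

/-- The two composable pairs may have different middle arrows. Equality in the category of proarrows
includes equality of side arrows, so it is stable under external composition. -/
theorem hom_hcompCell_congr {x y z x' y' z' : D.Obj} {f₁ f₂ : x ⟶ x'} {g₁ g₂ : y ⟶ y'}
    {h₁ h₂ : z ⟶ z'} {m : D.Pro x y} {n : D.Pro y z} {m' : D.Pro x' y'} {n' : D.Pro y' z'}
    {α₁ : D.Cell f₁ g₁ m m'} {α₂ : D.Cell f₂ g₂ m m'}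
    {β₁ : D.Cell g₁ h₁ n n'} {β₂ : D.Cell g₂ h₂ n n'}
    (h : hom α₁ = hom α₂) (h' : hom β₁ = hom β₂) :
    hom (D.hcompCell α₁ β₁) = hom (D.hcompCell α₂ β₂) :=
  hcompCell_congr h h'

theorem hom_assoc_naturality {x y z t x' y' z' t' : D.Obj} {f : x ⟶ x'} {g : y ⟶ y'}
    {h : z ⟶ z'} {k : t ⟶ t'} {m : D.Pro x y} {n : D.Pro y z} {p : D.Pro z t}
    {m' : D.Pro x' y'} {n' : D.Pro y' z'} {p' : D.Pro z' t'}
    (α : D.Cell f g m m') (β : D.Cell g h n n') (γ : D.Cell h k p p') :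
    hom (D.hcompCell (D.hcompCell α β) γ) ≫ hom (D.assocHom m' n' p') =
      hom (D.assocHom m n p) ≫ hom (D.hcompCell α (D.hcompCell β γ)) :=
  D.assoc_naturality α β γ

theorem hom_lunit_naturality {x y x' y' : D.Obj} {f : x ⟶ x'} {g : y ⟶ y'} {m : D.Pro x y}
    {m' : D.Pro x' y'} (α : D.Cell f g m m') :
    hom (D.hcompCell (D.hidCell f) α) ≫ hom (D.lunitHom m') = hom (D.lunitHom m) ≫ hom α :=
  D.lunit_naturality α

theorem hom_runit_naturality {x y x' y' : D.Obj} {f : x ⟶ x'} {g : y ⟶ y'} {m : D.Pro x y}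
    {m' : D.Pro x' y'} (α : D.Cell f g m m') :
    hom (D.hcompCell α (D.hidCell g)) ≫ hom (D.runitHom m') = hom (D.runitHom m) ≫ hom α :=
  D.runit_naturality α

/-- External composition is functorial by interchange, so whiskering preserves one-sided inverses.
Keeping the two sides separate lets each half of invertibility be used where it is needed. -/
theorem hom_whiskerRight_inv {x y z : D.Obj} {m m' : D.Pro x y} (n : D.Pro y z)
    {α : D.Cell (𝟙 x) (𝟙 y) m m'} {β : D.Cell (𝟙 x) (𝟙 y) m' m} (h : hom α ≫ hom β = 𝟙 _) :
    hom (D.hcompCell α (D.vid n)) ≫ hom (D.hcompCell β (D.vid n)) = 𝟙 _ := by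
  rw [← hom_hcompCell_vcomp, ← hom_hcompCell_vid]
  exact hom_hcompCell_congr h (D.vid_vcomp _)

theorem hom_whiskerLeft_inv {x y z : D.Obj} (m : D.Pro x y) {n n' : D.Pro y z}
    {α : D.Cell (𝟙 y) (𝟙 z) n n'} {β : D.Cell (𝟙 y) (𝟙 z) n' n} (h : hom α ≫ hom β = 𝟙 _) :
    hom (D.hcompCell (D.vid m) α) ≫ hom (D.hcompCell (D.vid m) β) = 𝟙 _ := by
  rw [← hom_hcompCell_vcomp, ← hom_hcompCell_vid]
  exact hom_hcompCell_congr (D.vid_vcomp _) h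

end DblCat

namespace LaxDblFunctor

open DblCat

variable {D : DblCat.{u₀, v₀, u₁, v₁}} {E : DblCat.{u₂, v₂, u₃, v₃}}

/-- The action of a lax double functor on the category of proarrows and cells. -/
def mapHom (F : LaxDblFunctor D E) {P Q : Proarrow D} (φ : P ⟶ Q) :
    Proarrow.mk (F.pro P.pro) ⟶ Proarrow.mk (F.pro Q.pro) :=
  hom (F.cell φ.cell)

theorem mapHom_comp (F : LaxDblFunctor D E) {P Q R : Proarrow D} (φ : P ⟶ Q) (ψ : Q ⟶ R) :
    F.mapHom (φ ≫ ψ) = F.mapHom φ ≫ F.mapHom ψ :=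
  F.cell_vcomp φ.cell ψ.cell

theorem mapHom_id (F : LaxDblFunctor D E) (P : Proarrow D) :
    F.mapHom (𝟙 P) = 𝟙 (Proarrow.mk (F.pro P.pro)) :=
  F.cell_vid P.pro

/-- Inverses of the comparison cells of a lax double functor. -/
structure ComparisonInverse (F : LaxDblFunctor D E) where
  compInv : ∀ {x y z : D.Obj} (m : D.Pro x y) (n : D.Pro y z),
    E.Cell (𝟙 (F.obj x)) (𝟙 (F.obj z)) (F.pro (D.hcomp m n)) (E.hcomp (F.pro m) (F.pro n))
  idInv : ∀ x : D.Obj, E.Cell (𝟙 (F.obj x)) (𝟙 (F.obj x)) (F.pro (D.hid x)) (E.hid (F.obj x))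
  comp_hom_inv : ∀ {x y z : D.Obj} (m : D.Pro x y) (n : D.Pro y z),
    hom (F.laxComp m n) ≫ hom (compInv m n) = 𝟙 _
  comp_inv_hom : ∀ {x y z : D.Obj} (m : D.Pro x y) (n : D.Pro y z),
    hom (compInv m n) ≫ hom (F.laxComp m n) = 𝟙 _
  id_hom_inv : ∀ x : D.Obj, hom (F.laxId x) ≫ hom (idInv x) = 𝟙 _
  id_inv_hom : ∀ x : D.Obj, hom (idInv x) ≫ hom (F.laxId x) = 𝟙 _

/-! ### Coherence laws of the inverses of lax comparisons -/

namespace ComparisonInverse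

variable {F : LaxDblFunctor D E} (Φ : F.ComparisonInverse)

/-- Conjugate the naturality square of the lax comparison by the inverses on its two ends. -/
theorem compInv_naturality {x y z x' y' z' : D.Obj} {f : x ⟶ x'} {g : y ⟶ y'} {h : z ⟶ z'}
    {m : D.Pro x y} {n : D.Pro y z} {m' : D.Pro x' y'} {n' : D.Pro y' z'}
    (α : D.Cell f g m m') (β : D.Cell g h n n') :
    F.mapHom (hom (D.hcompCell α β)) ≫ hom (Φ.compInv m' n') =
      hom (Φ.compInv m n) ≫ hom (E.hcompCell (F.cell α) (F.cell β)) := by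
  have h : hom (E.hcompCell (F.cell α) (F.cell β)) ≫ hom (F.laxComp m' n') =
    hom (F.laxComp m n) ≫ F.mapHom (hom (D.hcompCell α β)) := F.laxComp_naturality α β
  rw [← Category.comp_id (hom (E.hcompCell _ _)), ← Φ.comp_hom_inv,
    reassoc_of% h, reassoc_of% (Φ.comp_inv_hom m n)]

theorem compInv_naturality_assoc {x y z x' y' z' : D.Obj} {f : x ⟶ x'} {g : y ⟶ y'} {h : z ⟶ z'}
    {m : D.Pro x y} {n : D.Pro y z} {m' : D.Pro x' y'} {n' : D.Pro y' z'}
    (α : D.Cell f g m m') (β : D.Cell g h n n') {Q : Proarrow E}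
    (φ : Proarrow.mk (E.hcomp (F.pro m') (F.pro n')) ⟶ Q) :
    F.mapHom (hom (D.hcompCell α β)) ≫ hom (Φ.compInv m' n') ≫ φ =
      hom (Φ.compInv m n) ≫ hom (E.hcompCell (F.cell α) (F.cell β)) ≫ φ :=
  (reassoc_of% (Φ.compInv_naturality α β)) φ

theorem idInv_naturality {x y : D.Obj} (f : x ⟶ y) :
    F.mapHom (hom (D.hidCell f)) ≫ hom (Φ.idInv y) =
      hom (Φ.idInv x) ≫ hom (E.hidCell (F.map f)) := by
  have h : hom (E.hidCell (F.map f)) ≫ hom (F.laxId y) =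
    hom (F.laxId x) ≫ F.mapHom (hom (D.hidCell f)) := F.laxId_naturality f
  rw [← Category.comp_id (hom (E.hidCell _)), ← Φ.id_hom_inv, reassoc_of% h,
    reassoc_of% (Φ.id_inv_hom x)]

/-- Inverting every comparison in the lax associativity law turns it into the colax one. This is the
form in which coherence of the left adjoint enters the associativity law of its right adjoint. -/
theorem compInv_assoc {x y z t : D.Obj} (m : D.Pro x y) (n : D.Pro y z) (p : D.Pro z t) :
    hom (Φ.compInv (D.hcomp m n) p) ≫ hom (E.hcompCell (Φ.compInv m n) (E.vid (F.pro p))) ≫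
        hom (E.assocHom (F.pro m) (F.pro n) (F.pro p)) =
      F.mapHom (hom (D.assocHom m n p)) ≫ hom (Φ.compInv m (D.hcomp n p)) ≫
        hom (E.hcompCell (E.vid (F.pro m)) (Φ.compInv n p)) := by
  have h : hom (E.hcompCell (F.laxComp m n) (E.vid (F.pro p))) ≫
      hom (F.laxComp (D.hcomp m n) p) ≫ F.mapHom (hom (D.assocHom m n p)) =
      hom (E.assocHom (F.pro m) (F.pro n) (F.pro p)) ≫
        hom (E.hcompCell (E.vid (F.pro m)) (F.laxComp n p)) ≫
          hom (F.laxComp m (D.hcomp n p)) := F.associativity m n p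
  -- Two identities are inserted after the associator, each written as a comparison followed by its
  -- inverse. The lax associativity law then applies to the two comparisons, and the remaining pairs
  -- cancel.
  rw [← Category.comp_id (hom (E.assocHom _ _ _)),
    ← hom_whiskerLeft_inv (F.pro m) (Φ.comp_hom_inv n p), ← Category.id_comp (hom (E.hcompCell
    (E.vid (F.pro m)) (Φ.compInv n p))), ← Φ.comp_hom_inv]
  simp only [Category.assoc]
  rw [← reassoc_of% h, reassoc_of% (hom_whiskerRight_inv (F.pro p) (Φ.comp_inv_hom m n)),
    reassoc_of% (Φ.comp_inv_hom (D.hcomp m n) p), reassoc_of% (Φ.comp_hom_inv m (D.hcomp n p))]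

theorem compInv_lunit {x y : D.Obj} (m : D.Pro x y) :
    hom (Φ.compInv (D.hid x) m) ≫ hom (E.hcompCell (Φ.idInv x) (E.vid (F.pro m))) ≫
      hom (E.lunitHom (F.pro m)) = F.mapHom (hom (D.lunitHom m)) := by
  have h : hom (E.hcompCell (F.laxId x) (E.vid (F.pro m))) ≫ hom (F.laxComp (D.hid x) m) ≫
    F.mapHom (hom (D.lunitHom m)) = hom (E.lunitHom (F.pro m)) := F.left_unitality m
  rw [← h, reassoc_of% (hom_whiskerRight_inv (F.pro m) (Φ.id_inv_hom x)),
    reassoc_of% (Φ.comp_inv_hom (D.hid x) m)]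

theorem compInv_runit {x y : D.Obj} (m : D.Pro x y) :
    hom (Φ.compInv m (D.hid y)) ≫ hom (E.hcompCell (E.vid (F.pro m)) (Φ.idInv y)) ≫
      hom (E.runitHom (F.pro m)) = F.mapHom (hom (D.runitHom m)) := by
  have h : hom (E.hcompCell (E.vid (F.pro m)) (F.laxId y)) ≫ hom (F.laxComp m (D.hid y)) ≫
    F.mapHom (hom (D.runitHom m)) = hom (E.runitHom (F.pro m)) := F.right_unitality m
  rw [← h, reassoc_of% (hom_whiskerLeft_inv (F.pro m) (Φ.id_inv_hom y)),
    reassoc_of% (Φ.comp_inv_hom m (D.hid y))]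

end ComparisonInverse

/-- Universal arrows from a lax double functor to each object, and universal cells to each
proarrow lying over them. -/
structure UniversalTo (F : LaxDblFunctor D E) where
  obj : E.Obj → D.Obj
  counit : ∀ Y : E.Obj, F.obj (obj Y) ⟶ Y
  lift : ∀ {x : D.Obj} {Y : E.Obj}, (F.obj x ⟶ Y) → (x ⟶ obj Y)
  fac : ∀ {x : D.Obj} {Y : E.Obj} (f : F.obj x ⟶ Y), F.map (lift f) ≫ counit Y = f
  arrow_ext : ∀ {x : D.Obj} {Y : E.Obj} {a b : x ⟶ obj Y},
    F.map a ≫ counit Y = F.map b ≫ counit Y → a = b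
  pro : ∀ {X Y : E.Obj}, E.Pro X Y → D.Pro (obj X) (obj Y)
  counitPro : ∀ {X Y : E.Obj} (M : E.Pro X Y), E.Cell (counit X) (counit Y) (F.pro (pro M)) M
  liftCell : ∀ {x y : D.Obj} {X Y : E.Obj} {f : F.obj x ⟶ X} {g : F.obj y ⟶ Y} {m : D.Pro x y}
    {M : E.Pro X Y}, E.Cell f g (F.pro m) M → D.Cell (lift f) (lift g) m (pro M)
  fac_cell : ∀ {x y : D.Obj} {X Y : E.Obj} {f : F.obj x ⟶ X} {g : F.obj y ⟶ Y} {m : D.Pro x y}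
    {M : E.Pro X Y} (α : E.Cell f g (F.pro m) M),
    F.mapHom (hom (liftCell α)) ≫ hom (counitPro M) = hom α
  cell_ext : ∀ {P : Proarrow D} {X Y : E.Obj} {M : E.Pro X Y} {a b : P ⟶ Proarrow.mk (pro M)},
    F.mapHom a ≫ hom (counitPro M) = F.mapHom b ≫ hom (counitPro M) → a = b

/-! ### The right adjoint determined by universal arrows and cells -/

namespace UniversalTo

variable {F : LaxDblFunctor D E} (U : F.UniversalTo) (Φ : F.ComparisonInverse)

/-- Transposing a globular cell composed with counit cells gives side arrows of this form. The
equation allows the result to be recast as a globular cell, as a lax comparison must be. -/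
theorem lift_id_comp_counit (X : E.Obj) : U.lift (𝟙 _ ≫ U.counit X) = 𝟙 (U.obj X) :=
  U.arrow_ext (by rw [U.fac, F.map_id])

/-- composition comparison of the right adjoint -/
def laxComp {X Y Z : E.Obj} (M : E.Pro X Y) (N : E.Pro Y Z) :
    D.Cell (𝟙 (U.obj X)) (𝟙 (U.obj Z)) (D.hcomp (U.pro M) (U.pro N)) (U.pro (E.hcomp M N)) :=
  recast (U.lift_id_comp_counit X) (U.lift_id_comp_counit Z)
    (U.liftCell (E.vcomp (Φ.compInv (U.pro M) (U.pro N))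
      (E.hcompCell (U.counitPro M) (U.counitPro N))))

/-- identity comparison of the right adjoint -/
def laxId (X : E.Obj) : D.Cell (𝟙 (U.obj X)) (𝟙 (U.obj X)) (D.hid (U.obj X)) (U.pro (E.hid X)) :=
  recast (U.lift_id_comp_counit X) (U.lift_id_comp_counit X)
    (U.liftCell (E.vcomp (Φ.idInv (U.obj X)) (E.hidCell (U.counit X))))

/-- This equation characterises the comparison as a mate. It is all that the coherence proofs use
about the definition. -/
theorem laxComp_counit {X Y Z : E.Obj} (M : E.Pro X Y) (N : E.Pro Y Z) :
    F.mapHom (hom (U.laxComp Φ M N)) ≫ hom (U.counitPro (E.hcomp M N)) =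
      hom (Φ.compInv (U.pro M) (U.pro N)) ≫
        hom (E.hcompCell (U.counitPro M) (U.counitPro N)) := by
  rw [laxComp, hom_recast, ← hom_vcomp]
  exact U.fac_cell _

theorem laxId_counit (X : E.Obj) :
    F.mapHom (hom (U.laxId Φ X)) ≫ hom (U.counitPro (E.hid X)) =
      hom (Φ.idInv (U.obj X)) ≫ hom (E.hidCell (U.counit X)) := by
  rw [laxId, hom_recast, ← hom_vcomp]
  exact U.fac_cell _

/-- action of the right adjoint on arrows -/
def map {X Y : E.Obj} (f : X ⟶ Y) : U.obj X ⟶ U.obj Y :=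
  U.lift (U.counit X ≫ f)

/-- action of the right adjoint on cells -/
def cell {X Y W Z : E.Obj} {f : X ⟶ W} {g : Y ⟶ Z} {M : E.Pro X Y} {N : E.Pro W Z}
    (α : E.Cell f g M N) : D.Cell (U.map f) (U.map g) (U.pro M) (U.pro N) :=
  U.liftCell (E.vcomp (U.counitPro M) α)

theorem map_counit {X Y : E.Obj} (f : X ⟶ Y) :
    F.map (U.map f) ≫ U.counit Y = U.counit X ≫ f :=
  U.fac _

theorem cell_counit {X Y W Z : E.Obj} {f : X ⟶ W} {g : Y ⟶ Z} {M : E.Pro X Y} {N : E.Pro W Z}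
    (α : E.Cell f g M N) :
    F.mapHom (hom (U.cell α)) ≫ hom (U.counitPro N) = hom (U.counitPro M) ≫ hom α :=
  (U.fac_cell _).trans (hom_vcomp _ _)

/-- By interchange, transposing two cells separately and composing externally agrees with
transposing jointly. The transposes `α'` and `β'` are explicit cells sharing a middle arrow, so that
their external composite makes sense. -/
theorem hcompCell_counit {x y z : D.Obj} {X Y Z : E.Obj} {f : x ⟶ U.obj X} {g : y ⟶ U.obj Y}
    {h : z ⟶ U.obj Z} {f' : F.obj x ⟶ X} {g' : F.obj y ⟶ Y} {h' : F.obj z ⟶ Z}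
    {m : D.Pro x y} {n : D.Pro y z} {M : E.Pro X Y} {N : E.Pro Y Z}
    {α : D.Cell f g m (U.pro M)} {β : D.Cell g h n (U.pro N)}
    {α' : E.Cell f' g' (F.pro m) M} {β' : E.Cell g' h' (F.pro n) N}
    (hα : F.mapHom (hom α) ≫ hom (U.counitPro M) = hom α')
    (hβ : F.mapHom (hom β) ≫ hom (U.counitPro N) = hom β') :
    hom (E.hcompCell (F.cell α) (F.cell β)) ≫ hom (E.hcompCell (U.counitPro M) (U.counitPro N)) =
      hom (E.hcompCell α' β') := by
  rw [← hom_hcompCell_vcomp]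
  exact hom_hcompCell_congr hα hβ

/-- The identity cell is kept as a factor on the right so that the side arrows are `𝟙 ≫ counit`.
They then match those of the transposed comparisons, with which this cell is composed externally. -/
theorem vid_counit {X Y : E.Obj} (M : E.Pro X Y) :
    F.mapHom (hom (D.vid (U.pro M))) ≫ hom (U.counitPro M) =
      hom (E.vcomp (E.vid _) (U.counitPro M)) := by
  rw [hom_vid, hom_vcomp, hom_vid, F.mapHom_id]

/-- The lax double functor determined by universal arrows and cells. -/
def toLaxDblFunctor : LaxDblFunctor E D where
  obj := U.obj
  map := U.map
  pro := U.pro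
  cell := U.cell
  -- From here on, each law is checked by applying `F` and composing with the counit, which turns
  -- every constituent of the right adjoint into its transpose.
  map_id X := U.arrow_ext (by rw [map_counit, F.map_id, Category.comp_id, Category.id_comp])
  map_comp f g := U.arrow_ext (by
    rw [map_counit, F.map_comp, Category.assoc, map_counit, reassoc_of% (U.map_counit f)])
  cell_vid M := U.cell_ext (a := hom (U.cell (E.vid M))) (b := hom (D.vid (U.pro M))) (by
    rw [cell_counit, vid_counit, hom_vcomp, hom_vid, hom_vid, Category.comp_id, Category.id_comp])
  cell_vcomp α β := U.cell_ext (a := hom (U.cell (E.vcomp α β)))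
    (b := hom (D.vcomp (U.cell α) (U.cell β))) (by
    rw [cell_counit, hom_vcomp, hom_vcomp, F.mapHom_comp, Category.assoc, cell_counit,
      reassoc_of% (U.cell_counit α)])
  laxComp := U.laxComp Φ
  laxId := U.laxId Φ
  laxComp_naturality {_ _ _ _ _ _ _ _ _ M N M' N'} α β := U.cell_ext
    (a := hom (D.hcompCell (U.cell α) (U.cell β)) ≫ hom (U.laxComp Φ M' N'))
    (b := hom (U.laxComp Φ M N) ≫ hom (U.cell (E.hcompCell α β))) (by
    rw [F.mapHom_comp, F.mapHom_comp, Category.assoc, Category.assoc, cell_counit,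
      reassoc_of% (U.laxComp_counit Φ M N), laxComp_counit,
      reassoc_of% (Φ.compInv_naturality (U.cell α) (U.cell β)),
      U.hcompCell_counit (α' := E.vcomp (U.counitPro M) α) (β' := E.vcomp (U.counitPro N) β)
        (U.cell_counit α) (U.cell_counit β), hom_hcompCell_vcomp])
  laxId_naturality {X Y} f := U.cell_ext
    (a := hom (D.hidCell (U.map f)) ≫ hom (U.laxId Φ Y))
    (b := hom (U.laxId Φ X) ≫ hom (U.cell (E.hidCell f))) (by
    rw [F.mapHom_comp, F.mapHom_comp, Category.assoc, Category.assoc, cell_counit,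
      reassoc_of% (U.laxId_counit Φ X), laxId_counit, reassoc_of% (Φ.idInv_naturality (U.map f)),
      ← hom_hidCell_comp, ← hom_hidCell_comp, hom_hidCell_congr (U.map_counit f)])
  -- On both sides the counit is moved towards the front. What remains is inverse comparisons of
  -- `F`, counit cells and one associator; naturality of the associator and `compInv_assoc` identify
  -- the two sides.
  associativity M N P := U.cell_ext
    (a := hom (D.hcompCell (U.laxComp Φ M N) (D.vid (U.pro P))) ≫
      hom (U.laxComp Φ (E.hcomp M N) P) ≫ hom (U.cell (E.assocHom M N P)))
    (b := hom (D.assocHom (U.pro M) (U.pro N) (U.pro P)) ≫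
      hom (D.hcompCell (D.vid (U.pro M)) (U.laxComp Φ N P)) ≫
        hom (U.laxComp Φ M (E.hcomp N P))) (by
    have h := Φ.compInv_assoc (U.pro M) (U.pro N) (U.pro P)
    simp only [F.mapHom_comp, Category.assoc]
    rw [cell_counit, reassoc_of% (U.laxComp_counit Φ (E.hcomp M N) P), laxComp_counit,
      reassoc_of% (Φ.compInv_naturality (U.laxComp Φ M N) (D.vid (U.pro P))),
      Φ.compInv_naturality_assoc,
      reassoc_of% (U.hcompCell_counit (α' := E.vcomp (Φ.compInv (U.pro M) (U.pro N))
        (E.hcompCell (U.counitPro M) (U.counitPro N))) (β' := E.vcomp (E.vid _) (U.counitPro P))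
        (U.laxComp_counit Φ M N) (U.vid_counit P)),
      U.hcompCell_counit (β' := E.vcomp (Φ.compInv (U.pro N) (U.pro P))
        (E.hcompCell (U.counitPro N) (U.counitPro P))) (α' := E.vcomp (E.vid _) (U.counitPro M))
        (U.vid_counit M) (U.laxComp_counit Φ N P), hom_hcompCell_vcomp, hom_hcompCell_vcomp,
      Category.assoc, hom_assoc_naturality, reassoc_of% h])
  left_unitality {X Y} M := U.cell_ext
    (a := hom (D.hcompCell (U.laxId Φ X) (D.vid (U.pro M))) ≫
      hom (U.laxComp Φ (E.hid X) M) ≫ hom (U.cell (E.lunitHom M)))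
    (b := hom (D.lunitHom (U.pro M))) (by
    -- Here the counit cells are carried past the left unitor by its naturality, after which the
    -- inverse form of the left unit law of `F` closes the equation.
    have h := Φ.compInv_lunit (U.pro M)
    simp only [F.mapHom_comp, Category.assoc]
    rw [cell_counit, reassoc_of% (U.laxComp_counit Φ (E.hid X) M),
      reassoc_of% (Φ.compInv_naturality (U.laxId Φ X) (D.vid (U.pro M))),
      reassoc_of% (U.hcompCell_counit (α' := E.vcomp (Φ.idInv (U.obj X))
        (E.hidCell (U.counit X))) (β' := E.vcomp (E.vid _) (U.counitPro M))
        (U.laxId_counit Φ X) (U.vid_counit M)), hom_hcompCell_vcomp,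
      Category.assoc, hom_lunit_naturality, reassoc_of% h])
  right_unitality {X Y} M := U.cell_ext
    (a := hom (D.hcompCell (D.vid (U.pro M)) (U.laxId Φ Y)) ≫
      hom (U.laxComp Φ M (E.hid Y)) ≫ hom (U.cell (E.runitHom M)))
    (b := hom (D.runitHom (U.pro M))) (by
    have h := Φ.compInv_runit (U.pro M)
    simp only [F.mapHom_comp, Category.assoc]
    rw [cell_counit, reassoc_of% (U.laxComp_counit Φ M (E.hid Y)),
      reassoc_of% (Φ.compInv_naturality (D.vid (U.pro M)) (U.laxId Φ Y)),
      reassoc_of% (U.hcompCell_counit (β' := E.vcomp (Φ.idInv (U.obj Y))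
        (E.hidCell (U.counit Y))) (α' := E.vcomp (E.vid _) (U.counitPro M))
        (U.vid_counit M) (U.laxId_counit Φ Y)), hom_hcompCell_vcomp,
      Category.assoc, hom_runit_naturality, reassoc_of% h])

/-- unit of the adjunction determined by universal arrows and cells -/
def unit : LaxDblTrans (LaxDblFunctor.id D) (F.comp (U.toLaxDblFunctor Φ)) where
  app x := U.lift (𝟙 (F.obj x))
  appPro m := U.liftCell (E.vid (F.pro m))
  naturality {x y} f := U.arrow_ext (a := f ≫ U.lift (𝟙 _)) (b := U.lift (𝟙 _) ≫ U.map (F.map f))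
    (by rw [F.map_comp, F.map_comp, Category.assoc, Category.assoc, U.fac, map_counit,
      reassoc_of% (U.fac (𝟙 (F.obj x))), Category.comp_id])
  naturality_cell {_ _ _ _ _ _ m n} α := U.cell_ext
    (a := hom α ≫ hom (U.liftCell (E.vid (F.pro n))))
    (b := hom (U.liftCell (E.vid (F.pro m))) ≫ hom (U.cell (F.cell α))) (by
    rw [F.mapHom_comp, F.mapHom_comp, Category.assoc, Category.assoc, U.fac_cell, cell_counit,
      reassoc_of% (U.fac_cell (E.vid (F.pro m))), hom_vid, hom_vid, Category.comp_id,
      Category.id_comp]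
    rfl)
  -- After transposition the units cancel against the counits, and what is left is that an inverse
  -- comparison followed by the comparison is the identity. The final `hom_recast` accounts for the
  -- recast in the comparison of a composite lax functor.
  laxComp_app {x y z} m n := (U.cell_ext
    (a := hom (D.vid (D.hcomp m n)) ≫ hom (U.liftCell (E.vid (F.pro (D.hcomp m n)))))
    (b := hom (D.hcompCell (U.liftCell (E.vid (F.pro m))) (U.liftCell (E.vid (F.pro n)))) ≫
      hom (U.laxComp Φ (F.pro m) (F.pro n)) ≫ hom (U.cell (F.laxComp m n))) (by
    simp only [F.mapHom_comp, Category.assoc]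
    rw [hom_vid, F.mapHom_id, Category.id_comp, U.fac_cell, cell_counit,
      reassoc_of% (U.laxComp_counit Φ (F.pro m) (F.pro n)), Φ.compInv_naturality_assoc,
      reassoc_of% (U.hcompCell_counit (U.fac_cell (E.vid (F.pro m)))
        (U.fac_cell (E.vid (F.pro n)))), hom_hcompCell_vid, hom_vid, Category.id_comp,
      Φ.comp_inv_hom])).trans (congrArg (hom (D.hcompCell _ _) ≫ ·) (hom_recast _ _ _).symm)
  laxId_app x := (U.cell_ext
    (a := hom (D.vid (D.hid x)) ≫ hom (U.liftCell (E.vid (F.pro (D.hid x)))))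
    (b := hom (D.hidCell (U.lift (𝟙 (F.obj x)))) ≫
      hom (U.laxId Φ (F.obj x)) ≫ hom (U.cell (F.laxId x))) (by
    simp only [F.mapHom_comp, Category.assoc]
    rw [hom_vid, F.mapHom_id, Category.id_comp, U.fac_cell, cell_counit,
      reassoc_of% (U.laxId_counit Φ (F.obj x)), reassoc_of% (Φ.idInv_naturality (U.lift (𝟙 (F.obj x)))),
      ← reassoc_of% (hom_hidCell_comp (F.map (U.lift (𝟙 (F.obj x)))) (U.counit _)),
      hom_hidCell_congr (U.fac _), hom_hidCell_id, hom_vid, Category.id_comp,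
      Φ.id_inv_hom])).trans (congrArg (hom (D.hidCell _) ≫ ·) (hom_recast _ _ _).symm)

/-- counit of the adjunction determined by universal arrows and cells -/
def counitTrans : LaxDblTrans ((U.toLaxDblFunctor Φ).comp F) (LaxDblFunctor.id E) where
  app := U.counit
  appPro := U.counitPro
  naturality := U.map_counit
  naturality_cell α := U.cell_counit α
  -- Compatibility of the counit uses the other half of invertibility: the comparison of `F`
  -- followed by its inverse is the identity.
  laxComp_app {X Y Z} M N := by
    refine (congrArg (· ≫ hom (U.counitPro (E.hcomp M N))) (hom_recast _ _ _)).trans ?_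
    change (hom (F.laxComp (U.pro M) (U.pro N)) ≫ F.mapHom (hom (U.laxComp Φ M N))) ≫ _ =
      hom (E.hcompCell (U.counitPro M) (U.counitPro N)) ≫ 𝟙 (Proarrow.mk (E.hcomp M N))
    rw [Category.assoc, laxComp_counit, reassoc_of% (Φ.comp_hom_inv (U.pro M) (U.pro N)),
      Category.comp_id]
  laxId_app X := by
    refine (congrArg (· ≫ hom (U.counitPro (E.hid X))) (hom_recast _ _ _)).trans ?_
    change (hom (F.laxId (U.obj X)) ≫ F.mapHom (hom (U.laxId Φ X))) ≫ _ =
      hom (E.hidCell (U.counit X)) ≫ 𝟙 (Proarrow.mk (E.hid X))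
    rw [Category.assoc, laxId_counit, reassoc_of% (Φ.id_hom_inv (U.obj X)), Category.comp_id]

/-- A lax double functor with invertible comparisons is left adjoint to the lax double functor
determined by universal arrows and cells. -/
def adjunction : LaxDblAdjunction F (U.toLaxDblFunctor Φ) where
  unit := U.unit Φ
  counit := U.counitTrans Φ
  left_triangle x := U.fac _
  left_triangle_pro m := U.fac_cell _
  -- The left triangle is the factorisation property itself; the right triangle follows from
  -- uniqueness of factorisations.
  right_triangle X := U.arrow_ext (a := U.lift (𝟙 _) ≫ U.map (U.counit X))
    (b := 𝟙 (U.obj X)) (by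
    rw [F.map_comp, Category.assoc, map_counit, reassoc_of% (U.fac (𝟙 (F.obj (U.obj X)))),
      F.map_id, Category.id_comp])
  right_triangle_pro M := U.cell_ext
    (a := hom (U.liftCell (E.vid (F.pro (U.pro M)))) ≫ hom (U.cell (U.counitPro M)))
    (b := hom (D.vid (U.pro M))) (by
    rw [F.mapHom_comp, Category.assoc, cell_counit,
      reassoc_of% (U.fac_cell (E.vid (F.pro (U.pro M)))), vid_counit, hom_vcomp])

end UniversalTo
end LaxDblFunctor

/-! ### Colax left adjoints from universal arrows -/

namespace ColaxDblFunctor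

open DblCat

variable {D : DblCat.{u₀, v₀, u₁, v₁}} {E : DblCat.{u₂, v₂, u₃, v₃}}

/-- The action of a colax double functor on the category of proarrows and cells. -/
def mapHom (F : ColaxDblFunctor D E) {P Q : Proarrow D} (φ : P ⟶ Q) :
    Proarrow.mk (F.pro P.pro) ⟶ Proarrow.mk (F.pro Q.pro) :=
  hom (F.cell φ.cell)

theorem mapHom_comp (F : ColaxDblFunctor D E) {P Q R : Proarrow D} (φ : P ⟶ Q) (ψ : Q ⟶ R) :
    F.mapHom (φ ≫ ψ) = F.mapHom φ ≫ F.mapHom ψ :=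
  F.cell_vcomp φ.cell ψ.cell

theorem mapHom_id (F : ColaxDblFunctor D E) (P : Proarrow D) :
    F.mapHom (𝟙 P) = 𝟙 (Proarrow.mk (F.pro P.pro)) :=
  F.cell_vid P.pro

/-- Inverses of the comparison cells of a colax double functor. -/
structure ComparisonInverse (F : ColaxDblFunctor D E) where
  compInv : ∀ {x y z : D.Obj} (m : D.Pro x y) (n : D.Pro y z),
    E.Cell (𝟙 (F.obj x)) (𝟙 (F.obj z)) (E.hcomp (F.pro m) (F.pro n)) (F.pro (D.hcomp m n))
  idInv : ∀ x : D.Obj, E.Cell (𝟙 (F.obj x)) (𝟙 (F.obj x)) (E.hid (F.obj x)) (F.pro (D.hid x))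
  comp_hom_inv : ∀ {x y z : D.Obj} (m : D.Pro x y) (n : D.Pro y z),
    hom (F.colaxComp m n) ≫ hom (compInv m n) = 𝟙 _
  comp_inv_hom : ∀ {x y z : D.Obj} (m : D.Pro x y) (n : D.Pro y z),
    hom (compInv m n) ≫ hom (F.colaxComp m n) = 𝟙 _
  id_hom_inv : ∀ x : D.Obj, hom (F.colaxId x) ≫ hom (idInv x) = 𝟙 _
  id_inv_hom : ∀ x : D.Obj, hom (idInv x) ≫ hom (F.colaxId x) = 𝟙 _

/-! ### Coherence laws of the inverses of colax comparisons -/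

namespace ComparisonInverse

variable {F : ColaxDblFunctor D E} (Φ : F.ComparisonInverse)

/-- Prefixing the identity as an inverse comparison followed by the comparison makes the colax
naturality square applicable, and the last pair cancels. -/
theorem compInv_naturality {x y z x' y' z' : D.Obj} {f : x ⟶ x'} {g : y ⟶ y'} {h : z ⟶ z'}
    {m : D.Pro x y} {n : D.Pro y z} {m' : D.Pro x' y'} {n' : D.Pro y' z'}
    (α : D.Cell f g m m') (β : D.Cell g h n n') :
    hom (Φ.compInv m n) ≫ F.mapHom (hom (D.hcompCell α β)) =
      hom (E.hcompCell (F.cell α) (F.cell β)) ≫ hom (Φ.compInv m' n') := by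
  have h : hom (F.colaxComp m n) ≫ hom (E.hcompCell (F.cell α) (F.cell β)) =
    F.mapHom (hom (D.hcompCell α β)) ≫ hom (F.colaxComp m' n') := F.colaxComp_naturality α β
  rw [← Category.id_comp (hom (E.hcompCell _ _)), ← Φ.comp_inv_hom]
  simp only [Category.assoc]
  rw [reassoc_of% h, Φ.comp_hom_inv, Category.comp_id]

theorem idInv_naturality {x y : D.Obj} (f : x ⟶ y) :
    hom (Φ.idInv x) ≫ F.mapHom (hom (D.hidCell f)) =
      hom (E.hidCell (F.map f)) ≫ hom (Φ.idInv y) := by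
  have h : hom (F.colaxId x) ≫ hom (E.hidCell (F.map f)) =
    F.mapHom (hom (D.hidCell f)) ≫ hom (F.colaxId y) := F.colaxId_naturality f
  rw [← Category.id_comp (hom (E.hidCell _)), ← Φ.id_inv_hom]
  simp only [Category.assoc]
  rw [reassoc_of% h, Φ.id_hom_inv, Category.comp_id]

/-- The inverses satisfy the lax associativity law, which is what the universal cells transport to
the left adjoint. -/
theorem compInv_assoc {x y z t : D.Obj} (m : D.Pro x y) (n : D.Pro y z) (p : D.Pro z t) :
    hom (E.hcompCell (Φ.compInv m n) (E.vid (F.pro p))) ≫ hom (Φ.compInv (D.hcomp m n) p) ≫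
        F.mapHom (hom (D.assocHom m n p)) =
      hom (E.assocHom (F.pro m) (F.pro n) (F.pro p)) ≫
        hom (E.hcompCell (E.vid (F.pro m)) (Φ.compInv n p)) ≫
          hom (Φ.compInv m (D.hcomp n p)) := by
  have h : hom (F.colaxComp (D.hcomp m n) p) ≫
      hom (E.hcompCell (F.colaxComp m n) (E.vid (F.pro p))) ≫
        hom (E.assocHom (F.pro m) (F.pro n) (F.pro p)) =
      F.mapHom (hom (D.assocHom m n p)) ≫ hom (F.colaxComp m (D.hcomp n p)) ≫
        hom (E.hcompCell (E.vid (F.pro m)) (F.colaxComp n p)) := F.associativity m n p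
  -- The identities inserted after the image of the associator complete it to one side of the colax
  -- associativity law. Replacing that side by the other leaves only cancelling pairs before the
  -- associator of `E`.
  rw [← Category.comp_id (F.mapHom _), ← Φ.comp_hom_inv m (D.hcomp n p),
    ← Category.id_comp (hom (Φ.compInv m (D.hcomp n p))),
    ← hom_whiskerLeft_inv (F.pro m) (Φ.comp_hom_inv n p)]
  simp only [Category.assoc]
  rw [← reassoc_of% h, reassoc_of% (Φ.comp_inv_hom (D.hcomp m n) p),
    reassoc_of% (hom_whiskerRight_inv (F.pro p) (Φ.comp_inv_hom m n)),
    reassoc_of% (hom_whiskerLeft_inv (F.pro m) (Φ.comp_inv_hom n p))]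

theorem compInv_lunit {x y : D.Obj} (m : D.Pro x y) :
    hom (E.hcompCell (Φ.idInv x) (E.vid (F.pro m))) ≫ hom (Φ.compInv (D.hid x) m) ≫
      F.mapHom (hom (D.lunitHom m)) = hom (E.lunitHom (F.pro m)) := by
  have h : hom (F.colaxComp (D.hid x) m) ≫ hom (E.hcompCell (F.colaxId x) (E.vid (F.pro m))) ≫
    hom (E.lunitHom (F.pro m)) = F.mapHom (hom (D.lunitHom m)) := F.left_unitality m
  rw [← h, reassoc_of% (Φ.comp_inv_hom (D.hid x) m),
    reassoc_of% (hom_whiskerRight_inv (F.pro m) (Φ.id_inv_hom x))]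

theorem compInv_runit {x y : D.Obj} (m : D.Pro x y) :
    hom (E.hcompCell (E.vid (F.pro m)) (Φ.idInv y)) ≫ hom (Φ.compInv m (D.hid y)) ≫
      F.mapHom (hom (D.runitHom m)) = hom (E.runitHom (F.pro m)) := by
  have h : hom (F.colaxComp m (D.hid y)) ≫ hom (E.hcompCell (E.vid (F.pro m)) (F.colaxId y)) ≫
    hom (E.runitHom (F.pro m)) = F.mapHom (hom (D.runitHom m)) := F.right_unitality m
  rw [← h, reassoc_of% (Φ.comp_inv_hom m (D.hid y)),
    reassoc_of% (hom_whiskerLeft_inv (F.pro m) (Φ.id_inv_hom y))]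

end ComparisonInverse

/-- Universal arrows from each object to a colax double functor, and universal cells from each
proarrow lying over them. -/
structure UniversalFrom (F : ColaxDblFunctor D E) where
  obj : E.Obj → D.Obj
  unit : ∀ Y : E.Obj, Y ⟶ F.obj (obj Y)
  desc : ∀ {Y : E.Obj} {x : D.Obj}, (Y ⟶ F.obj x) → (obj Y ⟶ x)
  fac : ∀ {Y : E.Obj} {x : D.Obj} (f : Y ⟶ F.obj x), unit Y ≫ F.map (desc f) = f
  arrow_ext : ∀ {Y : E.Obj} {x : D.Obj} {a b : obj Y ⟶ x},
    unit Y ≫ F.map a = unit Y ≫ F.map b → a = b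
  pro : ∀ {X Y : E.Obj}, E.Pro X Y → D.Pro (obj X) (obj Y)
  unitPro : ∀ {X Y : E.Obj} (M : E.Pro X Y), E.Cell (unit X) (unit Y) M (F.pro (pro M))
  descCell : ∀ {x y : D.Obj} {X Y : E.Obj} {f : X ⟶ F.obj x} {g : Y ⟶ F.obj y} {m : D.Pro x y}
    {M : E.Pro X Y}, E.Cell f g M (F.pro m) → D.Cell (desc f) (desc g) (pro M) m
  fac_cell : ∀ {x y : D.Obj} {X Y : E.Obj} {f : X ⟶ F.obj x} {g : Y ⟶ F.obj y} {m : D.Pro x y}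
    {M : E.Pro X Y} (α : E.Cell f g M (F.pro m)),
    hom (unitPro M) ≫ F.mapHom (hom (descCell α)) = hom α
  cell_ext : ∀ {P : Proarrow D} {X Y : E.Obj} {M : E.Pro X Y} {a b : Proarrow.mk (pro M) ⟶ P},
    hom (unitPro M) ≫ F.mapHom a = hom (unitPro M) ≫ F.mapHom b → a = b

/-! ### The left adjoint determined by universal arrows and cells -/

namespace UniversalFrom

variable {F : ColaxDblFunctor D E} (U : F.UniversalFrom) (Φ : F.ComparisonInverse)

/-- Needed to recast the transposed comparison cells as globular cells. -/
theorem desc_unit_comp_id (X : E.Obj) : U.desc (U.unit X ≫ 𝟙 _) = 𝟙 (U.obj X) :=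
  U.arrow_ext (by rw [U.fac, F.map_id])

/-- composition comparison of the left adjoint -/
def colaxComp {X Y Z : E.Obj} (M : E.Pro X Y) (N : E.Pro Y Z) :
    D.Cell (𝟙 (U.obj X)) (𝟙 (U.obj Z)) (U.pro (E.hcomp M N)) (D.hcomp (U.pro M) (U.pro N)) :=
  recast (U.desc_unit_comp_id X) (U.desc_unit_comp_id Z)
    (U.descCell (E.vcomp (E.hcompCell (U.unitPro M) (U.unitPro N))
      (Φ.compInv (U.pro M) (U.pro N))))

/-- identity comparison of the left adjoint -/
def colaxId (X : E.Obj) :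
    D.Cell (𝟙 (U.obj X)) (𝟙 (U.obj X)) (U.pro (E.hid X)) (D.hid (U.obj X)) :=
  recast (U.desc_unit_comp_id X) (U.desc_unit_comp_id X)
    (U.descCell (E.vcomp (E.hidCell (U.unit X)) (Φ.idInv (U.obj X))))

/-- The colax comparison of the left adjoint is the unique cell whose transpose is the external
composite of units followed by the inverse comparison of `F`. -/
theorem unit_colaxComp {X Y Z : E.Obj} (M : E.Pro X Y) (N : E.Pro Y Z) :
    hom (U.unitPro (E.hcomp M N)) ≫ F.mapHom (hom (U.colaxComp Φ M N)) =
      hom (E.hcompCell (U.unitPro M) (U.unitPro N)) ≫ hom (Φ.compInv (U.pro M) (U.pro N)) := by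
  rw [colaxComp, hom_recast, ← hom_vcomp]
  exact U.fac_cell _

theorem unit_colaxId (X : E.Obj) :
    hom (U.unitPro (E.hid X)) ≫ F.mapHom (hom (U.colaxId Φ X)) =
      hom (E.hidCell (U.unit X)) ≫ hom (Φ.idInv (U.obj X)) := by
  rw [colaxId, hom_recast, ← hom_vcomp]
  exact U.fac_cell _

/-- action of the left adjoint on arrows -/
def map {X Y : E.Obj} (f : X ⟶ Y) : U.obj X ⟶ U.obj Y :=
  U.desc (f ≫ U.unit Y)

/-- action of the left adjoint on cells -/
def cell {X Y W Z : E.Obj} {f : X ⟶ W} {g : Y ⟶ Z} {M : E.Pro X Y} {N : E.Pro W Z}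
    (α : E.Cell f g M N) : D.Cell (U.map f) (U.map g) (U.pro M) (U.pro N) :=
  U.descCell (E.vcomp α (U.unitPro N))

theorem unit_map {X Y : E.Obj} (f : X ⟶ Y) :
    U.unit X ≫ F.map (U.map f) = f ≫ U.unit Y :=
  U.fac _

theorem unit_cell {X Y W Z : E.Obj} {f : X ⟶ W} {g : Y ⟶ Z} {M : E.Pro X Y} {N : E.Pro W Z}
    (α : E.Cell f g M N) :
    hom (U.unitPro M) ≫ F.mapHom (hom (U.cell α)) = hom α ≫ hom (U.unitPro N) :=
  (U.fac_cell _).trans (hom_vcomp _ _)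

/-- Interchange lets units be absorbed componentwise in an external composite; `α'` and `β'` must
share their middle arrow for the result to be composable. -/
theorem unit_hcompCell {x y z : D.Obj} {X Y Z : E.Obj} {f : U.obj X ⟶ x} {g : U.obj Y ⟶ y}
    {h : U.obj Z ⟶ z} {f' : X ⟶ F.obj x} {g' : Y ⟶ F.obj y} {h' : Z ⟶ F.obj z}
    {m : D.Pro x y} {n : D.Pro y z} {M : E.Pro X Y} {N : E.Pro Y Z}
    {α : D.Cell f g (U.pro M) m} {β : D.Cell g h (U.pro N) n}
    {α' : E.Cell f' g' M (F.pro m)} {β' : E.Cell g' h' N (F.pro n)}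
    (hα : hom (U.unitPro M) ≫ F.mapHom (hom α) = hom α')
    (hβ : hom (U.unitPro N) ≫ F.mapHom (hom β) = hom β') :
    hom (E.hcompCell (U.unitPro M) (U.unitPro N)) ≫ hom (E.hcompCell (F.cell α) (F.cell β)) =
      hom (E.hcompCell α' β') := by
  rw [← hom_hcompCell_vcomp]
  exact hom_hcompCell_congr hα hβ

/-- The trailing identity cell gives side arrows `unit ≫ 𝟙`, those of the transposed comparison
cells appearing next to it in external composites. -/
theorem unit_vid {X Y : E.Obj} (M : E.Pro X Y) :
    hom (U.unitPro M) ≫ F.mapHom (hom (D.vid (U.pro M))) =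
      hom (E.vcomp (U.unitPro M) (E.vid _)) := by
  rw [hom_vid, hom_vcomp, hom_vid, F.mapHom_id]

/-- The colax double functor determined by universal arrows and cells. -/
def toColaxDblFunctor : ColaxDblFunctor E D where
  obj := U.obj
  map := U.map
  pro := U.pro
  cell := U.cell
  map_id X := U.arrow_ext (by rw [unit_map, F.map_id, Category.comp_id, Category.id_comp])
  map_comp {X Y Z} f g := U.arrow_ext (by
    rw [unit_map, F.map_comp, reassoc_of% (U.unit_map f), unit_map, Category.assoc])
  cell_vid M := U.cell_ext (a := hom (U.cell (E.vid M))) (b := hom (D.vid (U.pro M))) (by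
    rw [unit_cell, unit_vid, hom_vcomp, hom_vid, hom_vid, Category.comp_id, Category.id_comp])
  cell_vcomp α β := U.cell_ext (a := hom (U.cell (E.vcomp α β)))
    (b := hom (D.vcomp (U.cell α) (U.cell β))) (by
    rw [unit_cell, hom_vcomp, hom_vcomp, F.mapHom_comp, Category.assoc,
      reassoc_of% (U.unit_cell α), unit_cell])
  colaxComp := U.colaxComp Φ
  colaxId := U.colaxId Φ
  -- Precomposing with the universal cell moves the comparison of the left adjoint to the inverse
  -- comparison of `F`, whose naturality gives the square.
  colaxComp_naturality {_ _ _ _ _ _ _ _ _ M N M' N'} α β := U.cell_ext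
    (a := hom (U.colaxComp Φ M N) ≫ hom (D.hcompCell (U.cell α) (U.cell β)))
    (b := hom (U.cell (E.hcompCell α β)) ≫ hom (U.colaxComp Φ M' N')) (by
    rw [F.mapHom_comp, F.mapHom_comp, reassoc_of% (U.unit_colaxComp Φ M N),
      reassoc_of% (U.unit_cell (E.hcompCell α β)), unit_colaxComp, Φ.compInv_naturality,
      reassoc_of% (U.unit_hcompCell (α' := E.vcomp α (U.unitPro M'))
        (β' := E.vcomp β (U.unitPro N')) (U.unit_cell α) (U.unit_cell β)),
      hom_hcompCell_vcomp, Category.assoc])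
  colaxId_naturality {X Y} f := U.cell_ext
    (a := hom (U.colaxId Φ X) ≫ hom (D.hidCell (U.map f)))
    (b := hom (U.cell (E.hidCell f)) ≫ hom (U.colaxId Φ Y)) (by
    rw [F.mapHom_comp, F.mapHom_comp, reassoc_of% (U.unit_colaxId Φ X),
      reassoc_of% (U.unit_cell (E.hidCell f)), unit_colaxId, Φ.idInv_naturality,
      ← Category.assoc, ← Category.assoc, ← hom_hidCell_comp, ← hom_hidCell_comp,
      hom_hidCell_congr (U.unit_map f)])
  -- Both sides are precomposed with the universal cell. The left side acquires the associator of
  -- `E` through `compInv_assoc`, the right side has it from the start, and its naturality with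
  -- respect to the unit cells matches them.
  associativity M N P := U.cell_ext
    (a := hom (U.colaxComp Φ (E.hcomp M N) P) ≫
      hom (D.hcompCell (U.colaxComp Φ M N) (D.vid (U.pro P))) ≫
        hom (D.assocHom (U.pro M) (U.pro N) (U.pro P)))
    (b := hom (U.cell (E.assocHom M N P)) ≫ hom (U.colaxComp Φ M (E.hcomp N P)) ≫
      hom (D.hcompCell (D.vid (U.pro M)) (U.colaxComp Φ N P))) (by
    have h := Φ.compInv_assoc (U.pro M) (U.pro N) (U.pro P)
    simp only [F.mapHom_comp]
    rw [reassoc_of% (U.unit_colaxComp Φ (E.hcomp M N) P),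
      reassoc_of% (Φ.compInv_naturality (U.colaxComp Φ M N) (D.vid (U.pro P))),
      reassoc_of% (U.unit_hcompCell (α' := E.vcomp (E.hcompCell (U.unitPro M) (U.unitPro N))
        (Φ.compInv (U.pro M) (U.pro N))) (β' := E.vcomp (U.unitPro P) (E.vid _))
        (U.unit_colaxComp Φ M N) (U.unit_vid P)),
      hom_hcompCell_vcomp, Category.assoc, h, reassoc_of% (U.unit_cell (E.assocHom M N P)),
      reassoc_of% (U.unit_colaxComp Φ M (E.hcomp N P)), Φ.compInv_naturality,
      reassoc_of% (U.unit_hcompCell (β' := E.vcomp (E.hcompCell (U.unitPro N) (U.unitPro P))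
        (Φ.compInv (U.pro N) (U.pro P))) (α' := E.vcomp (U.unitPro M) (E.vid _))
        (U.unit_vid M) (U.unit_colaxComp Φ N P)),
      hom_hcompCell_vcomp, Category.assoc,
      ← reassoc_of% (hom_assoc_naturality (U.unitPro M) (U.unitPro N) (U.unitPro P))])
  left_unitality {X Y} M := U.cell_ext
    (a := hom (U.colaxComp Φ (E.hid X) M) ≫
      hom (D.hcompCell (U.colaxId Φ X) (D.vid (U.pro M))) ≫ hom (D.lunitHom (U.pro M)))
    (b := hom (U.cell (E.lunitHom M))) (by
    have h := Φ.compInv_lunit (U.pro M)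
    simp only [F.mapHom_comp]
    rw [reassoc_of% (U.unit_colaxComp Φ (E.hid X) M),
      reassoc_of% (Φ.compInv_naturality (U.colaxId Φ X) (D.vid (U.pro M))),
      reassoc_of% (U.unit_hcompCell (α' := E.vcomp (E.hidCell (U.unit X))
        (Φ.idInv (U.obj X))) (β' := E.vcomp (U.unitPro M) (E.vid _))
        (U.unit_colaxId Φ X) (U.unit_vid M)),
      hom_hcompCell_vcomp, Category.assoc, h, unit_cell, hom_lunit_naturality])
  right_unitality {X Y} M := U.cell_ext
    (a := hom (U.colaxComp Φ M (E.hid Y)) ≫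
      hom (D.hcompCell (D.vid (U.pro M)) (U.colaxId Φ Y)) ≫ hom (D.runitHom (U.pro M)))
    (b := hom (U.cell (E.runitHom M))) (by
    have h := Φ.compInv_runit (U.pro M)
    simp only [F.mapHom_comp]
    rw [reassoc_of% (U.unit_colaxComp Φ M (E.hid Y)),
      reassoc_of% (Φ.compInv_naturality (D.vid (U.pro M)) (U.colaxId Φ Y)),
      reassoc_of% (U.unit_hcompCell (β' := E.vcomp (E.hidCell (U.unit Y))
        (Φ.idInv (U.obj Y))) (α' := E.vcomp (U.unitPro M) (E.vid _))
        (U.unit_vid M) (U.unit_colaxId Φ Y)),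
      hom_hcompCell_vcomp, Category.assoc, h, unit_cell, hom_runit_naturality])

/-- unit of the adjunction determined by universal arrows and cells -/
def unitTrans : ColaxDblTrans (ColaxDblFunctor.id E) ((U.toColaxDblFunctor Φ).comp F) where
  app := U.unit
  appPro := U.unitPro
  naturality f := (U.unit_map f).symm
  naturality_cell α := (U.unit_cell α).symm
  -- The comparison of the composite functor is a recast of the image of the new comparison followed
  -- by that of `F`; transposing, an inverse comparison meets the comparison of `F` and cancels.
  colaxComp_app {X Y Z} M N := by
    refine Eq.trans ?_ (congrArg (hom (U.unitPro (E.hcomp M N)) ≫ ·) (hom_recast _ _ _)).symm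
    change 𝟙 (Proarrow.mk (E.hcomp M N)) ≫ hom (E.hcompCell (U.unitPro M) (U.unitPro N)) =
      _ ≫ F.mapHom (hom (U.colaxComp Φ M N)) ≫ hom (F.colaxComp (U.pro M) (U.pro N))
    rw [reassoc_of% (U.unit_colaxComp Φ M N), Φ.comp_inv_hom, Category.comp_id,
      Category.id_comp]
  colaxId_app X := by
    refine Eq.trans ?_ (congrArg (hom (U.unitPro (E.hid X)) ≫ ·) (hom_recast _ _ _)).symm
    change 𝟙 (Proarrow.mk (E.hid X)) ≫ hom (E.hidCell (U.unit X)) =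
      _ ≫ F.mapHom (hom (U.colaxId Φ X)) ≫ hom (F.colaxId (U.obj X))
    rw [reassoc_of% (U.unit_colaxId Φ X), Φ.id_inv_hom, Category.comp_id, Category.id_comp]

/-- counit of the adjunction determined by universal arrows and cells -/
def counit : ColaxDblTrans (F.comp (U.toColaxDblFunctor Φ)) (ColaxDblFunctor.id D) where
  app x := U.desc (𝟙 (F.obj x))
  appPro m := U.descCell (E.vid (F.pro m))
  naturality {x y} f := U.arrow_ext (a := U.map (F.map f) ≫ U.desc (𝟙 _)) (b := U.desc (𝟙 _) ≫ f)
    (by rw [F.map_comp, F.map_comp, reassoc_of% (U.unit_map (F.map f)), U.fac,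
      reassoc_of% (U.fac (𝟙 (F.obj x))), Category.comp_id])
  naturality_cell {_ _ _ _ _ _ m n} α := U.cell_ext
    (a := hom (U.cell (F.cell α)) ≫ hom (U.descCell (E.vid (F.pro n))))
    (b := hom (U.descCell (E.vid (F.pro m))) ≫ hom α) (by
    rw [F.mapHom_comp, F.mapHom_comp, reassoc_of% (U.unit_cell (F.cell α)), U.fac_cell,
      reassoc_of% (U.fac_cell (E.vid (F.pro m))), hom_vid, hom_vid, Category.comp_id,
      Category.id_comp]
    rfl)
  -- The cancellation occurs here in the other order: a comparison of `F` followed by its inverse.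
  -- The rest is the factorisation of identity cells through the units.
  colaxComp_app {x y z} m n := (congrArg (· ≫ hom (D.hcompCell _ _)) (hom_recast _ _ _)).trans
    (U.cell_ext
    (a := (hom (U.cell (F.colaxComp m n)) ≫ hom (U.colaxComp Φ (F.pro m) (F.pro n))) ≫
      hom (D.hcompCell (U.descCell (E.vid (F.pro m))) (U.descCell (E.vid (F.pro n)))))
    (b := hom (U.descCell (E.vid (F.pro (D.hcomp m n)))) ≫ hom (D.vid (D.hcomp m n))) (by
    simp only [F.mapHom_comp, Category.assoc]
    rw [reassoc_of% (U.unit_cell (F.colaxComp m n)),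
      reassoc_of% (U.unit_colaxComp Φ (F.pro m) (F.pro n)), Φ.compInv_naturality,
      reassoc_of% (U.unit_hcompCell (U.fac_cell (E.vid (F.pro m)))
        (U.fac_cell (E.vid (F.pro n)))), hom_hcompCell_vid, Category.id_comp, Φ.comp_hom_inv,
      reassoc_of% (U.fac_cell (E.vid (F.pro (D.hcomp m n)))), hom_vid, hom_vid, F.mapHom_id,
      Category.id_comp]))
  colaxId_app x := (congrArg (· ≫ hom (D.hidCell _)) (hom_recast _ _ _)).trans
    (U.cell_ext
    (a := (hom (U.cell (F.colaxId x)) ≫ hom (U.colaxId Φ (F.obj x))) ≫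
      hom (D.hidCell (U.desc (𝟙 (F.obj x)))))
    (b := hom (U.descCell (E.vid (F.pro (D.hid x)))) ≫ hom (D.vid (D.hid x))) (by
    simp only [F.mapHom_comp, Category.assoc]
    rw [reassoc_of% (U.unit_cell (F.colaxId x)),
      reassoc_of% (U.unit_colaxId Φ (F.obj x)), Φ.idInv_naturality,
      ← reassoc_of% (hom_hidCell_comp (U.unit _) (F.map (U.desc (𝟙 (F.obj x))))),
      hom_hidCell_congr (U.fac _), hom_hidCell_id, Category.id_comp, Φ.id_hom_inv,
      reassoc_of% (U.fac_cell (E.vid (F.pro (D.hid x)))), hom_vid, hom_vid, F.mapHom_id,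
      Category.id_comp]))

/-- A colax double functor with invertible comparisons is right adjoint to the colax double
functor determined by universal arrows and cells. -/
def adjunction : ColaxDblAdjunction (U.toColaxDblFunctor Φ) F where
  unit := U.unitTrans Φ
  counit := U.counit Φ
  left_triangle X := U.arrow_ext (a := U.map (U.unit X) ≫ U.desc (𝟙 _)) (b := 𝟙 (U.obj X)) (by
    rw [F.map_comp, reassoc_of% (U.unit_map (U.unit X)), U.fac, F.map_id])
  left_triangle_pro M := U.cell_ext
    (a := hom (U.cell (U.unitPro M)) ≫ hom (U.descCell (E.vid (F.pro (U.pro M)))))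
    (b := hom (D.vid (U.pro M))) (by
    rw [F.mapHom_comp, reassoc_of% (U.unit_cell (U.unitPro M)), U.fac_cell, unit_vid, hom_vcomp])
  right_triangle x := U.fac _
  right_triangle_pro m := U.fac_cell _

end UniversalFrom
end ColaxDblFunctor

/-! ### The comparison cells of the diagonals are invertible -/

section DiagonalInverse

open DblCat

variable (κ : IndexClass.{w}) (D : DblCat.{u₀, v₀, u₁, v₁})

variable {κ D} in
/-- constituent of the inverse identity comparison of the contravariant diagonal -/
def OpFamCell.singleIdInvAt (x : D.Obj) : ∀ {i j : PUnit.{w + 1}} (a : (SetSpan.one PUnit).El i j),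
    D.Cell (𝟙 x) (𝟙 x) (D.hid x) (idPro (fun _ => x) a)
  | _, _, ⟨_, rfl, rfl⟩ => D.vid (D.hid x)

variable {κ D} in
/-- constituent of the inverse identity comparison of the covariant diagonal -/
def FamCell.singleIdInvAt (x : D.Obj) : ∀ {i j : PUnit.{w + 1}} (a : (SetSpan.one PUnit).El i j),
    D.Cell (𝟙 x) (𝟙 x) (idPro (fun _ => x) a) (D.hid x)
  | _, _, ⟨_, rfl, rfl⟩ => D.vid (D.hid x)

/-- The comparison cells of the contravariant diagonal are invertible. -/
def deltaOpComparisonInverse : (deltaOp κ D).ComparisonInverse where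
  compInv {x y z} m n :=
    (⟨fun _ => PUnit.unit, fun _ => rfl, fun _ => rfl, fun _ => D.vid (D.hcomp m n)⟩ :
      OpFamCell (OpFamHom.id _) (OpFamHom.id _)
        (FamPro.single κ (D.hcomp m n)) ((FamPro.single κ m).hcomp (FamPro.single κ n)))
  idInv x :=
    (⟨fun a => a, fun _ => rfl, fun _ => rfl, fun a => OpFamCell.singleIdInvAt x a⟩ :
      OpFamCell (OpFamHom.id _) (OpFamHom.id _)
        (FamPro.single κ (D.hid x)) (FamPro.hid (FamObj.single κ x)))
  -- The composite of two singleton spans again has a one-element apex, so the index maps agree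
  -- definitionally and only identity cells of `D` remain to be composed.
  comp_hom_inv m n := OpFamCell.sq_ext (OpFamHom.mk_eq fun _ => Category.id_comp _)
    (OpFamHom.mk_eq fun _ => Category.id_comp _) (fun _ => rfl)
    fun _ _ _ => heq_of_sq (D.vid_vcomp _)
  comp_inv_hom m n := OpFamCell.sq_ext (OpFamHom.mk_eq fun _ => Category.id_comp _)
    (OpFamHom.mk_eq fun _ => Category.id_comp _) (fun _ => rfl)
    fun _ _ _ => heq_of_sq (D.vid_vcomp _)
  id_hom_inv x := OpFamCell.sq_ext (OpFamHom.mk_eq fun _ => Category.id_comp _)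
    (OpFamHom.mk_eq fun _ => Category.id_comp _) (fun _ => rfl)
    -- The constituents of an identity proarrow family are defined by matching on the element of the
    -- identity span, so they reduce only once the element has been destructured.
    (by rintro _ _ ⟨_, rfl, rfl⟩; exact heq_of_sq (D.vid_vcomp _))
  id_inv_hom x := OpFamCell.sq_ext (OpFamHom.mk_eq fun _ => Category.id_comp _)
    (OpFamHom.mk_eq fun _ => Category.id_comp _) (fun _ => rfl)
    (by rintro _ _ ⟨_, rfl, rfl⟩; exact heq_of_sq (D.vid_vcomp _))

/-- The comparison cells of the covariant diagonal are invertible. -/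
def deltaComparisonInverse : (delta κ D).ComparisonInverse where
  compInv {x y z} m n :=
    (⟨fun _ => PUnit.unit, fun _ => rfl, fun _ => rfl, fun _ => D.vid (D.hcomp m n)⟩ :
      FamCell (FamHom.id _) (FamHom.id _)
        ((FamPro.single κ m).hcomp (FamPro.single κ n)) (FamPro.single κ (D.hcomp m n)))
  idInv x :=
    (⟨fun a => a, fun _ => rfl, fun _ => rfl, fun a => FamCell.singleIdInvAt x a⟩ :
      FamCell (FamHom.id _) (FamHom.id _)
        (FamPro.hid (FamObj.single κ x)) (FamPro.single κ (D.hid x)))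
  comp_hom_inv m n := FamCell.sq_ext (FamHom.mk_eq fun _ => Category.id_comp _)
    (FamHom.mk_eq fun _ => Category.id_comp _) (fun _ => rfl)
    fun _ _ _ => heq_of_sq (D.vid_vcomp _)
  comp_inv_hom m n := FamCell.sq_ext (FamHom.mk_eq fun _ => Category.id_comp _)
    (FamHom.mk_eq fun _ => Category.id_comp _) (fun _ => rfl)
    fun _ _ _ => heq_of_sq (D.vid_vcomp _)
  id_hom_inv x := FamCell.sq_ext (FamHom.mk_eq fun _ => Category.id_comp _)
    (FamHom.mk_eq fun _ => Category.id_comp _) (fun _ => rfl)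
    (by rintro _ _ ⟨_, rfl, rfl⟩; exact heq_of_sq (D.vid_vcomp _))
  id_inv_hom x := FamCell.sq_ext (FamHom.mk_eq fun _ => Category.id_comp _)
    (FamHom.mk_eq fun _ => Category.id_comp _) (fun _ => rfl)
    (by rintro _ _ ⟨_, rfl, rfl⟩; exact heq_of_sq (D.vid_vcomp _))

end DiagonalInverse

/-! ### Lax products of spans -/

/-- The category `S` has products indexed by the sets in `κ`. -/
class IndexClass.HasProducts (κ : IndexClass.{w}) (S : Type u) [Category.{v} S] : Prop where
  hasProductsOfShape : ∀ {I : Type w}, κ.mem I → HasProductsOfShape I S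

/-- A family of spans in `S`, indexed by a span of sets. -/
structure SpanFamily (S : Type u) [Category.{v} S] where
  I : Type w
  J : Type w
  A : Type w
  l₀ : A → I
  r₀ : A → J
  x : I → S
  y : J → S
  s : A → S
  l : ∀ a, s a ⟶ x (l₀ a)
  r : ∀ a, s a ⟶ y (r₀ a)

/-! ### The product of a family of spans as a pullback -/

namespace SpanFamily

variable {S : Type u} [Category.{v} S] [HasPullbacks S] [HasBinaryProducts S]
  (M : SpanFamily.{w} S) [HasProduct M.x] [HasProduct M.y] [HasProduct M.s]
  [HasProduct fun a => M.x (M.l₀ a) ⨯ M.y (M.r₀ a)]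

/-- The product of a family of spans: the joint pullback of its members along the projections from
the products of the feet. -/
noncomputable def prodSpan : SpanIn (∏ᶜ M.x) (∏ᶜ M.y) where
  apex := pullback
    (Pi.lift fun a => Limits.prod.map (Pi.π M.x (M.l₀ a)) (Pi.π M.y (M.r₀ a)))
    (Limits.Pi.map fun a => prod.lift (M.l a) (M.r a))
  l := pullback.fst _ _ ≫ prod.fst
  r := pullback.fst _ _ ≫ prod.snd

/-- The projection from the apex of the product of a family of spans. -/
noncomputable def apexProj (a : M.A) : M.prodSpan.apex ⟶ M.s a :=
  pullback.snd _ _ ≫ Pi.π _ a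

/-- This is the component at `a` of the pullback square, read in the first factor of `x (l₀ a) × y
(r₀ a)`. -/
theorem apexProj_l (a : M.A) :
    M.apexProj a ≫ M.l a = M.prodSpan.l ≫ Pi.π M.x (M.l₀ a) := by
  have h := pullback.condition
    (f := Pi.lift fun a => Limits.prod.map (Pi.π M.x (M.l₀ a)) (Pi.π M.y (M.r₀ a)))
    (g := Limits.Pi.map fun a => prod.lift (M.l a) (M.r a)) =≫ (Pi.π _ a ≫ prod.fst)
  simp only [Category.assoc, Pi.map_π_assoc, Pi.lift_π_assoc, prod.lift_fst, prod.map_fst] at h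
  exact (Category.assoc _ _ _).trans (h.symm.trans (Category.assoc _ _ _).symm)

theorem apexProj_r (a : M.A) :
    M.apexProj a ≫ M.r a = M.prodSpan.r ≫ Pi.π M.y (M.r₀ a) := by
  have h := pullback.condition
    (f := Pi.lift fun a => Limits.prod.map (Pi.π M.x (M.l₀ a)) (Pi.π M.y (M.r₀ a)))
    (g := Limits.Pi.map fun a => prod.lift (M.l a) (M.r a)) =≫ (Pi.π _ a ≫ prod.snd)
  simp only [Category.assoc, Pi.map_π_assoc, Pi.lift_π_assoc, prod.lift_snd, prod.map_snd] at h
  exact (Category.assoc _ _ _).trans (h.symm.trans (Category.assoc _ _ _).symm)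

/-- A map into the pullback is determined by its components in `∏ x × ∏ y` and `∏ s`. The legs have
to be included because indices outside the images of `l₀` and `r₀` are not seen by the apex
projections. -/
theorem prodSpan_hom_ext {t : S} {f g : t ⟶ M.prodSpan.apex}
    (hl : f ≫ M.prodSpan.l = g ≫ M.prodSpan.l) (hr : f ≫ M.prodSpan.r = g ≫ M.prodSpan.r)
    (h : ∀ a, f ≫ M.apexProj a = g ≫ M.apexProj a) : f = g :=
  pullback.hom_ext
    (Limits.prod.hom_ext ((Category.assoc _ _ _).trans (hl.trans (Category.assoc _ _ _).symm))
      ((Category.assoc _ _ _).trans (hr.trans (Category.assoc _ _ _).symm)))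
    (Pi.hom_ext _ _ fun a =>
      (Category.assoc _ _ _).trans ((h a).trans (Category.assoc _ _ _).symm))

/-- The universal map into the product of a family of spans. -/
noncomputable def lift {x y : S} {n : SpanIn x y} {f : ∀ i, x ⟶ M.x i} {g : ∀ j, y ⟶ M.y j}
    (c : ∀ a, n.apex ⟶ M.s a) (hl : ∀ a, c a ≫ M.l a = n.l ≫ f (M.l₀ a))
    (hr : ∀ a, c a ≫ M.r a = n.r ≫ g (M.r₀ a)) :
    SpanIn.Cell (Pi.lift f) (Pi.lift g) n M.prodSpan where
  -- The two components into the pullback are the pair of legs followed by the tuples `f` and `g`,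
  -- and the tuple `c`. They agree over `∏ₐ (x × y)` by the leg conditions in each factor.
  hom := pullback.lift (prod.lift (n.l ≫ Pi.lift f) (n.r ≫ Pi.lift g)) (Pi.lift c)
    (Pi.hom_ext _ _ fun a => Limits.prod.hom_ext (by simp [hl, prod.lift_fst])
      (by simp [hr, prod.lift_snd]))
  hom_l := (pullback.lift_fst_assoc _ _ _ _).trans (prod.lift_fst _ _)
  hom_r := (pullback.lift_fst_assoc _ _ _ _).trans (prod.lift_snd _ _)

theorem lift_apexProj {x y : S} {n : SpanIn x y} {f : ∀ i, x ⟶ M.x i} {g : ∀ j, y ⟶ M.y j}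
    (c : ∀ a, n.apex ⟶ M.s a) (hl : ∀ a, c a ≫ M.l a = n.l ≫ f (M.l₀ a))
    (hr : ∀ a, c a ≫ M.r a = n.r ≫ g (M.r₀ a)) (a : M.A) :
    (M.lift c hl hr).hom ≫ M.apexProj a = c a :=
  (pullback.lift_snd_assoc _ _ _ _).trans (Pi.lift_π _ _)

end SpanFamily

/-! ### Universality of products in the double category of spans -/

section SpanProducts

open DblCat

variable {κ : IndexClass.{w}} {S : Type u} [Category.{v} S] [HasPullbacks S]

section Families

variable {x y : S} {n : SpanIn x y} {X Y : FamObj κ (spanDbl S)} {M : FamPro X Y}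

/-- The index function lands in a singleton, so it carries no information. -/
theorem OpFamHom.single_ext {D : DblCat.{u₀, v₀, u₁, v₁}} {x : D.Obj} {X : FamObj κ D}
    {F G : OpFamHom (FamObj.single κ x) X} (h : ∀ i, F.f i = G.f i) : F = G := by
  obtain ⟨F₀, F⟩ := F
  obtain ⟨G₀, G⟩ := G
  obtain rfl : F₀ = G₀ := funext fun _ => rfl
  exact OpFamHom.mk_eq h

/-- The arrow of apexes underlying the component at `a` of a cell from a single span to a family
of spans. -/
def DblQuiver.Sq.apexAt (σ : (opFamQuiver κ (spanDbl S)).Sq (FamPro.single κ (D := spanDbl S) n) M)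
    (a : M.A.apex) : n.apex ⟶ (spanAt M a).apex :=
  SpanIn.Cell.hom (S := S) (σ.cell.α ⟨a, rfl, rfl⟩)

/-- A map of spans is determined by its side arrows and its arrow of apexes, and the index map into
a singleton apex is unique. Every element of the indexing span has the form `⟨a, rfl, rfl⟩` up to
its endpoints, so components at apex elements suffice. -/
theorem OpFamCell.sq_single_ext
    {σ τ : (opFamQuiver κ (spanDbl S)).Sq (FamPro.single κ (D := spanDbl S) n) M}
    (hl : ∀ i, σ.left.f i = τ.left.f i) (hr : ∀ j, σ.right.f j = τ.right.f j)
    (h : ∀ a, σ.apexAt a = τ.apexAt a) : σ = τ := by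
  obtain ⟨F, G, σ⟩ := σ
  obtain ⟨F', G', τ⟩ := τ
  refine OpFamCell.sq_ext (OpFamHom.single_ext hl) (OpFamHom.single_ext hr) (fun _ => rfl) ?_
  rintro _ _ ⟨a, rfl, rfl⟩
  exact heq_of_sq (D := spanDbl S) (SpanIn.sq_ext (hl _) (hr _) (h a))

end Families

/-- A family of objects of the double category of spans, as a family of objects of `S`. -/
def FamObj.ofSpans (X : FamObj κ (spanDbl S)) : X.I → S :=
  X.x

/-- A family of proarrows of the double category of spans, as a family of spans in `S`. -/
def FamPro.spanFamily {X Y : FamObj κ (spanDbl S)} (M : FamPro X Y) : SpanFamily.{w} S where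
  I := X.I
  J := Y.I
  A := M.A.apex
  l₀ := M.A.l
  r₀ := M.A.r
  x := X.ofSpans
  y := Y.ofSpans
  s a := (spanAt M a).apex
  l a := (spanAt M a).l
  r a := (spanAt M a).r

variable [hκ : κ.HasProducts S]

namespace FamObj

variable (X : FamObj κ (spanDbl S))

instance hasProduct : HasProduct X.ofSpans :=
  have := hκ.hasProductsOfShape X.memI
  inferInstance

/-- The product of a family of objects. -/
noncomputable def prod : S :=
  ∏ᶜ X.ofSpans

/-- The projections from the product of a family of objects. -/
noncomputable def proj : OpFamHom (FamObj.single κ (D := spanDbl S) X.prod) X :=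
  ⟨fun _ => PUnit.unit, Pi.π X.ofSpans⟩

variable {X} {x : S}

/-- The arrow into a product determined by its components. -/
noncomputable def prodLift (F : OpFamHom (FamObj.single κ (D := spanDbl S) x) X) : x ⟶ X.prod :=
  Pi.lift (f := X.ofSpans) F.f

theorem prodLift_proj (F : OpFamHom (FamObj.single κ (D := spanDbl S) x) X) (i : X.I) :
    prodLift F ≫ X.proj.f i = F.f i :=
  Pi.lift_π _ _

theorem prod_hom_ext {f g : x ⟶ X.prod} (h : ∀ i, f ≫ X.proj.f i = g ≫ X.proj.f i) : f = g :=
  Pi.hom_ext _ _ h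

end FamObj

variable [HasBinaryProducts S]

namespace FamPro

variable {X Y : FamObj κ (spanDbl S)} (M : FamPro X Y)

instance hasProduct_x : HasProduct M.spanFamily.x :=
  X.hasProduct

instance hasProduct_y : HasProduct M.spanFamily.y :=
  Y.hasProduct

/-- Stated for an arbitrary family over the apex because two such products are needed: of the apexes
`s a` and of the pairs `x (l a) × y (r a)`. -/
instance hasProduct_apex (f : M.spanFamily.A → S) : HasProduct f :=
  have : HasProductsOfShape M.spanFamily.A S := hκ.hasProductsOfShape M.memA
  inferInstance

/-- The product of a family of spans. -/
noncomputable def prod : SpanIn X.prod Y.prod :=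
  M.spanFamily.prodSpan

/-- The projection from the product of a family of spans to the member at an element of the
indexing span. -/
noncomputable def projAt : ∀ {i : X.I} {j : Y.I} (e : M.A.El i j),
    SpanIn.Cell (S := S) (X.proj.f i) (Y.proj.f j) M.prod (M.m e)
  | _, _, ⟨a, rfl, rfl⟩ =>
    ⟨M.spanFamily.apexProj a, M.spanFamily.apexProj_l a, M.spanFamily.apexProj_r a⟩

/-- The projections from the product of a family of spans. -/
noncomputable def proj : OpFamCell X.proj Y.proj (FamPro.single κ (D := spanDbl S) M.prod) M :=
  ⟨fun _ => PUnit.unit, fun _ => rfl, fun _ => rfl, fun e => M.projAt e⟩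

variable {M} {x y : S} {n : SpanIn x y}

/-- The map of spans into a product determined by its components. -/
noncomputable def prodLift {F : OpFamHom (FamObj.single κ (D := spanDbl S) x) X}
    {G : OpFamHom (FamObj.single κ (D := spanDbl S) y) Y}
    (α : OpFamCell F G (FamPro.single κ (D := spanDbl S) n) M) :
    SpanIn.Cell (FamObj.prodLift F) (FamObj.prodLift G) n M.prod :=
  M.spanFamily.lift (fun a => SpanIn.Cell.hom (S := S) (α.α ⟨a, rfl, rfl⟩))
    (fun a => SpanIn.Cell.hom_l (S := S) (α.α ⟨a, rfl, rfl⟩))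
    (fun a => SpanIn.Cell.hom_r (S := S) (α.α ⟨a, rfl, rfl⟩))

theorem prodLift_proj {F : OpFamHom (FamObj.single κ (D := spanDbl S) x) X}
    {G : OpFamHom (FamObj.single κ (D := spanDbl S) y) Y}
    (α : OpFamCell F G (FamPro.single κ (D := spanDbl S) n) M) (a : M.A.apex) :
    (prodLift α).hom ≫ ((opFamQuiver κ (spanDbl S)).sq M.proj).apexAt a =
      ((opFamQuiver κ (spanDbl S)).sq α).apexAt a :=
  M.spanFamily.lift_apexProj _ _ _ a

/-- With the side arrows fixed, the composites with the legs are prescribed, so only the apex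
projections are left to compare. -/
theorem prod_cell_ext {f : x ⟶ X.prod} {g : y ⟶ Y.prod} {α β : SpanIn.Cell f g n M.prod}
    (h : ∀ a, α.hom ≫ ((opFamQuiver κ (spanDbl S)).sq M.proj).apexAt a =
      β.hom ≫ ((opFamQuiver κ (spanDbl S)).sq M.proj).apexAt a) : α = β :=
  SpanIn.Cell.ext (M.spanFamily.prodSpan_hom_ext (α.hom_l.trans β.hom_l.symm)
    (α.hom_r.trans β.hom_r.symm) h)

end FamPro

variable (κ S) in
/-- The products of objects and of spans are universal. -/
noncomputable def spanUniversalTo : (deltaOp κ (spanDbl S)).UniversalTo where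
  obj X := FamObj.prod (S := S) X
  counit X := FamObj.proj X
  lift f := FamObj.prodLift (S := S) f
  fac f := OpFamHom.single_ext fun i => FamObj.prodLift_proj (S := S) f i
  arrow_ext {x X _ _} h := FamObj.prod_hom_ext (S := S) fun i =>
    congrArg (β := (x : S) ⟶ X.x i)
      (fun F : OpFamHom (FamObj.single κ (D := spanDbl S) x) X => F.f i) h
  pro M := FamPro.prod M
  counitPro M := FamPro.proj M
  liftCell α := FamPro.prodLift (S := S) α
  fac_cell {x y X Y f g m M} α := OpFamCell.sq_single_ext (n := m) (M := M)
    (fun i => FamObj.prodLift_proj (S := S) f i) (fun i => FamObj.prodLift_proj (S := S) g i)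
    (fun a => FamPro.prodLift_proj (S := S) (n := m) (M := M) α a)
  cell_ext {P X Y M a b} h := by
    obtain ⟨f, g, a⟩ := a
    obtain ⟨f', g', b⟩ := b
    -- The hypothesis equates cells with possibly different side arrows. Its two sides determine
    -- these arrows through the product projections; once they are identified, both cells have the
    -- same type and their apex arrows can be compared.
    have hf : f = f' := FamObj.prod_hom_ext (S := S) fun i => congrArg (β := (_ : S) ⟶ _)
      (fun σ : (opFamQuiver κ (spanDbl S)).Sq (FamPro.single κ (D := spanDbl S) P.pro) M =>
        σ.left.f i) h
    have hg : g = g' := FamObj.prod_hom_ext (S := S) fun i => congrArg (β := (_ : S) ⟶ _)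
      (fun σ : (opFamQuiver κ (spanDbl S)).Sq (FamPro.single κ (D := spanDbl S) P.pro) M =>
        σ.right.f i) h
    subst hf hg
    refine congrArg _ (FamPro.prod_cell_ext (α := a) (β := b) fun e => ?_)
    exact congrArg (fun σ : (opFamQuiver κ (spanDbl S)).Sq
      (FamPro.single κ (D := spanDbl S) P.pro) M => σ.apexAt e) h

variable (κ S) in
-- The right adjoint comes formally from the universal arrows and cells together with invertibility
-- of the comparisons of the diagonal.
theorem hasLaxProducts_spanDbl : HasLaxProducts κ (spanDbl S) :=
  ⟨_, ⟨(spanUniversalTo κ S).adjunction (deltaOpComparisonInverse κ (spanDbl S))⟩⟩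

end SpanProducts

/-! ### Lax products of spans are limits -/

/-! ### Universality of the counit of a lax adjunction -/

namespace LaxDblAdjunction

open DblCat

variable {D : DblCat.{u₀, v₀, u₁, v₁}} {E : DblCat.{u₂, v₂, u₃, v₃}} {F : LaxDblFunctor D E}
  {G : LaxDblFunctor E D} (adj : LaxDblAdjunction F G)

/-- The unit at an object. -/
def unitAt (x : D.Obj) : x ⟶ G.obj (F.obj x) :=
  adj.unit.app x

/-- The counit at an object. -/
def counitAt (X : E.Obj) : F.obj (G.obj X) ⟶ X :=
  adj.counit.app X

/-- The unit at a proarrow. -/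
def unitHom {x y : D.Obj} (m : D.Pro x y) : Proarrow.mk m ⟶ Proarrow.mk (G.pro (F.pro m)) :=
  hom (adj.unit.appPro m)

/-- The counit at a proarrow. -/
def counitHom {X Y : E.Obj} (M : E.Pro X Y) : Proarrow.mk (F.pro (G.pro M)) ⟶ Proarrow.mk M :=
  hom (adj.counit.appPro M)

/-- This and the following lemmas restate the adjunction data with the composite and identity
functors unfolded, so that the usual calculus of transposes applies to arrows and, in the category
of proarrows, to cells. -/
theorem unitAt_naturality {x y : D.Obj} (f : x ⟶ y) :
    f ≫ adj.unitAt y = adj.unitAt x ≫ G.map (F.map f) :=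
  adj.unit.naturality f

theorem counitAt_naturality {X Y : E.Obj} (f : X ⟶ Y) :
    F.map (G.map f) ≫ adj.counitAt Y = adj.counitAt X ≫ f :=
  adj.counit.naturality f

theorem unitHom_naturality {P Q : Proarrow D} (φ : P ⟶ Q) :
    φ ≫ adj.unitHom Q.pro = adj.unitHom P.pro ≫ G.mapHom (F.mapHom φ) :=
  adj.unit.naturality_cell φ.cell

theorem counitHom_naturality {P Q : Proarrow E} (φ : P ⟶ Q) :
    F.mapHom (G.mapHom φ) ≫ adj.counitHom Q.pro = adj.counitHom P.pro ≫ φ :=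
  adj.counit.naturality_cell φ.cell

theorem map_unitAt_counitAt (x : D.Obj) :
    F.map (adj.unitAt x) ≫ adj.counitAt (F.obj x) = 𝟙 _ :=
  adj.left_triangle x

theorem unitAt_map_counitAt (X : E.Obj) :
    adj.unitAt (G.obj X) ≫ G.map (adj.counitAt X) = 𝟙 _ :=
  adj.right_triangle X

theorem mapHom_unitHom_counitHom {x y : D.Obj} (m : D.Pro x y) :
    F.mapHom (adj.unitHom m) ≫ adj.counitHom (F.pro m) = 𝟙 _ :=
  adj.left_triangle_pro m

theorem unitHom_mapHom_counitHom {X Y : E.Obj} (M : E.Pro X Y) :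
    adj.unitHom (G.pro M) ≫ G.mapHom (adj.counitHom M) = 𝟙 _ :=
  adj.right_triangle_pro M

/-- Transposing back and forth is the identity: naturality of the counit followed by the left
triangle. The other direction uses naturality of the unit and the right triangle. -/
theorem map_lift_counitAt {x : D.Obj} {Y : E.Obj} (f : F.obj x ⟶ Y) :
    F.map (adj.unitAt x ≫ G.map f) ≫ adj.counitAt Y = f := by
  rw [F.map_comp, Category.assoc, adj.counitAt_naturality, reassoc_of% (adj.map_unitAt_counitAt x)]

theorem lift_map_counitAt {x : D.Obj} {Y : E.Obj} (a : x ⟶ G.obj Y) :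
    adj.unitAt x ≫ G.map (F.map a ≫ adj.counitAt Y) = a := by
  rw [G.map_comp, ← reassoc_of% (adj.unitAt_naturality a), adj.unitAt_map_counitAt,
    Category.comp_id]

theorem mapHom_lift_counitHom {x y : D.Obj} {X Y : E.Obj} {m : D.Pro x y} {M : E.Pro X Y}
    (φ : Proarrow.mk (F.pro m) ⟶ Proarrow.mk M) :
    F.mapHom (adj.unitHom m ≫ G.mapHom φ) ≫ adj.counitHom M = φ := by
  rw [F.mapHom_comp, Category.assoc, adj.counitHom_naturality φ,
    reassoc_of% (adj.mapHom_unitHom_counitHom m)]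

theorem lift_mapHom_counitHom {P : Proarrow D} {X Y : E.Obj} {M : E.Pro X Y}
    (φ : P ⟶ Proarrow.mk (G.pro M)) :
    adj.unitHom P.pro ≫ G.mapHom (F.mapHom φ ≫ adj.counitHom M) = φ := by
  rw [G.mapHom_comp, ← reassoc_of% (adj.unitHom_naturality φ), adj.unitHom_mapHom_counitHom,
    Category.comp_id]

/-- The components of the counit of an adjunction are universal. -/
def universalTo : F.UniversalTo where
  obj := G.obj
  counit := adj.counit.app
  lift {x _} f := adj.unit.app x ≫ G.map f
  fac f := adj.map_lift_counitAt f
  -- An arrow is recovered as the transpose of its image followed by the counit, so equal images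
  -- give equal arrows.
  arrow_ext {x Y a b} h := (adj.lift_map_counitAt a).symm.trans
    ((congrArg (fun f : F.obj x ⟶ Y => adj.unitAt x ≫ G.map f) h).trans (adj.lift_map_counitAt b))
  pro M := G.pro M
  counitPro M := adj.counit.appPro M
  liftCell {_ _ _ _ _ _ m _} α := D.vcomp (adj.unit.appPro m) (G.cell α)
  fac_cell α := adj.mapHom_lift_counitHom (hom α)
  cell_ext {P _ _ M a b} h := (adj.lift_mapHom_counitHom a).symm.trans
    ((congrArg (fun φ : Proarrow.mk (F.pro P.pro) ⟶ Proarrow.mk M =>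
      adj.unitHom P.pro ≫ G.mapHom φ) h).trans (adj.lift_mapHom_counitHom b))

end LaxDblAdjunction

/-! ### Universal cells as limit cones over the category of elements -/

section SpanLimits

open DblCat

variable {κ : IndexClass.{w}} {S : Type u} [Category.{v} S] [HasPullbacks S]
  (U : (deltaOp κ (spanDbl S)).UniversalTo)

/-- The arrow of families determined by a fan. -/
noncomputable def fanHom {X : FamObj κ (spanDbl S)} (s : Fan fun i : X.I => (X.x i : S)) :
    OpFamHom (FamObj.single κ (D := spanDbl S) s.pt) X :=
  ⟨fun _ => PUnit.unit, fun i => s.proj i⟩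

/-- The factorisation through the counit is an equation of arrows of families; this is its member at
`i`. -/
theorem lift_comp_counit {x : S} {X : FamObj κ (spanDbl S)}
    (F : OpFamHom (FamObj.single κ (D := spanDbl S) x) X) (i : X.I) :
    (U.lift F : x ⟶ (U.obj X : S)) ≫ OpFamHom.f (D := spanDbl S) (U.counit X) i = F.f i :=
  congrArg (β := x ⟶ X.x i)
    (fun F : OpFamHom (FamObj.single κ (D := spanDbl S) x) X => F.f i) (U.fac F)

/-- The projections of a universal object are those of a product. -/
noncomputable def isLimitFanCounit (X : FamObj κ (spanDbl S)) :
    IsLimit (Fan.mk (U.obj X : S) fun i : X.I =>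
      (OpFamHom.f (D := spanDbl S) (U.counit X) i : (U.obj X : S) ⟶ X.x i)) :=
  Fan.IsLimit.mk _ (fun s => U.lift (fanHom s)) (fun s i => lift_comp_counit U (fanHom s) i)
    (fun s _ h => U.arrow_ext (x := s.pt) (Y := X)
      (OpFamHom.single_ext (D := spanDbl S) (x := s.pt) fun i =>
        (h i).trans (lift_comp_counit U (fanHom s) i).symm))

variable {X Y : FamObj κ (spanDbl S)} {M : FamPro X Y}

/-- The arrow of families on the left feet of a cone over the diagram of a family of spans. -/
noncomputable def coneLeft (c : Cone (elementsDiagram M)) :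
    OpFamHom (FamObj.single κ (D := spanDbl S) c.pt) X :=
  ⟨fun _ => PUnit.unit, fun i => c.π.app ⟨some WalkingPair.left, i⟩⟩

/-- The arrow of families on the right feet of a cone over the diagram of a family of spans. -/
noncomputable def coneRight (c : Cone (elementsDiagram M)) :
    OpFamHom (FamObj.single κ (D := spanDbl S) c.pt) Y :=
  ⟨fun _ => PUnit.unit, fun j => c.π.app ⟨some WalkingPair.right, j⟩⟩

/-- The diagram sends the arrow from `a` to `l a` to the leg followed by a trivial transport, which
accounts for the composition with an identity. -/
theorem cone_w_left (c : Cone (elementsDiagram M)) (a : M.A.apex) :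
    c.π.app ⟨none, a⟩ ≫ (spanAt M a).l = c.π.app ⟨some WalkingPair.left, M.A.l a⟩ :=
  (congrArg (c.π.app ⟨none, a⟩ ≫ ·) (Category.comp_id _).symm).trans
    (c.w (j := ⟨none, a⟩) (j' := ⟨some WalkingPair.left, M.A.l a⟩)
      ⟨WidePushoutShape.Hom.init WalkingPair.left, rfl⟩)

theorem cone_w_right (c : Cone (elementsDiagram M)) (a : M.A.apex) :
    c.π.app ⟨none, a⟩ ≫ (spanAt M a).r = c.π.app ⟨some WalkingPair.right, M.A.r a⟩ :=
  (congrArg (c.π.app ⟨none, a⟩ ≫ ·) (Category.comp_id _).symm).trans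
    (c.w (j := ⟨none, a⟩) (j' := ⟨some WalkingPair.right, M.A.r a⟩)
      ⟨WidePushoutShape.Hom.init WalkingPair.right, rfl⟩)

/-- The components of a cone over the diagram of a family of spans, as maps of spans from an
identity span. -/
noncomputable def coneCellAt (c : Cone (elementsDiagram M)) : ∀ {i : X.I} {j : Y.I} (e : M.A.El i j),
    SpanIn.Cell (S := S) ((coneLeft c).f i) ((coneRight c).f j) (SpanIn.hid c.pt) (M.m e)
  | _, _, ⟨a, rfl, rfl⟩ => ⟨c.π.app ⟨none, a⟩,
      (cone_w_left c a).trans (Category.id_comp _).symm,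
      (cone_w_right c a).trans (Category.id_comp _).symm⟩

/-- A cone over the diagram of a family of spans, as a cell of families from an identity span. -/
noncomputable def coneCell (c : Cone (elementsDiagram M)) :
    OpFamCell (coneLeft c) (coneRight c)
      (FamPro.single κ (D := spanDbl S) (SpanIn.hid c.pt)) M :=
  ⟨fun _ => PUnit.unit, fun _ => rfl, fun _ => rfl, fun e => coneCellAt c e⟩

/-- The cell into a universal proarrow determined by a cone. -/
noncomputable def coneLift (c : Cone (elementsDiagram M)) :
    SpanIn.Cell (S := S) (U.lift (coneLeft c)) (U.lift (coneRight c)) (SpanIn.hid c.pt)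
      (U.pro M) :=
  U.liftCell (x := c.pt) (y := c.pt) (coneCell c)

/-- At an apex element this is the factorisation of the cone through the universal cell. At a foot,
the leg condition of the lifted map of spans, whose domain has identity legs, reduces it to the
factorisation of arrows. -/
theorem coneLift_comp (c : Cone (elementsDiagram M)) (p : M.A.copresheaf.Elements) :
    (coneLift U c).hom ≫ (elementsCone M (U.pro M) (U.counitPro M)).π.app p = c.π.app p := by
  match p with
  | ⟨none, a⟩ =>
    exact congrArg (fun σ : (opFamQuiver κ (spanDbl S)).Sq
      (FamPro.single κ (D := spanDbl S) (SpanIn.hid c.pt)) M => σ.apexAt a)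
      (U.fac_cell (x := c.pt) (y := c.pt) (coneCell c))
  | ⟨some WalkingPair.left, i⟩ =>
    exact ((coneLift U c).hom_l_assoc _).trans ((Category.id_comp _).trans
      (lift_comp_counit U (coneLeft c) i))
  | ⟨some WalkingPair.right, i⟩ =>
    exact ((coneLift U c).hom_r_assoc _).trans ((Category.id_comp _).trans
      (lift_comp_counit U (coneRight c) i))

/-- An arrow into the apex is turned into a cell so that uniqueness of factorisations through the
universal cell can be applied. -/
theorem cell_hom_ext {t : S} {f g : t ⟶ SpanIn.apex (S := S) (U.pro M)}
    (h : ∀ p, f ≫ (elementsCone M (U.pro M) (U.counitPro M)).π.app p =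
      g ≫ (elementsCone M (U.pro M) (U.counitPro M)).π.app p) : f = g := by
  -- The cell has the identity span on `t` as domain, and its side arrows are forced to be the
  -- composites of `f` with the legs. They depend on `f`, which is why uniqueness is required for
  -- cells with arbitrary sides.
  let sq (f : t ⟶ SpanIn.apex (S := S) (U.pro M)) :
      (Proarrow.mk (D := spanDbl S) (SpanIn.hid t) : Proarrow (spanDbl S)) ⟶
        Proarrow.mk (U.pro M) :=
    (spanQuiver S).sq (m := SpanIn.hid t) (n := U.pro M)
      (f := f ≫ SpanIn.l (S := S) (U.pro M)) (g := f ≫ SpanIn.r (S := S) (U.pro M))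
      ⟨f, (Category.id_comp _).symm, (Category.id_comp _).symm⟩
  -- The hypothesis at the feet gives the side arrows after the counit, and at the apex elements the
  -- arrows of apexes.
  have key : sq f = sq g := U.cell_ext (OpFamCell.sq_single_ext (n := SpanIn.hid t) (M := M)
    (fun i => (Category.assoc _ _ _).trans
      ((h ⟨some WalkingPair.left, i⟩).trans (Category.assoc _ _ _).symm))
    (fun i => (Category.assoc _ _ _).trans
      ((h ⟨some WalkingPair.right, i⟩).trans (Category.assoc _ _ _).symm))
    (fun a => h ⟨none, a⟩))
  exact congrArg (fun σ : (spanQuiver S).Sq (SpanIn.hid t) (U.pro M) => σ.cell.hom) key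

variable (M) in
/-- The apex of a universal proarrow is a limit over the category of elements. -/
noncomputable def isLimitElementsCone : IsLimit (elementsCone M (U.pro M) (U.counitPro M)) where
  lift c := (coneLift U c).hom
  fac := coneLift_comp U
  uniq c _ h := cell_hom_ext U fun p => (h p).trans (coneLift_comp U c p).symm

variable (κ S) in
-- Nothing about the chosen adjoint is used beyond the universality of its counit, so no comparison
-- with the constructed products is necessary.
theorem laxProductsAreLimits : LaxProductsAreLimits κ S := fun _ adj =>
  ⟨fun X => ⟨isLimitFanCounit adj.universalTo X⟩,
    fun M => ⟨isLimitElementsCone adj.universalTo M⟩⟩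

end SpanLimits

/-! ### Colax coproducts of cospans -/

/-- The category `S` has coproducts indexed by the sets in `κ`. -/
class IndexClass.HasCoproducts (κ : IndexClass.{w}) (S : Type u) [Category.{v} S] : Prop where
  hasCoproductsOfShape : ∀ {I : Type w}, κ.mem I → HasCoproductsOfShape I S

/-- A family of cospans in `S`, indexed by a span of sets. -/
structure CospanFamily (S : Type u) [Category.{v} S] where
  I : Type w
  J : Type w
  A : Type w
  l₀ : A → I
  r₀ : A → J
  x : I → S
  y : J → S
  s : A → S
  l : ∀ a, x (l₀ a) ⟶ s a
  r : ∀ a, y (r₀ a) ⟶ s a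

/-! ### The coproduct of a family of cospans as a pushout -/

namespace CospanFamily

variable {S : Type u} [Category.{v} S] [HasPushouts S] [HasBinaryCoproducts S]
  (M : CospanFamily.{w} S) [HasCoproduct M.x] [HasCoproduct M.y] [HasCoproduct M.s]
  [HasCoproduct fun a => M.x (M.l₀ a) ⨿ M.y (M.r₀ a)]

/-- The coproduct of a family of cospans: the joint pushout of its members along the injections
into the coproducts of the feet. -/
noncomputable def coprodCospan : CospanIn (∐ M.x) (∐ M.y) where
  apex := pushout
    (Sigma.desc fun a => Limits.coprod.map (Sigma.ι M.x (M.l₀ a)) (Sigma.ι M.y (M.r₀ a)))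
    (Limits.Sigma.map fun a => coprod.desc (M.l a) (M.r a))
  l := coprod.inl ≫ pushout.inl _ _
  r := coprod.inr ≫ pushout.inl _ _

/-- The injection into the apex of the coproduct of a family of cospans. -/
noncomputable def apexInj (a : M.A) : M.s a ⟶ M.coprodCospan.apex :=
  Sigma.ι _ a ≫ pushout.inr _ _

/-- Restrict the pushout square along the first summand of the component at `a`. -/
theorem l_apexInj (a : M.A) :
    M.l a ≫ M.apexInj a = Sigma.ι M.x (M.l₀ a) ≫ M.coprodCospan.l := by
  have h := (coprod.inl ≫ Sigma.ι (fun a => M.x (M.l₀ a) ⨿ M.y (M.r₀ a)) a) ≫= pushout.condition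
    (f := Sigma.desc fun a => Limits.coprod.map (Sigma.ι M.x (M.l₀ a)) (Sigma.ι M.y (M.r₀ a)))
    (g := Limits.Sigma.map fun a => coprod.desc (M.l a) (M.r a))
  simp only [Category.assoc, Sigma.ι_map_assoc, Sigma.ι_desc_assoc, coprod.inl_desc_assoc,
    coprod.inl_map_assoc] at h
  exact h.symm

theorem r_apexInj (a : M.A) :
    M.r a ≫ M.apexInj a = Sigma.ι M.y (M.r₀ a) ≫ M.coprodCospan.r := by
  have h := (coprod.inr ≫ Sigma.ι (fun a => M.x (M.l₀ a) ⨿ M.y (M.r₀ a)) a) ≫= pushout.condition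
    (f := Sigma.desc fun a => Limits.coprod.map (Sigma.ι M.x (M.l₀ a)) (Sigma.ι M.y (M.r₀ a)))
    (g := Limits.Sigma.map fun a => coprod.desc (M.l a) (M.r a))
  simp only [Category.assoc, Sigma.ι_map_assoc, Sigma.ι_desc_assoc, coprod.inr_desc_assoc,
    coprod.inr_map_assoc] at h
  exact h.symm

/-- The legs and apex injections are jointly epic, because the pushout is covered by `∐ x ⨿ ∐ y` and
`∐ s`. The legs cannot be dropped, since some feet may be met by no member of the family. -/
theorem coprodCospan_hom_ext {t : S} {f g : M.coprodCospan.apex ⟶ t}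
    (hl : M.coprodCospan.l ≫ f = M.coprodCospan.l ≫ g)
    (hr : M.coprodCospan.r ≫ f = M.coprodCospan.r ≫ g)
    (h : ∀ a, M.apexInj a ≫ f = M.apexInj a ≫ g) : f = g :=
  pushout.hom_ext
    (Limits.coprod.hom_ext ((Category.assoc _ _ _).symm.trans (hl.trans (Category.assoc _ _ _)))
      ((Category.assoc _ _ _).symm.trans (hr.trans (Category.assoc _ _ _))))
    (Sigma.hom_ext _ _ fun a =>
      (Category.assoc _ _ _).symm.trans ((h a).trans (Category.assoc _ _ _)))

/-- The universal map out of the coproduct of a family of cospans. -/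
noncomputable def desc {x y : S} {n : CospanIn x y} {f : ∀ i, M.x i ⟶ x} {g : ∀ j, M.y j ⟶ y}
    (c : ∀ a, M.s a ⟶ n.apex) (hl : ∀ a, M.l a ≫ c a = f (M.l₀ a) ≫ n.l)
    (hr : ∀ a, M.r a ≫ c a = g (M.r₀ a) ≫ n.r) :
    CospanIn.Cell (Sigma.desc f) (Sigma.desc g) M.coprodCospan n where
  -- The copairing on the feet and the copairing `c` on the apexes agree on each summand `x (l₀ a) ⨿
  -- y (r₀ a)` by the leg conditions.
  hom := pushout.desc (coprod.desc (Sigma.desc f ≫ n.l) (Sigma.desc g ≫ n.r)) (Sigma.desc c)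
    (Sigma.hom_ext _ _ fun a => Limits.coprod.hom_ext
      (by simp [hl, coprod.inl_desc])
      (by simp [hr, coprod.inr_desc]))
  l_hom := (Category.assoc _ _ _).trans
    ((congrArg (coprod.inl ≫ ·) (pushout.inl_desc _ _ _)).trans (coprod.inl_desc _ _))
  r_hom := (Category.assoc _ _ _).trans
    ((congrArg (coprod.inr ≫ ·) (pushout.inl_desc _ _ _)).trans (coprod.inr_desc _ _))

theorem apexInj_desc {x y : S} {n : CospanIn x y} {f : ∀ i, M.x i ⟶ x} {g : ∀ j, M.y j ⟶ y}
    (c : ∀ a, M.s a ⟶ n.apex) (hl : ∀ a, M.l a ≫ c a = f (M.l₀ a) ≫ n.l)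
    (hr : ∀ a, M.r a ≫ c a = g (M.r₀ a) ≫ n.r) (a : M.A) :
    M.apexInj a ≫ (M.desc c hl hr).hom = c a :=
  (Category.assoc _ _ _).trans
    ((congrArg (Sigma.ι M.s a ≫ ·) (pushout.inr_desc _ _ _)).trans (Sigma.ι_desc _ _))

end CospanFamily

/-! ### Universality of coproducts in the double category of cospans -/

section CospanCoproducts

open DblCat

variable {κ : IndexClass.{w}} {S : Type u} [Category.{v} S] [HasPushouts S]

section Families

variable {x y : S} {n : CospanIn x y} {X Y : FamObj κ (cospanDbl S)} {M : FamPro X Y}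

theorem FamHom.single_ext {D : DblCat.{u₀, v₀, u₁, v₁}} {x : D.Obj} {X : FamObj κ D}
    {F G : FamHom X (FamObj.single κ x)} (h : ∀ i, F.f i = G.f i) : F = G := by
  obtain ⟨F₀, F⟩ := F
  obtain ⟨G₀, G⟩ := G
  obtain rfl : F₀ = G₀ := funext fun _ => rfl
  exact FamHom.mk_eq h

/-- The member `x (l a) ⟶ s a ⟵ y (r a)` of a family of cospans at an element `a` of the apex of
the indexing span. -/
abbrev cospanAt (M : FamPro X Y) (a : M.A.apex) :
    CospanIn (S := S) (X.x (M.A.l a)) (Y.x (M.A.r a)) :=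
  M.m ⟨a, rfl, rfl⟩

/-- The arrow of apexes underlying the component at `a` of a cell from a family of cospans to a
single cospan. -/
def DblQuiver.Sq.coapexAt
    (σ : (famQuiver κ (cospanDbl S)).Sq M (FamPro.single κ (D := cospanDbl S) n))
    (a : M.A.apex) : (cospanAt M a).apex ⟶ n.apex :=
  CospanIn.Cell.hom (S := S) (σ.cell.α ⟨a, rfl, rfl⟩)

/-- In covariant families the index maps point towards the single cospan and are therefore unique;
what remains is side arrows and arrows of apexes. -/
theorem FamCell.sq_single_ext
    {σ τ : (famQuiver κ (cospanDbl S)).Sq M (FamPro.single κ (D := cospanDbl S) n)}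
    (hl : ∀ i, σ.left.f i = τ.left.f i) (hr : ∀ j, σ.right.f j = τ.right.f j)
    (h : ∀ a, σ.coapexAt a = τ.coapexAt a) : σ = τ := by
  obtain ⟨F, G, σ⟩ := σ
  obtain ⟨F', G', τ⟩ := τ
  refine FamCell.sq_ext (FamHom.single_ext hl) (FamHom.single_ext hr) (fun _ => rfl) ?_
  rintro _ _ ⟨a, rfl, rfl⟩
  exact heq_of_sq (D := cospanDbl S) (CospanIn.sq_ext (hl _) (hr _) (h a))

end Families

/-- A family of objects of the double category of cospans, as a family of objects of `S`. -/
def FamObj.ofCospans (X : FamObj κ (cospanDbl S)) : X.I → S :=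
  X.x

/-- A family of proarrows of the double category of cospans, as a family of cospans in `S`. -/
def FamPro.cospanFamily {X Y : FamObj κ (cospanDbl S)} (M : FamPro X Y) : CospanFamily.{w} S where
  I := X.I
  J := Y.I
  A := M.A.apex
  l₀ := M.A.l
  r₀ := M.A.r
  x := X.ofCospans
  y := Y.ofCospans
  s a := (cospanAt M a).apex
  l a := (cospanAt M a).l
  r a := (cospanAt M a).r

variable [hκ : κ.HasCoproducts S]

namespace FamObj

variable (X : FamObj κ (cospanDbl S))

instance hasCoproduct : HasCoproduct X.ofCospans :=
  have := hκ.hasCoproductsOfShape X.memI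
  inferInstance

/-- The coproduct of a family of objects. -/
noncomputable def coprod : S :=
  ∐ X.ofCospans

/-- The injections into the coproduct of a family of objects. -/
noncomputable def inj : FamHom X (FamObj.single κ (D := cospanDbl S) X.coprod) :=
  ⟨fun _ => PUnit.unit, Sigma.ι X.ofCospans⟩

variable {X} {x : S}

/-- The arrow out of a coproduct determined by its components. -/
noncomputable def coprodDesc (F : FamHom X (FamObj.single κ (D := cospanDbl S) x)) :
    X.coprod ⟶ x :=
  Sigma.desc (f := X.ofCospans) F.f

theorem inj_coprodDesc (F : FamHom X (FamObj.single κ (D := cospanDbl S) x)) (i : X.I) :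
    X.inj.f i ≫ coprodDesc (S := S) F = F.f i :=
  Sigma.ι_desc (C := S) (f := X.ofCospans) F.f i

theorem coprod_hom_ext {f g : X.coprod ⟶ x} (h : ∀ i, X.inj.f i ≫ f = X.inj.f i ≫ g) : f = g :=
  Sigma.hom_ext _ _ h

end FamObj

variable [HasBinaryCoproducts S]

namespace FamPro

variable {X Y : FamObj κ (cospanDbl S)} (M : FamPro X Y)

instance hasCoproduct_x : HasCoproduct M.cospanFamily.x :=
  X.hasCoproduct

instance hasCoproduct_y : HasCoproduct M.cospanFamily.y :=
  Y.hasCoproduct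

/-- Used for the coproduct of the apexes and for that of the pairs `x (l a) ⨿ y (r a)`, both indexed
by the apex of the indexing span. -/
instance hasCoproduct_apex (f : M.cospanFamily.A → S) : HasCoproduct f :=
  have : HasCoproductsOfShape M.cospanFamily.A S := hκ.hasCoproductsOfShape M.memA
  inferInstance

/-- The coproduct of a family of cospans. -/
noncomputable def coprod : CospanIn X.coprod Y.coprod :=
  M.cospanFamily.coprodCospan

/-- The injection into the coproduct of a family of cospans of the member at an element of the
indexing span. -/
noncomputable def injAt : ∀ {i : X.I} {j : Y.I} (e : M.A.El i j),
    CospanIn.Cell (S := S) (X.inj.f i) (Y.inj.f j) (M.m e) M.coprod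
  | _, _, ⟨a, rfl, rfl⟩ =>
    ⟨M.cospanFamily.apexInj a, M.cospanFamily.l_apexInj a, M.cospanFamily.r_apexInj a⟩

/-- The injections into the coproduct of a family of cospans. -/
noncomputable def inj : FamCell X.inj Y.inj M (FamPro.single κ (D := cospanDbl S) M.coprod) :=
  ⟨fun _ => PUnit.unit, fun _ => rfl, fun _ => rfl, fun e => M.injAt e⟩

variable {M} {x y : S} {n : CospanIn x y}

/-- The map of cospans out of a coproduct determined by its components. -/
noncomputable def coprodDesc {F : FamHom X (FamObj.single κ (D := cospanDbl S) x)}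
    {G : FamHom Y (FamObj.single κ (D := cospanDbl S) y)}
    (α : FamCell F G M (FamPro.single κ (D := cospanDbl S) n)) :
    CospanIn.Cell (FamObj.coprodDesc F) (FamObj.coprodDesc G) M.coprod n :=
  M.cospanFamily.desc (fun a => CospanIn.Cell.hom (S := S) (α.α ⟨a, rfl, rfl⟩))
    (fun a => CospanIn.Cell.l_hom (S := S) (α.α ⟨a, rfl, rfl⟩))
    (fun a => CospanIn.Cell.r_hom (S := S) (α.α ⟨a, rfl, rfl⟩))

theorem inj_coprodDesc {F : FamHom X (FamObj.single κ (D := cospanDbl S) x)}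
    {G : FamHom Y (FamObj.single κ (D := cospanDbl S) y)}
    (α : FamCell F G M (FamPro.single κ (D := cospanDbl S) n)) (a : M.A.apex) :
    ((famQuiver κ (cospanDbl S)).sq M.inj).coapexAt a ≫ (coprodDesc α).hom =
      ((famQuiver κ (cospanDbl S)).sq α).coapexAt a :=
  M.cospanFamily.apexInj_desc _ _ _ a

/-- Fixed side arrows prescribe the restrictions to the legs, leaving only those to the members of
the family. -/
theorem coprod_cell_ext {f : X.coprod ⟶ x} {g : Y.coprod ⟶ y}
    {α β : CospanIn.Cell f g M.coprod n}
    (h : ∀ a, ((famQuiver κ (cospanDbl S)).sq M.inj).coapexAt a ≫ α.hom =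
      ((famQuiver κ (cospanDbl S)).sq M.inj).coapexAt a ≫ β.hom) : α = β :=
  CospanIn.Cell.ext (M.cospanFamily.coprodCospan_hom_ext (α.l_hom.trans β.l_hom.symm)
    (α.r_hom.trans β.r_hom.symm) h)

end FamPro

variable (κ S) in
/-- The coproducts of objects and of cospans are universal. -/
noncomputable def cospanUniversalFrom : (delta κ (cospanDbl S)).UniversalFrom where
  obj X := FamObj.coprod (S := S) X
  unit X := FamObj.inj (S := S) X
  desc f := FamObj.coprodDesc (S := S) f
  fac f := FamHom.single_ext fun i => FamObj.inj_coprodDesc (S := S) f i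
  arrow_ext {X x _ _} h := FamObj.coprod_hom_ext (S := S) fun i =>
    congrArg (β := X.x i ⟶ (x : S))
      (fun F : FamHom X (FamObj.single κ (D := cospanDbl S) x) => F.f i) h
  pro M := FamPro.coprod M
  unitPro M := FamPro.inj M
  descCell α := FamPro.coprodDesc (S := S) α
  fac_cell {x y X Y f g m M} α := FamCell.sq_single_ext (n := m) (M := M)
    (fun i => FamObj.inj_coprodDesc (S := S) f i) (fun i => FamObj.inj_coprodDesc (S := S) g i)
    (fun a => FamPro.inj_coprodDesc (S := S) (n := m) (M := M) α a)
  cell_ext {P X Y M a b} h := by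
    obtain ⟨f, g, a⟩ := a
    obtain ⟨f', g', b⟩ := b
    -- Side arrows out of coproducts are compared on injections first, so that the two cells acquire
    -- a common type.
    have hf : f = f' := FamObj.coprod_hom_ext (S := S) fun i => congrArg (β := (_ : S) ⟶ _)
      (fun σ : (famQuiver κ (cospanDbl S)).Sq M (FamPro.single κ (D := cospanDbl S) P.pro) =>
        σ.left.f i) h
    have hg : g = g' := FamObj.coprod_hom_ext (S := S) fun i => congrArg (β := (_ : S) ⟶ _)
      (fun σ : (famQuiver κ (cospanDbl S)).Sq M (FamPro.single κ (D := cospanDbl S) P.pro) =>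
        σ.right.f i) h
    subst hf hg
    refine congrArg _ (FamPro.coprod_cell_ext (α := a) (β := b) fun e => ?_)
    exact congrArg (fun σ : (famQuiver κ (cospanDbl S)).Sq M
      (FamPro.single κ (D := cospanDbl S) P.pro) => σ.coapexAt e) h

variable (κ S) in
theorem hasColaxCoproducts_cospanDbl : HasColaxCoproducts κ (cospanDbl S) :=
  ⟨_, ⟨(cospanUniversalFrom κ S).adjunction (deltaComparisonInverse κ (cospanDbl S))⟩⟩

end CospanCoproducts

/-! ### Assembly of the small and finite cases -/

theorem mainTheorem4 (S : Type u) [Category.{v} S] :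
    (∀ [HasLimitsOfSize.{w, w} S],
      haveI : HasFiniteLimits S := hasFiniteLimits_of_hasLimitsOfSize.{w, w} S
      HasLaxProducts IndexClass.all.{w} (spanDbl S) ∧
        LaxProductsAreLimits IndexClass.all.{w} S) ∧
    (∀ [HasFiniteLimits S],
      HasLaxProducts IndexClass.finite.{w} (spanDbl S) ∧
        LaxProductsAreLimits IndexClass.finite.{w} S) ∧
    (∀ [HasColimitsOfSize.{w, w} S],
      haveI : HasFiniteColimits S := hasFiniteColimits_of_hasColimitsOfSize.{w, w} S
      HasColaxCoproducts IndexClass.all.{w} (cospanDbl S)) ∧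
    (∀ [HasFiniteColimits S],
      HasColaxCoproducts IndexClass.finite.{w} (cospanDbl S)) := by
  refine ⟨?_, ?_, ?_, ?_⟩
  · intro _
    have : HasFiniteLimits S := hasFiniteLimits_of_hasLimitsOfSize.{w, w} S
    -- Products indexed by types in universe `w` are among the limits of size `w`; the pullbacks and
    -- binary products come from finite limits.
    have : IndexClass.all.{w}.HasProducts S := ⟨fun _ => inferInstance⟩
    exact ⟨hasLaxProducts_spanDbl _ S, laxProductsAreLimits _ S⟩
  · intro _
    have : IndexClass.finite.{w}.HasProducts S :=
      -- Membership in the finite index class is finiteness by definition, and this makes the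
      -- finite-product instance available for sets in any universe.
      ⟨fun {I} (_ : Finite I) => inferInstance⟩
    exact ⟨hasLaxProducts_spanDbl _ S, laxProductsAreLimits _ S⟩
  · intro _
    have : HasFiniteColimits S := hasFiniteColimits_of_hasColimitsOfSize.{w, w} S
    have : IndexClass.all.{w}.HasCoproducts S := ⟨fun _ => inferInstance⟩
    exact hasColaxCoproducts_cospanDbl _ S
  · intro _
    have : IndexClass.finite.{w}.HasCoproducts S :=
      ⟨fun {I} (_ : Finite I) => inferInstance⟩
    exact hasColaxCoproducts_cospanDbl _ S
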